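/- Let $\mathbb{F}_q$ be a finite field of characteristic $p\ge 5$, let $K=\mathbb{F}_q(t)$, let $d\ge 2$ be an integer coprime to $q$, and let $E_d/K$ be the elliptic curve $y^2+xy-t^d y=x^3$. Its $L$-function is the power series $$L(E_d/K,T)=\prod_{v\text{ good}}\bigl(1-a_vT^{\deg v}+q_vT^{2\deg v}\bigr)^{-1}\prod_{v\text{ bad}}\bigl(1-a_vT^{\deg v}\bigr)^{-1}\in\mathbb{Z}[[T]],$$ where $v$ runs over the places of $K$ (good or bad according to the reduction of $E_d$ at $v$), $q_v$ is the cardinality of the residue field at $v$, and $a_v=q_v+1-|(\widetilde{E_d})_v(\mathbb{F}_{q_v})|$, with $(\widetilde{E_d})_v$ the plane cubic obtained by reducing modulo $v$ a minimal integral Weierstrass model of $E_d$ at $v$. Let $\overline{\mathbb{Z}}$ be the ring of algebraic integers in an algebraic closure $\overline{\mathbb{Q}}$ of $\mathbb{Q}$ and let $\mathfrak{P}$ be a prime ideal of $\overline{\mathbb{Z}}$ above $p$; regard the fields $\mathbb{F}_{q^n}$ as subfields of $\overline{\mathbb{Z}}/\mathfrak{P}=\overline{\mathbb{F}}_p$.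 For $x\in\overline{\mathbb{F}}_p^\times$ let $\mathbf{t}(x)\in\overline{\mathbb{Z}}$ be the unique root of unity of order prime to $p$ that reduces to $x$. Let $G_d=\{(a_0,a_1,a_2,a_3)\in(\mathbb{Z}/d\mathbb{Z})^4: a_0+a_1+a_2+a_3=0\}$, on which $q$ acts by multiplication. For $\mathbf{a}=(a_0,\dots,a_3)\in G_d\smallsetminus\{0\}$ with orbit $\mathbf{A}=\{\mathbf{a},q\mathbf{a},q^2\mathbf{a},\dots\}$, put $r=q^{|\mathbf{A}|}$ and let $\chi_i$ be the character $x\mapsto\mathbf{t}(x)^{(r-1)a_i/d}$ of $\mathbb{F}_r^\times$, extended to $\mathbb{F}_r$ by $\chi_i(0)=0$ if $\chi_i$ is nontrivial and $\chi_i(0)=1$ if $\chi_i$ is trivial. Put $$J'(\mathbf{a})=\frac{1}{r-1}\sum_{\substack{x_0,\dots,x_3\in\mathbb{F}_r\\ x_0+x_1+x_2+x_3=0}}\chi_0(x_0)\chi_1(x_1)\chi_2(x_2)\chi_3(x_3).$$ (In particular $J'(\mathbf{a})=0$ if some but not all of the $a_i$ are $0$.) For a subset $\Lambda\subset G_d\smallsetminus\{0\}$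 stable under multiplication by $(\mathbb{Z}/d\mathbb{Z})^\times$, let $$P(\Lambda,T)=\prod_{\mathbf{A}}\bigl(1-J'(\mathbf{a})\,T^{|\mathbf{A}|}\bigr),$$ where $\mathbf{A}$ runs over the orbits of multiplication by $q$ on $\Lambda$, and $\mathbf{a}$ is any representative of $\mathbf{A}$. Finally let $\Lambda_d=\{(m,m,m,-3m): m\in\mathbb{Z}/d\mathbb{Z}\}\smallsetminus\{0\}\subset G_d$. Then the infinite product defining $L(E_d/K,T)$ converges in $\mathbb{Z}[[T]]$, and $$L(E_d/K,T)=P(\Lambda_d,T)\in\mathbb{Z}[T].$$ Consequently $L^*(E_d/K,1)=P^*(\Lambda_d)$, where, for $f=L(E_d/K,T)$ and $f=P(\Lambda_d,T)$ respectively, the special value is $\dfrac{f(T)}{(1-qT)^{\rho}}\Big|_{T=q^{-1}}$ with $\rho=\operatorname{ord}_{T=q^{-1}}f$. -/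

import Mathlib

open scoped PowerSeries.WithPiTopology Polynomial

noncomputable section

namespace HessianCurve

/-! ### Places of the rational function field -/

/-- A place of `K = F(t)`: a discrete valuation ring of `K` that contains the constants `F`
(its field of fractions is `K`, because it is a valuation subring of `K`). -/
structure Place (F : Type*) [Field F] where
  /-- the valuation ring of the place -/
  ring : ValuationSubring (RatFunc F)
  const_mem : ∀ c : F, RatFunc.C c ∈ ring
  isDVR : IsDiscreteValuationRing ring

attribute [instance] Place.isDVR

variable {F : Type*} [Field F]

/-- The residue field at a place. -/
abbrev Place.residueField (v : Place F) : Type _ := IsLocalRing.ResidueField v.ring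

/-- The embedding of the constants into the residue field. -/
def Place.constHom (v : Place F) : F →+* v.residueField :=
  (IsLocalRing.residue v.ring).comp (RatFunc.C.codRestrict v.ring.toSubring v.const_mem)

/-- The degree of a place: the degree of its residue field over the field of constants. -/
def Place.deg (v : Place F) : ℕ :=
  letI := v.constHom.toAlgebra
  Module.finrank F v.residueField

/-- The cardinality `q_v` of the residue field. -/
def Place.card (v : Place F) : ℕ := Nat.card v.residueField

/-! ### The `L`-function of a Weierstrass curve over `F(t)` -/

/-- The number of rational points of the plane projective Weierstrass cubic (smooth or not):
all affine solutions of the equation, and the unique point `[0 : 1 : 0]` at infinity. -/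
def cubicPointCount {k : Type*} [Field k] (W : WeierstrassCurve k) : ℕ :=
  Nat.card {P : k × k // W.toAffine.Equation P.1 P.2} + 1

/-- `a_v = q_v + 1 - |Ẽ_v(𝔽_{q_v})|`, where `Ẽ_v` is the reduction at `v` of a minimal integral
model of `W` at `v`. -/
def traceAt (W : WeierstrassCurve (RatFunc F)) (v : Place F) : ℤ :=
  (v.card : ℤ) + 1 - (cubicPointCount ((W.minimal v.ring).reduction v.ring) : ℤ)

open Classical in
/-- The polynomial `1 - a_v T^{deg v} + q_v T^{2 deg v}` if `W` has good reduction at `v`, and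
`1 - a_v T^{deg v}` if it has bad reduction. -/
def eulerPolynomial (W : WeierstrassCurve (RatFunc F)) (v : Place F) : ℤ[X] :=
  if (W.minimal v.ring).HasGoodReduction v.ring then
    1 - Polynomial.C (traceAt W v) * Polynomial.X ^ v.deg
      + Polynomial.C (v.card : ℤ) * Polynomial.X ^ (2 * v.deg)
  else
    1 - Polynomial.C (traceAt W v) * Polynomial.X ^ v.deg

/-- The Euler factor at `v`: the inverse in `ℤ⟦T⟧` of the polynomial above (whose constant
coefficient is `1`). -/
def eulerFactor (W : WeierstrassCurve (RatFunc F)) (v : Place F) : PowerSeries ℤ :=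
  PowerSeries.invOfUnit (eulerPolynomial W v : PowerSeries ℤ) 1

/-- `L(W/K, T) ∈ ℤ⟦T⟧`: the product of all Euler factors, for the topology of coefficientwise
(discrete) convergence on `ℤ⟦T⟧`. -/
def LFunction (W : WeierstrassCurve (RatFunc F)) : PowerSeries ℤ :=
  ∏' v : Place F, eulerFactor W v

/-- The Weierstrass curve `y² + x y - t^d y = x³` over `F(t)`. -/
def hessian (F : Type*) [Field F] (d : ℕ) : WeierstrassCurve (RatFunc F) where
  a₁ := 1
  a₂ := 0
  a₃ := -RatFunc.X ^ d
  a₄ := 0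
  a₆ := 0

/-! ### Special values -/

/-- For a polynomial `f ≠ 0`, the value at `T = q⁻¹` of `f(T) / (1 - q T)^ρ`, where `ρ` is the
order of vanishing of `f` at `T = q⁻¹`. The division of polynomials is exact. -/
def polySpecialValue {k : Type*} [Field k] (q : ℕ) (f : k[X]) : k :=
  (f / (1 - Polynomial.C (q : k) * Polynomial.X) ^ f.rootMultiplicity (q : k)⁻¹).eval (q : k)⁻¹

open Classical in
/-- `L*(W/K, 1)`: the special value at `T = q⁻¹` of `L(W/K, T)`, when that power series is
a polynomial (and `0` otherwise). Here `q` is the cardinality of `F`. -/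
def LSpecialValue (W : WeierstrassCurve (RatFunc F)) : ℚ :=
  if h : ∃ f : ℤ[X], (f : PowerSeries ℤ) = LFunction W then
    polySpecialValue (Nat.card F) (h.choose.map (Int.castRingHom ℚ))
  else 0

/-! ### The group `G_d`, the action of `q`, the subset `Λ_d` -/

/-- `G_d = {(a₀, a₁, a₂, a₃) ∈ (ℤ/dℤ)⁴ : a₀ + a₁ + a₂ + a₃ = 0}`. -/
def G (d : ℕ) : AddSubgroup (Fin 4 → ZMod d) where
  carrier := {a | ∑ i, a i = 0}
  zero_mem' := by simp
  add_mem' := by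
    intro a b ha hb
    simp only [Set.mem_ofPred_eq] at ha hb ⊢
    simp [Finset.sum_add_distrib, ha, hb]
  neg_mem' := by
    intro a ha
    simp only [Set.mem_ofPred_eq] at ha ⊢
    simp [ha]

/-- The orbit `{a, q a, q² a, …}`. -/
def orbit {d : ℕ} (q : ℕ) (a : G d) : Set (G d) := Set.range fun k : ℕ => q ^ k • a

/-- `Λ_d = {(m, m, m, -3m) : m ∈ ℤ/dℤ} ∖ {0}`. -/
def Lam (d : ℕ) : Set (G d) :=
  {a | ∃ m : ZMod d, (a : Fin 4 → ZMod d) = ![m, m, m, -3 * m]} \ {0}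

/-! ### Teichmüller character, Jacobi sums, and the polynomial `P(Λ, T)` -/

variable {Qbar : Type*} [Field Qbar]

/-- The Teichmüller lift of `x ∈ ℤ̄/𝔓`, `x ≠ 0`: the root of unity of order prime to `q`
(equivalently, prime to the residue characteristic) in `ℤ̄` whose reduction modulo `𝔓` is `x`. -/
def teich (𝔓 : Ideal (integralClosure ℤ Qbar)) (q : ℕ) (x : integralClosure ℤ Qbar ⧸ 𝔓) :
    integralClosure ℤ Qbar :=
  Function.invFunOn (Ideal.Quotient.mk 𝔓) {z | ∃ n : ℕ, 0 < n ∧ n.Coprime q ∧ z ^ n = 1} x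

open Classical in
/-- The character `x ↦ teich(x)^{(r - 1) a / d}` of `𝔽_r^×`, with `a` lifted to `{0, …, d - 1}`,
where `𝔽_r = {x ∈ ℤ̄/𝔓 : x ^ r = x}` and `r a = a` in `ℤ/dℤ`, extended to `𝔽_r` by the value `0` at
`x = 0` if the character is nontrivial (that is, if `a ≠ 0`) and by the value `1` if it is
trivial. -/
def chi (𝔓 : Ideal (integralClosure ℤ Qbar)) (q r : ℕ) {d : ℕ} (a : ZMod d)
    (x : integralClosure ℤ Qbar ⧸ 𝔓) : Qbar :=
  if x = 0 then (if a = 0 then 1 else 0)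
  else (teich 𝔓 q x : Qbar) ^ ((r - 1) * a.val / d)

/-- The Jacobi sum `J'(a)`: with `r = q^{|A|}`, where `|A|` is the length of the orbit of `a`,
it is `1 / (r - 1)` times the (finite) sum of `χ₀(x₀) χ₁(x₁) χ₂(x₂) χ₃(x₃)` over all
`x₀, …, x₃ ∈ 𝔽_r` such that `x₀ + x₁ + x₂ + x₃ = 0`. -/
def jacobi (𝔓 : Ideal (integralClosure ℤ Qbar)) (q : ℕ) {d : ℕ} (a : G d) : Qbar :=
  (((q ^ (orbit q a).ncard : ℕ) : Qbar) - 1)⁻¹ *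
    ∑ᶠ x ∈ {x : Fin 4 → integralClosure ℤ Qbar ⧸ 𝔓 |
        (∀ i, x i ^ (q ^ (orbit q a).ncard) = x i) ∧ ∑ i, x i = 0},
      ∏ i, chi 𝔓 q (q ^ (orbit q a).ncard) ((a : Fin 4 → ZMod d) i) (x i)

/-- `P(Λ, T)`: the product over the orbits `A` of multiplication by `q` on `Λ` of
`1 - J'(a) T^{|A|}`, where `a` is a representative of `A`. -/
def P (𝔓 : Ideal (integralClosure ℤ Qbar)) (q : ℕ) {d : ℕ} (Λ : Set (G d)) : Qbar[X] :=
  ∏ᶠ A ∈ orbit q '' Λ,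
    (1 - Polynomial.C (jacobi 𝔓 q (Classical.epsilon fun a => a ∈ A)) * Polynomial.X ^ A.ncard)

end HessianCurve

end

/-! Both sides are power series with constant term 1 over a field of characteristic zero, so it
suffices to compare the coefficients of their logarithmic derivatives `T f'/f`
(`IsLogDeriv.unique`). Fix `n ≥ 1` and let `E` be the extension of `𝔽_q` of degree `n`.

On the side of `P`, an orbit of length `l` contributes `-l J^(n/l)` when `l ∣ n`. By
Hasse-Davenport, `J^(n/l)` is the Jacobi sum with the same exponents formed over `E`
(`jacobiAt_lift`), and Frobenius invariance makes it independent of the representative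
(`jacobiAt_frobenius`). The coefficient is therefore minus the sum of the Jacobi sums over `E` of
`(m, m, m, -3m)`, over all `m ≠ 0` with `q^n m = m`.

On the side of `L`, the coefficient collects power sums of local Frobenius eigenvalues. Away from
characteristics 2 and 3 these are quadratic character sums of a cubic over extensions of the residue
field, at good and bad places alike (`powerSum_eq_neg_sum`). Grouping the points of the projective
line over `E` by places turns the coefficient into minus a sum of fibre contributions `frobSum`
(`coeff_logDeriv_LFunction_hessian`). The fibre at infinity is `y² - y = x³` if `3 ∣ d`, and
cuspidal with contribution 0 otherwise.

Hasse-Davenport and `powerSum_eq_neg_sum` come from one device. A completely multiplicative function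
on monic polynomials has a generating series with an Euler product, hence satisfies Newton's
identity `natCast_mul_monicSum`, and its prime sums are sums over the elements of an extension. For
Gauss sums the series is `1 + g T`; for the quadratic character of a resultant with a cubic it is `1
+ S₁ T + S₂ T²`.

What remains is an identity over the single finite field `E` (`sum_frobSum_eq_sum_jacobiAt`). The
equation of the curve is linear in `a = t^d`, so expanding the number of `d`-th roots of `a` in
characters `χ` gives sums of `χ((y² + xy - x³)/y)`. Monomial substitutions identify these with
Jacobi sums when `3m ≠ 0`. When `3m = 0` the Jacobi sum vanishes, and the fibre at infinity cancels
the leftover term. -/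

noncomputable section

namespace HessianCurve

/-! ### Completely multiplicative functions on monic polynomials over a finite field -/

section MonicSums

open Polynomial Finset

variable {k : Type*} [Field k]

/-- The monic polynomial of degree `n` with given lower coefficients. -/
def ofCoeffs {n : ℕ} (a : Fin n → k) : k[X] := X ^ n + ∑ i, C (a i) * X ^ (i : ℕ)

lemma degree_ofCoeffs_tail {n : ℕ} (a : Fin n → k) :
    (∑ i, C (a i) * X ^ (i : ℕ) : k[X]).degree < n := by
  exact degree_sum_fin_lt a

lemma ofCoeffs_monic {n : ℕ} (a : Fin n → k) : (ofCoeffs a).Monic :=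
  monic_X_pow_add (degree_ofCoeffs_tail a)

lemma natDegree_ofCoeffs {n : ℕ} (a : Fin n → k) : (ofCoeffs a).natDegree = n := by
  rw [ofCoeffs, natDegree_add_eq_left_of_degree_lt, natDegree_X_pow]
  rw [degree_X_pow]
  exact degree_ofCoeffs_tail a

lemma coeff_ofCoeffs {n : ℕ} (a : Fin n → k) (i : Fin n) : (ofCoeffs a).coeff i = a i := by
  have : ((i : ℕ) = n) = False := by simp [i.2.ne]
  simp [ofCoeffs, coeff_X_pow, this, Fin.val_inj]

lemma ofCoeffs_coeff {n : ℕ} {g : k[X]} (hg : g.Monic) (hn : g.natDegree = n) :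
    ofCoeffs (fun i : Fin n => g.coeff i) = g := by
  ext j
  rcases lt_trichotomy j n with h | h | h
  · exact coeff_ofCoeffs _ (⟨j, h⟩ : Fin n)
  · subst h
    have h1 := (ofCoeffs_monic (fun i : Fin j => g.coeff i)).coeff_natDegree
    rw [natDegree_ofCoeffs] at h1
    rw [h1, ← hn, hg.coeff_natDegree]
  · rw [coeff_eq_zero_of_natDegree_lt, coeff_eq_zero_of_natDegree_lt]
    · omega
    · rwa [natDegree_ofCoeffs]

variable [Fintype k]

open Classical in
/-- The finite set of monic polynomials of degree `n`. -/
def monics (k : Type*) [Field k] [Fintype k] (n : ℕ) : Finset k[X] :=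
  univ.image (ofCoeffs (k := k) (n := n))

lemma mem_monics {n : ℕ} {g : k[X]} : g ∈ monics k n ↔ g.Monic ∧ g.natDegree = n := by
  classical
  simp only [monics, mem_image, mem_univ, true_and]
  constructor
  · rintro ⟨a, rfl⟩
    exact ⟨ofCoeffs_monic a, natDegree_ofCoeffs a⟩
  · rintro ⟨h1, h2⟩
    exact ⟨_, ofCoeffs_coeff h1 h2⟩

lemma sum_monics {n : ℕ} {R : Type*} [AddCommMonoid R] (f : k[X] → R) :
    ∑ g ∈ monics k n, f g = ∑ a : Fin n → k, f (ofCoeffs a) := by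
  classical
  rw [monics, sum_image]
  intro a _ b _ h
  ext i
  rw [← coeff_ofCoeffs a, h, coeff_ofCoeffs]

lemma monics_zero : monics k 0 = {1} := by
  ext g
  rw [mem_monics, mem_singleton]
  constructor
  · rintro ⟨h, h2⟩
    exact h.natDegree_eq_zero.mp h2
  · rintro rfl
    simp

open Classical in
/-- The finite set of monic irreducible polynomials of degree at most `N`. -/
def irredsLE (k : Type*) [Field k] [Fintype k] (N : ℕ) : Finset k[X] :=
  ((range (N + 1)).biUnion (monics k)).filter Irreducible

lemma mem_irredsLE {N : ℕ} {g : k[X]} :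
    g ∈ irredsLE k N ↔ g.Monic ∧ Irreducible g ∧ g.natDegree ≤ N := by
  classical
  simp only [irredsLE, mem_filter, mem_biUnion, mem_range, mem_monics]
  constructor
  · rintro ⟨⟨a, h1, h2, h3⟩, h4⟩
    exact ⟨h2, h4, by omega⟩
  · rintro ⟨h1, h2, h3⟩
    exact ⟨⟨_, by omega, h1, rfl⟩, h2⟩

omit [Fintype k] in
lemma multiplicity_of_irreducible {P Q : k[X]} (hP : P.Monic) (hQ : Q.Monic)
    (hiP : Irreducible P) (hiQ : Irreducible Q) [Decidable (P = Q)] :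
    multiplicity P Q = if P = Q then 1 else 0 := by
  split_ifs with h
  · subst h
    exact multiplicity_self
  · apply multiplicity_eq_zero.mpr
    intro hd
    exact h (eq_of_monic_of_associated hP hQ (hiP.associated_of_dvd hiQ hd))

omit [Fintype k] in
lemma finiteMultiplicity_monic {P g : k[X]} (hiP : Irreducible P) (hg : g.Monic) :
    FiniteMultiplicity P g :=
  FiniteMultiplicity.of_not_isUnit hiP.not_isUnit hg.ne_zero

/-- Unique factorization counted by degree: induct by splitting off one monic irreducible factor.
The bound `N` is independent of `g` so that a single index set of primes serves all `g` of a given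
degree. -/
lemma sum_natDegree_mul_multiplicity (N : ℕ) (g : k[X]) (hg : g.Monic) (hN : g.natDegree ≤ N) :
    ∑ P ∈ irredsLE k N, P.natDegree * multiplicity P g = g.natDegree := by
  classical
  induction h : g.natDegree using Nat.strong_induction_on generalizing g with
  | _ n ih =>
    by_cases h0 : g = 1
    · subst h0
      rw [natDegree_one] at h
      subst h
      refine Finset.sum_eq_zero fun P hP => ?_
      rw [mem_irredsLE] at hP
      rw [multiplicity_eq_zero.mpr, mul_zero]
      exact fun hd => hP.2.1.not_isUnit (isUnit_of_dvd_one hd)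
    · obtain ⟨Q, hQm, hQi, hQd⟩ := exists_monic_irreducible_factor g
        (fun hu => h0 (hg.eq_one_of_isUnit hu))
      obtain ⟨t, rfl⟩ := hQd
      have ht : t.Monic := hQm.of_mul_monic_left hg
      have hd : (Q * t).natDegree = Q.natDegree + t.natDegree := hQm.natDegree_mul ht
      have hpos := hQi.natDegree_pos
      have := ih t.natDegree (by omega) t ht (by omega) rfl
      rw [← h, hd, ← this]
      have hQN : Q ∈ irredsLE k N := mem_irredsLE.mpr ⟨hQm, hQi, by omega⟩
      have key : ∀ P ∈ irredsLE k N, P.natDegree * multiplicity P (Q * t) =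
          (if P = Q then Q.natDegree else 0) + P.natDegree * multiplicity P t := by
        intro P hP
        rw [mem_irredsLE] at hP
        rw [multiplicity_mul hP.2.1.prime (finiteMultiplicity_monic hP.2.1 hg),
          multiplicity_of_irreducible hP.1 hQm hP.2.1 hQi]
        split_ifs with hh
        · subst hh; ring
        · ring
      rw [sum_congr rfl key, sum_add_distrib]
      simp [hQN]

/-! ### Newton's identities for multiplicative functions on monic polynomials -/

section Newton

variable {R : Type*} [CommRing R]

/-- The sum of the values of `lam` over the monic polynomials of degree `n`. -/
def monicSum (lam : k[X] → R) (n : ℕ) : R := ∑ g ∈ monics k n, lam g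

open Classical in
/-- The sum of `deg P * lam(P) ^ (j / deg P)` over the monic irreducible polynomials `P` of degree
dividing `j`. -/
def primeSum (lam : k[X] → R) (j : ℕ) : R :=
  ∑ P ∈ (irredsLE k j).filter (fun P => P.natDegree ∣ j), P.natDegree * lam P ^ (j / P.natDegree)

omit [Fintype k] in
-- Rewrites a multiplicity as a count of exponents, so that the sum over `g` can be exchanged with
-- the sum over prime powers. The range up to `N` suffices because a multiplicity is at most the
-- degree of `g`.
lemma card_pow_dvd_Icc {P g : k[X]} {N : ℕ} (hP : Irreducible P) (hg : g.Monic)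
    (hN : g.natDegree ≤ N) [∀ e, Decidable (P ^ e ∣ g)] :
    ((Icc 1 N).filter fun e => P ^ e ∣ g).card = multiplicity P g := by
  have hf := finiteMultiplicity_monic hP hg
  have : (Icc 1 N).filter (fun e => P ^ e ∣ g) = Icc 1 (multiplicity P g) := by
    ext e
    simp only [mem_filter, mem_Icc, hf.pow_dvd_iff_le_multiplicity]
    have : multiplicity P g ≤ g.natDegree := by
      have h1 := natDegree_le_of_dvd (pow_multiplicity_dvd P g) hg.ne_zero
      rw [natDegree_pow] at h1
      have := hP.natDegree_pos
      nlinarith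
    omega
  rw [this, Nat.card_Icc, Nat.add_sub_cancel]

lemma sum_dvd_monics (lam : k[X] → R)
    (hmul : ∀ g h : k[X], g.Monic → h.Monic → lam (g * h) = lam g * lam h)
    {Q : k[X]} (hQ : Q.Monic) (n : ℕ) [DecidablePred fun g : k[X] => Q ∣ g] :
    ∑ g ∈ (monics k n).filter (fun g => Q ∣ g), lam g =
      if Q.natDegree ≤ n then lam Q * monicSum lam (n - Q.natDegree) else 0 := by
  split_ifs with h
  · rw [monicSum, mul_sum]
    symm
    refine sum_bij (fun g _ => Q * g) ?_ ?_ ?_ ?_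
    · intro g hg
      rw [mem_monics] at hg
      rw [mem_filter, mem_monics]
      exact ⟨⟨hQ.mul hg.1, by rw [hQ.natDegree_mul hg.1]; omega⟩, dvd_mul_right _ _⟩
    · intro a _ b _ hab
      exact mul_left_cancel₀ hQ.ne_zero hab
    · intro g hg
      rw [mem_filter, mem_monics] at hg
      obtain ⟨⟨h1, h2⟩, t, rfl⟩ := hg
      have ht := hQ.of_mul_monic_left h1
      rw [hQ.natDegree_mul ht] at h2
      exact ⟨t, mem_monics.mpr ⟨ht, by omega⟩, rfl⟩
    · intro g hg
      rw [mem_monics] at hg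
      rw [hmul _ _ hQ hg.1]
  · refine sum_eq_zero fun g hg => ?_
    rw [mem_filter, mem_monics] at hg
    have := natDegree_le_of_dvd hg.2 hg.1.1.ne_zero
    omega

/-- This is `T Z' = Z · (T Z'/Z)` for the Euler product `Z = ∏ (1 - lam(P) T^(deg P))⁻¹`, read off
coefficientwise. Write the degree of each `g` as the sum of `deg P` over prime powers `P^e` dividing
`g`, and sum first over the multiples of a fixed `P^e`, which carry the factor `lam(P)^e`. -/
theorem natCast_mul_monicSum (lam : k[X] → R) (h1 : lam 1 = 1)
    (hmul : ∀ g h : k[X], g.Monic → h.Monic → lam (g * h) = lam g * lam h) (n : ℕ) :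
    (n : R) * monicSum lam n = ∑ j ∈ Icc 1 n, primeSum lam j * monicSum lam (n - j) := by
  classical
  have hpow : ∀ (P : k[X]) (e : ℕ), P.Monic → lam (P ^ e) = lam P ^ e := by
    intro P e hP
    induction e with
    | zero => simp [h1]
    | succ e ih => rw [pow_succ, hmul _ _ (hP.pow e) hP, ih, pow_succ]
  have step1 : (n : R) * monicSum lam n = ∑ g ∈ monics k n, ∑ P ∈ irredsLE k n,
      ∑ e ∈ Icc 1 n, if P ^ e ∣ g then (P.natDegree : R) * lam g else 0 := by
    rw [monicSum, mul_sum]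
    refine sum_congr rfl fun g hg => ?_
    rw [mem_monics] at hg
    have := sum_natDegree_mul_multiplicity n g hg.1 hg.2.le
    rw [hg.2] at this
    have hcast : (n : R) = ∑ P ∈ irredsLE k n, ((P.natDegree * multiplicity P g : ℕ) : R) := by
      rw [← Nat.cast_sum, this]
    rw [hcast, sum_mul]
    refine sum_congr rfl fun P hP => ?_
    rw [mem_irredsLE] at hP
    rw [← sum_filter, sum_const, card_pow_dvd_Icc hP.2.1 hg.1 hg.2.le]
    simp
    ring
  have step2 : (n : R) * monicSum lam n = ∑ P ∈ irredsLE k n, ∑ e ∈ Icc 1 n,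
      if e * P.natDegree ≤ n then
        (P.natDegree : R) * lam P ^ e * monicSum lam (n - e * P.natDegree) else 0 := by
    rw [step1, sum_comm]
    refine sum_congr rfl fun P hP => ?_
    rw [sum_comm]
    refine sum_congr rfl fun e he => ?_
    rw [mem_irredsLE] at hP
    rw [← sum_filter, ← mul_sum, sum_dvd_monics lam hmul (hP.1.pow e), natDegree_pow, hpow P e hP.1]
    split_ifs
    · ring
    · simp
  rw [step2]
  have step3 : ∀ j ∈ Icc 1 n, primeSum lam j * monicSum lam (n - j) =
      ∑ P ∈ irredsLE k n, if P.natDegree ∣ j then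
        (P.natDegree : R) * lam P ^ (j / P.natDegree) * monicSum lam (n - j) else 0 := by
    intro j hj
    rw [mem_Icc] at hj
    rw [primeSum, sum_mul, ← sum_filter]
    refine sum_congr ?_ fun _ _ => rfl
    ext P
    simp only [mem_filter, mem_irredsLE]
    constructor
    · rintro ⟨⟨a, b, c⟩, d⟩
      exact ⟨⟨a, b, by omega⟩, d⟩
    · rintro ⟨⟨a, b, c⟩, d⟩
      exact ⟨⟨a, b, Nat.le_of_dvd (by omega) d⟩, d⟩
  rw [sum_congr rfl step3, sum_comm (s := Icc 1 n)]
  refine sum_congr rfl fun P hP => ?_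
  rw [mem_irredsLE] at hP
  have hpos := hP.2.1.natDegree_pos
  rw [← sum_filter, ← sum_filter]
  -- The index of Newton's identity is `j = e · deg P`.
  refine sum_bij (fun e _ => e * P.natDegree) ?_ ?_ ?_ ?_
  · intro e he
    rw [mem_filter, mem_Icc] at he ⊢
    exact ⟨⟨Nat.mul_pos he.1.1 hpos, he.2⟩, dvd_mul_left _ _⟩
  · intro a _ b _ hab
    exact Nat.eq_of_mul_eq_mul_right hpos hab
  · intro j hj
    rw [mem_filter, mem_Icc] at hj
    obtain ⟨⟨h2, h3⟩, t, rfl⟩ := hj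
    refine ⟨t, ?_, mul_comm _ _⟩
    rw [mem_filter, mem_Icc]
    refine ⟨⟨Nat.pos_of_mul_pos_left h2, ?_⟩, by linarith [mul_comm t P.natDegree]⟩
    nlinarith
  · intro e _
    simp only [Nat.mul_div_cancel _ hpos]

/-- Summation over the elements of an extension of degree `j`, grouped by minimal polynomial. -/
theorem primeSum_eq_sum (lam : k[X] → R) {L : Type*} [Field L] [Fintype L] [Algebra k L] :
    primeSum lam (Module.finrank k L) =
      ∑ x : L, lam (minpoly k x) ^ (Module.finrank k L / (minpoly k x).natDegree) := by
  classical
  have hint : ∀ x : L, IsIntegral k x := fun x => Algebra.IsIntegral.isIntegral x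
  rw [primeSum, ← sum_fiberwise_of_maps_to (s := univ) (g := fun x : L => minpoly k x)
    (t := (irredsLE k (Module.finrank k L)).filter (fun P => P.natDegree ∣ Module.finrank k L))]
  · refine sum_congr rfl fun P hP => ?_
    rw [mem_filter, mem_irredsLE] at hP
    obtain ⟨⟨hPm, hPi, hPd⟩, hdvd⟩ := hP
    have : ∀ x ∈ univ.filter (fun x : L => minpoly k x = P),
        lam (minpoly k x) ^ (Module.finrank k L / (minpoly k x).natDegree) =
          lam P ^ (Module.finrank k L / P.natDegree) := by
      intro x hx
      rw [(mem_filter.mp hx).2]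
    rw [sum_congr rfl this, sum_const, nsmul_eq_mul]
    congr 2
    have hfact : Fact (Irreducible P) := ⟨hPi⟩
    have hfr : Module.finrank k (AdjoinRoot P) = P.natDegree :=
      finrank_quotient_span_eq_natDegree (f := P)
    -- The elements with minimal polynomial `P` are the roots of `P` in `L`, that is, the embeddings
    -- of `k[X]/(P)` into `L`; there are `deg P` of them because `deg P ∣ [L : k]`.
    have hcard := FiniteField.natCard_algHom_of_finrank_dvd (F := k) (K := AdjoinRoot P) (L := L)
      (by rw [hfr]; exact hdvd)
    rw [hfr] at hcard
    rw [← hcard, Nat.card_congr (AdjoinRoot.equiv L k P hPi.ne_zero), Nat.card_eq_fintype_card,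
      Fintype.card_of_subtype]
    intro x
    rw [mem_aroots, mem_filter]
    symm
    constructor
    · rintro ⟨-, h⟩
      exact ⟨mem_univ _, (minpoly.eq_of_irreducible_of_monic hPi h hPm).symm⟩
    · rintro ⟨-, h⟩
      exact ⟨hPi.ne_zero, by rw [← h]; exact minpoly.aeval k x⟩
  · intro x _
    rw [mem_filter, mem_irredsLE]
    have hd := minpoly.degree_dvd (hint x)
    exact ⟨⟨minpoly.monic (hint x), minpoly.irreducible (hint x),
      Nat.le_of_dvd Module.finrank_pos hd⟩, hd⟩

end Newton

end MonicSums

/-! ### The Hasse-Davenport lifting relation -/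

section HasseDavenport

open Polynomial Finset

variable {k : Type*} [Field k]

/-- Transitivity of the norm through `k(x)`. Together with the trace analogue it turns the powers of
`gaussWeight` in `primeSum_eq_sum` into characters composed with norm and trace. -/
lemma norm_eq_coeff_zero_pow {L : Type*} [Field L] [Algebra k L] [FiniteDimensional k L] (x : L) :
    Algebra.norm k x = ((-1) ^ (minpoly k x).natDegree * (minpoly k x).coeff 0) ^
      (Module.finrank k L / (minpoly k x).natDegree) := by
  have hx : IsIntegral k x := Algebra.IsIntegral.isIntegral x
  have h1 := IntermediateField.adjoin.finrank hx
  have h2 := Module.finrank_mul_finrank k (IntermediateField.adjoin k {x}) L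
  rw [Algebra.norm_eq_norm_adjoin, ← IntermediateField.adjoin.powerBasis_gen hx,
    Algebra.PowerBasis.norm_gen_eq_coeff_zero_minpoly, IntermediateField.adjoin.powerBasis_gen hx,
    IntermediateField.adjoin.powerBasis_dim, IntermediateField.minpoly_gen, ← h2, h1,
    Nat.mul_div_cancel_left _ (minpoly.natDegree_pos hx)]

lemma trace_eq_nextCoeff {L : Type*} [Field L] [Algebra k L] [FiniteDimensional k L] (x : L) :
    Algebra.trace k L x =
      (Module.finrank k L / (minpoly k x).natDegree) • (-(minpoly k x).nextCoeff) := by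
  have hx : IsIntegral k x := Algebra.IsIntegral.isIntegral x
  have h1 := IntermediateField.adjoin.finrank hx
  have h2 := Module.finrank_mul_finrank k (IntermediateField.adjoin k {x}) L
  rw [trace_eq_finrank_mul_minpoly_nextCoeff, ← h2, h1,
    Nat.mul_div_cancel_left _ (minpoly.natDegree_pos hx), nsmul_eq_mul]

variable [Fintype k] {R : Type*} [CommRing R]

/-- The multiplicative function on monic polynomials attached to a multiplicative and an
additive character. -/
def gaussWeight (χ : k →* R) (ψ : AddChar k R) (g : k[X]) : R :=
  χ ((-1) ^ g.natDegree * g.coeff 0) * ψ (-g.nextCoeff)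

omit [Fintype k] in
lemma gaussWeight_one (χ : k →* R) (ψ : AddChar k R) : gaussWeight χ ψ 1 = 1 := by
  simp [gaussWeight, nextCoeff]

omit [Fintype k] in
lemma gaussWeight_mul (χ : k →* R) (ψ : AddChar k R) (g h : k[X]) (hg : g.Monic) (hh : h.Monic) :
    gaussWeight χ ψ (g * h) = gaussWeight χ ψ g * gaussWeight χ ψ h := by
  rw [gaussWeight, gaussWeight, gaussWeight, hg.natDegree_mul hh, hg.nextCoeff_mul hh,
    mul_coeff_zero, neg_add, AddChar.map_add_eq_mul, pow_add, mul_mul_mul_comm, map_mul]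
  ring

lemma monicSum_gaussWeight_one (χ : k →* R) (ψ : AddChar k R) :
    monicSum (gaussWeight χ ψ) 1 = ∑ x, χ x * ψ x := by
  rw [monicSum, sum_monics]
  have : ∀ a : Fin 1 → k, gaussWeight χ ψ (ofCoeffs a) = χ (-a 0) * ψ (-a 0) := by
    intro a
    have h0 : (ofCoeffs a).coeff 0 = a 0 := coeff_ofCoeffs a 0
    rw [gaussWeight, nextCoeff, natDegree_ofCoeffs, if_neg one_ne_zero]
    simp [h0]
  rw [sum_congr rfl fun a _ => this a]
  rw [← Equiv.sum_comp (Equiv.neg k) (fun x => χ x * ψ x)]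
  exact Equiv.sum_comp (Equiv.funUnique (Fin 1) k) (fun x => χ (-x) * ψ (-x))

/-- From degree 2 on, the constant and the next-to-leading coefficient are independent; shifting the
latter by `b` multiplies the sum by `ψ b ≠ 1`. -/
lemma monicSum_gaussWeight_eq_zero [IsDomain R] (χ : k →* R) (ψ : AddChar k R) (hψ : ψ ≠ 1)
    {n : ℕ} (hn : 2 ≤ n) : monicSum (gaussWeight χ ψ) n = 0 := by
  obtain ⟨m, rfl⟩ := Nat.exists_eq_add_of_le' hn
  obtain ⟨b, hb⟩ := (AddChar.ne_one_iff).mp hψ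
  rw [monicSum, sum_monics]
  have hval : ∀ a : Fin (m + 2) → k, gaussWeight χ ψ (ofCoeffs a) =
      χ ((-1) ^ (m + 2) * a 0) * ψ (-a (Fin.last (m + 1))) := by
    intro a
    have h0 : (ofCoeffs a).coeff 0 = a 0 := coeff_ofCoeffs a 0
    have h1 : (ofCoeffs a).coeff (m + 1) = a (Fin.last (m + 1)) :=
      coeff_ofCoeffs a (Fin.last (m + 1))
    rw [gaussWeight, nextCoeff, natDegree_ofCoeffs, if_neg (by omega), h0]
    simp [h1]
  have h := (Equiv.subRight (Pi.single (Fin.last (m + 1)) b : Fin (m + 2) → k)).sum_comp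
    (fun a => gaussWeight χ ψ (ofCoeffs a))
  have h2 : ∀ a : Fin (m + 2) → k, gaussWeight χ ψ (ofCoeffs
      (Equiv.subRight (Pi.single (Fin.last (m + 1)) b : Fin (m + 2) → k) a)) =
      ψ b * gaussWeight χ ψ (ofCoeffs a) := by
    intro a
    rw [hval, hval]
    have : (0 : Fin (m + 2)) ≠ Fin.last (m + 1) := by
      rw [Ne, Fin.ext_iff]; simp
    simp only [Equiv.subRight_apply, Pi.sub_apply, Pi.single_eq_same,
      Pi.single_eq_of_ne this, sub_zero]
    rw [neg_sub, sub_eq_add_neg, AddChar.map_add_eq_mul]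
    ring
  rw [sum_congr rfl fun a _ => h2 a, ← mul_sum] at h
  have h3 : (ψ b - 1) * ∑ a : Fin (m + 2) → k, gaussWeight χ ψ (ofCoeffs a) = 0 := by
    rw [sub_mul, h, one_mul, sub_self]
  exact (mul_eq_zero.mp h3).resolve_left (sub_ne_zero.mpr hb)

/-- The generating series is `1 + g T` with `g` the Gauss sum, so only two terms of Newton's
identity survive and the prime sums satisfy a geometric recursion of ratio `-g`. -/
lemma neg_primeSum_gaussWeight [IsDomain R] (χ : k →* R) (ψ : AddChar k R) (hψ : ψ ≠ 1)
    (n : ℕ) : -primeSum (gaussWeight χ ψ) (n + 1) = (-∑ x, χ x * ψ x) ^ (n + 1) := by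
  have h0 : monicSum (gaussWeight χ ψ) 0 = 1 := by
    rw [monicSum, monics_zero, sum_singleton, gaussWeight_one]
  have hN := natCast_mul_monicSum (gaussWeight χ ψ) (gaussWeight_one χ ψ) (gaussWeight_mul χ ψ)
  induction n with
  | zero =>
    have := hN 1
    rw [Icc_self, sum_singleton, Nat.sub_self, h0, monicSum_gaussWeight_one] at this
    simp only [Nat.cast_one, one_mul, mul_one] at this
    simp [← this]
  | succ n ih =>
    have := hN (n + 2)
    rw [monicSum_gaussWeight_eq_zero χ ψ hψ (by omega), mul_zero, sum_Icc_succ_top (by omega),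
      sum_Icc_succ_top (by omega), Nat.sub_self, h0, show n + 2 - (n + 1) = 1 by omega,
      monicSum_gaussWeight_one, sum_eq_zero, zero_add] at this
    · rw [pow_succ, ← ih]
      linear_combination this
    · intro j hj
      rw [mem_Icc] at hj
      rw [monicSum_gaussWeight_eq_zero χ ψ hψ (by omega), mul_zero]

/-- The **Hasse-Davenport lifting relation**. -/
theorem hasseDavenport [IsDomain R] (χ : k →* R) (ψ : AddChar k R) (hψ : ψ ≠ 1)
    {L : Type*} [Field L] [Fintype L] [Algebra k L] :
    -∑ x : L, χ (Algebra.norm k x) * ψ (Algebra.trace k L x) =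
      (-∑ x, χ x * ψ x) ^ Module.finrank k L := by
  obtain ⟨n, hn⟩ := Nat.exists_eq_add_of_le' (Module.finrank_pos (R := k) (M := L))
  rw [hn, ← neg_primeSum_gaussWeight χ ψ hψ, ← hn, primeSum_eq_sum]
  congr 1
  refine sum_congr rfl fun x _ => ?_
  rw [gaussWeight, mul_pow, ← map_pow, ← AddChar.map_nsmul_eq_pow, ← norm_eq_coeff_zero_pow,
    ← trace_eq_nextCoeff]

end HasseDavenport

/-! ### Quadratic character sums of cubic polynomials -/

section QuadraticSums

open Finset

variable {k : Type*} [Field k] [Fintype k] [DecidableEq k]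

lemma sum_comp_sq (hF : ringChar k ≠ 2) (h : k → ℤ) :
    ∑ v, h (v ^ 2) = ∑ u, (1 + quadraticChar k u) * h u := by
  rw [← sum_fiberwise_of_maps_to (s := univ) (t := univ) (g := fun v : k => v ^ 2)
    fun _ _ => mem_univ _]
  refine sum_congr rfl fun u _ => ?_
  have : ∀ v ∈ univ.filter (fun v : k => v ^ 2 = u), h (v ^ 2) = h u := by
    intro v hv
    rw [(mem_filter.mp hv).2]
  rw [sum_congr rfl this, sum_const, nsmul_eq_mul]
  congr 1
  have := quadraticChar_card_sqrts hF u
  rw [add_comm, ← this]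
  congr 2
  ext v
  simp

/-- Since `u (u - E) = u² (1 - E/u)`, the sum runs over the values `t = 1 - E/u`, that is, over all
`t ≠ 1`. -/
lemma sum_quadraticChar_mul_sub (hF : ringChar k ≠ 2) {E : k} (hE : E ≠ 0) :
    ∑ u, quadraticChar k u * quadraticChar k (u - E) = -1 := by
  have h1 : ∑ u, quadraticChar k u * quadraticChar k (u - E) =
      ∑ t ∈ univ.erase (1 : k), quadraticChar k t := by
    rw [← sum_erase (s := univ) (a := (0 : k))
      (f := fun u => quadraticChar k u * quadraticChar k (u - E)) (by simp)]
    refine sum_bij' (fun u _ => 1 - E / u) (fun t _ => E / (1 - t)) ?_ ?_ ?_ ?_ ?_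
    · intro u hu
      simp only [mem_erase, mem_univ, and_true] at hu ⊢
      have := div_ne_zero hE hu
      intro h
      exact this (by linear_combination -h)
    · intro t ht
      simp only [mem_erase, mem_univ, and_true] at ht ⊢
      exact div_ne_zero hE (sub_ne_zero.mpr (Ne.symm ht))
    · intro u hu
      rw [sub_sub_cancel, div_div_cancel₀ hE]
    · intro t ht
      simp only [mem_erase, mem_univ, and_true] at ht
      have : 1 - t ≠ 0 := sub_ne_zero.mpr (Ne.symm ht)
      field_simp
      ring
    · intro u hu
      simp only [mem_erase, mem_univ, and_true] at hu
      rw [← map_mul, show u * (u - E) = u ^ 2 * (1 - E / u) by field_simp, map_mul,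
        quadraticChar_sq_one' hu, one_mul]
  have h2 := add_sum_erase univ (fun t => quadraticChar k t) (mem_univ (1 : k))
  rw [quadraticChar_sum_zero hF, map_one] at h2
  rw [h1]
  linarith

lemma sum_quadraticChar_sq (k : Type*) [Field k] [Fintype k] [DecidableEq k] :
    ∑ v : k, quadraticChar k (v ^ 2) = Fintype.card k - 1 := by
  have h2 := add_sum_erase univ (fun t => quadraticChar k (t ^ 2)) (mem_univ (0 : k))
  rw [← h2]
  have : ∀ t ∈ univ.erase (0 : k), quadraticChar k (t ^ 2) = 1 := fun t ht =>
    quadraticChar_sq_one' (mem_erase.mp ht).1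
  rw [sum_congr rfl this]
  simp [card_erase_of_mem, Fintype.card_pos]

/-- Complete the square, then count square roots with `sum_comp_sq` to reduce to
`sum_quadraticChar_mul_sub`. -/
lemma sum_quadraticChar_quadratic (hF : ringChar k ≠ 2) (b c : k) :
    ∑ v, quadraticChar k (v ^ 2 + b * v + c) =
      if b ^ 2 = 4 * c then (Fintype.card k : ℤ) - 1 else -1 := by
  have h2 : (2 : k) ≠ 0 := Ring.two_ne_zero hF
  have h4 : (4 : k) ≠ 0 := by
    rw [show (4 : k) = 2 * 2 by norm_num]; exact mul_ne_zero h2 h2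
  rw [← Equiv.sum_comp (Equiv.subRight (b / 2))]
  have : ∀ v : k, (Equiv.subRight (b / 2) v) ^ 2 + b * (Equiv.subRight (b / 2) v) + c =
      v ^ 2 - (b ^ 2 - 4 * c) / 4 := by
    intro v
    rw [Equiv.subRight_apply, show (4 : k) = 2 * 2 by norm_num]
    field_simp
    ring
  simp_rw [this]
  split_ifs with h
  · simp only [h, sub_self, zero_div, sub_zero]
    exact sum_quadraticChar_sq k
  · have hE : (b ^ 2 - 4 * c) / 4 ≠ 0 := div_ne_zero (sub_ne_zero.mpr h) h4
    rw [sum_comp_sq hF (fun u => quadraticChar k (u - (b ^ 2 - 4 * c) / 4))]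
    simp_rw [add_mul, one_mul]
    rw [sum_add_distrib, sum_quadraticChar_mul_sub hF hE]
    have := Equiv.sum_comp (Equiv.subRight ((b ^ 2 - 4 * c) / 4)) (fun u => quadraticChar k u)
    simp only [Equiv.subRight_apply] at this
    rw [this, quadraticChar_sum_zero hF, zero_add]

/-- The sum over `s, n` of the quadratic character of the resultant of `X² - sX + n` and the
cubic polynomial `X³ + AX + B`, in the coordinates `x = -s`, `α = s² - n + A`. -/
lemma sum_cubic_weight (hF : ringChar k ≠ 2) (A B x : k) :
    ∑ α, quadraticChar k (-α ^ 3 + α ^ 2 * (3 * x ^ 2 + A) - 3 * α * x * (x ^ 3 + A * x + B)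
        + (x ^ 3 + A * x + B) ^ 2) =
      1 + (∑ v, quadraticChar k v * quadraticChar k ((x + v) ^ 3 + A * (x + v) + B)) -
        (if x ^ 3 + A * x + B = 0 ∧ 3 * x ^ 2 + 4 * A = 0 then (Fintype.card k : ℤ) else 0) := by
  have h2 : (2 : k) ≠ 0 := Ring.two_ne_zero hF
  -- If `x` is a root of the cubic, the arguments are `α²` times a linear polynomial and `v²` times
  -- a quadratic one, so both sums are explicit. Otherwise they match term by term.
  by_cases he : x ^ 3 + A * x + B = 0
  · simp only [he, true_and]
    have e1 : ∑ α, quadraticChar k (-α ^ 3 + α ^ 2 * (3 * x ^ 2 + A) - 3 * α * x * 0 + 0 ^ 2) =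
        -quadraticChar k (3 * x ^ 2 + A) := by
      have h := add_sum_erase univ (fun α => quadraticChar k (3 * x ^ 2 + A - α))
        (mem_univ (0 : k))
      have h3 := Equiv.sum_comp (Equiv.subLeft (3 * x ^ 2 + A)) (fun u => quadraticChar k u)
      simp only [Equiv.subLeft_apply] at h3
      rw [h3, quadraticChar_sum_zero hF, sub_zero] at h
      rw [← sum_erase (s := univ) (a := (0 : k))
        (f := fun α => quadraticChar k
          (-α ^ 3 + α ^ 2 * (3 * x ^ 2 + A) - 3 * α * x * 0 + 0 ^ 2)) (by simp), ← sub_eq_zero, sub_neg_eq_add, ← h,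
        add_comm]
      congr 1
      refine sum_congr rfl fun α hα => ?_
      rw [show -α ^ 3 + α ^ 2 * (3 * x ^ 2 + A) - 3 * α * x * 0 + 0 ^ 2 =
        α ^ 2 * (3 * x ^ 2 + A - α) by ring, map_mul, quadraticChar_sq_one' (mem_erase.mp hα).1,
        one_mul]
    have e2 : ∑ v, quadraticChar k v * quadraticChar k ((x + v) ^ 3 + A * (x + v) + B) =
        (∑ v, quadraticChar k (v ^ 2 + 3 * x * v + (3 * x ^ 2 + A))) -
          quadraticChar k (3 * x ^ 2 + A) := by
      have h := add_sum_erase univ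
        (fun v => quadraticChar k (v ^ 2 + 3 * x * v + (3 * x ^ 2 + A))) (mem_univ (0 : k))
      rw [← h, ← sum_erase (s := univ) (a := (0 : k))
        (f := fun v => quadraticChar k v * quadraticChar k ((x + v) ^ 3 + A * (x + v) + B))
        (by simp)]
      simp only [ne_eq, OfNat.ofNat_ne_zero, not_false_eq_true, zero_pow, mul_zero, add_zero,
        zero_add, add_sub_cancel_left]
      refine sum_congr rfl fun v hv => ?_
      rw [← map_mul, show v * ((x + v) ^ 3 + A * (x + v) + B) =
        v ^ 2 * (v ^ 2 + 3 * x * v + (3 * x ^ 2 + A)) by linear_combination v * he, map_mul,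
        quadraticChar_sq_one' (mem_erase.mp hv).1, one_mul]
    rw [e1, e2, sum_quadraticChar_quadratic hF]
    have : (3 * x) ^ 2 = 4 * (3 * x ^ 2 + A) ↔ 3 * x ^ 2 + 4 * A = 0 := by
      constructor
      · intro h; linear_combination -h
      · intro h; linear_combination -h
    simp only [this]
    split_ifs <;> ring
  · simp only [he, false_and, if_false, sub_zero]
    set e := x ^ 3 + A * x + B with hedef
    rw [← add_sum_erase univ _ (mem_univ (0 : k))]
    congr 1
    · simp [quadraticChar_sq_one' he]
    · rw [← sum_erase (s := univ) (a := (0 : k))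
        (f := fun v => quadraticChar k v * quadraticChar k ((x + v) ^ 3 + A * (x + v) + B))
        (by simp)]
      -- With `v = -e/α`, the resultant equals `v · f(x + v)` up to the square of `α²/e`, where `f`
      -- is the cubic and `e = f(x)`.
      refine sum_bij' (fun α _ => -e / α) (fun v _ => -e / v) ?_ ?_ ?_ ?_ ?_
      · intro a ha
        simp only [mem_erase, mem_univ, and_true] at ha ⊢
        exact div_ne_zero (neg_ne_zero.mpr he) ha
      · intro a ha
        simp only [mem_erase, mem_univ, and_true] at ha ⊢
        exact div_ne_zero (neg_ne_zero.mpr he) ha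
      · intro a ha
        simp only [mem_erase, mem_univ, and_true] at ha
        field_simp
      · intro a ha
        simp only [mem_erase, mem_univ, and_true] at ha
        field_simp
      · intro α hα
        simp only [mem_erase, mem_univ, and_true] at hα
        have hα2 : α ^ 2 / e ≠ 0 := div_ne_zero (pow_ne_zero 2 hα) he
        rw [← map_mul]
        have : -α ^ 3 + α ^ 2 * (3 * x ^ 2 + A) - 3 * α * x * e + e ^ 2 =
            (α ^ 2 / e) ^ 2 * (-e / α * ((x + -e / α) ^ 3 + A * (x + -e / α) + B)) := by
          have : (x + -e / α) ^ 3 + A * (x + -e / α) + B =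
            e + 3 * x ^ 2 * (-e / α) + 3 * x * (-e / α) ^ 2 + (-e / α) ^ 3 + A * (-e / α) := by
            rw [hedef]; ring
          rw [this]
          field_simp
          ring
        rw [this, map_mul, quadraticChar_sq_one' hα2, one_mul]

/-- Dividing the cubic by `X - x` leaves `v² + 3xv + (3x² + A)` in `v = X - x`, of discriminant
`-(3x² + 4A)`. So `x` is counted when the other two roots coincide, which forces vanishing
discriminant and then `x = 3B/A`, or `x = 0` if `A = B = 0`. -/
lemma card_double_roots (h2 : (2 : k) ≠ 0) (h3 : (3 : k) ≠ 0) (A B : k) :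
    (univ.filter fun x : k => x ^ 3 + A * x + B = 0 ∧ 3 * x ^ 2 + 4 * A = 0).card =
      if 4 * A ^ 3 + 27 * B ^ 2 = 0 then 1 else 0 := by
  have h4 : (4 : k) ≠ 0 := by
    rw [show (4 : k) = 2 * 2 by norm_num]; exact mul_ne_zero h2 h2
  split_ifs with h
  · rw [card_eq_one]
    by_cases hA : A = 0
    · subst hA
      have hB : B = 0 := by
        have : (3 : k) ^ 3 * B ^ 2 = 0 := by linear_combination h
        exact pow_eq_zero_iff two_ne_zero |>.mp
          ((mul_eq_zero.mp this).resolve_left (pow_ne_zero 3 h3))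
      subst hB
      refine ⟨0, ?_⟩
      ext x
      simp [h3]
    · refine ⟨3 * B / A, ?_⟩
      ext x
      simp only [mem_filter, mem_univ, true_and, mem_singleton]
      constructor
      · rintro ⟨e1, e2⟩
        rw [eq_div_iff hA]
        linear_combination x * e2 - 3 * e1
      · rintro rfl
        constructor
        · field_simp
          linear_combination B * h
        · field_simp
          linear_combination h
  · rw [card_eq_zero, filter_eq_empty_iff]
    rintro x - ⟨e1, e2⟩
    apply h
    have h6 : x * A = 3 * B := by linear_combination x * e2 - 3 * e1
    linear_combination A ^ 2 * e2 - 3 * (x * A + 3 * B) * h6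

end QuadraticSums

/-! ### Quadratic character sums of a cubic polynomial over finite extensions -/

section CubicSums

open Polynomial Finset

variable {k : Type*} [Field k]

/-- The polynomial `X³ + AX + B`. -/
def cubic (A B : k) : k[X] := X ^ 3 + C A * X + C B

lemma natDegree_cubic (A B : k) : (cubic A B).natDegree = 3 := by
  unfold cubic; compute_degree!

lemma monic_cubic (A B : k) : (cubic A B).Monic := by
  unfold cubic; monicity!

lemma eval_cubic (A B x : k) : (cubic A B).eval x = x ^ 3 + A * x + B := by
  simp [cubic]

variable [Fintype k] [DecidableEq k]

/-- The quadratic character of the resultant of `g` and a cubic polynomial. -/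
def cubicWeight (A B : k) (g : k[X]) : ℤ :=
  quadraticChar k (resultant g (cubic A B) g.natDegree 3)

lemma cubicWeight_one (A B : k) : cubicWeight A B 1 = 1 := by
  simp [cubicWeight]

lemma cubicWeight_mul (A B : k) (g h : k[X]) (hg : g.Monic) (hh : h.Monic) :
    cubicWeight A B (g * h) = cubicWeight A B g * cubicWeight A B h := by
  rw [cubicWeight, hg.natDegree_mul hh, resultant_mul_left _ _ _ _ (natDegree_cubic A B).le,
    map_mul, cubicWeight, cubicWeight]

lemma monicSum_cubicWeight_one (A B : k) :
    monicSum (cubicWeight A B) 1 = ∑ x, quadraticChar k (x ^ 3 + A * x + B) := by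
  rw [monicSum, sum_monics]
  have : ∀ a : Fin 1 → k, cubicWeight A B (ofCoeffs a) =
      quadraticChar k ((-a 0) ^ 3 + A * (-a 0) + B) := by
    intro a
    have h0 : ofCoeffs a = X + C (a 0) := by simp [ofCoeffs]
    rw [cubicWeight, natDegree_ofCoeffs, h0, resultant_X_add_C_left _ _ _ (natDegree_cubic A B).le,
      eval_cubic]
  rw [sum_congr rfl fun a _ => this a]
  rw [← Equiv.sum_comp (Equiv.neg k) (fun x => quadraticChar k (x ^ 3 + A * x + B))]
  exact Equiv.sum_comp (Equiv.funUnique (Fin 1) k)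
    (fun x => quadraticChar k ((-x) ^ 3 + A * (-x) + B))

omit [Fintype k] [DecidableEq k] in
lemma resultant_quadratic_linear (u w α β : k) :
    resultant (X ^ 2 + C u * X + C w) (C α * X + C β) 2 1 = β ^ 2 - α * β * u + α ^ 2 * w := by
  rw [resultant, sylvester, Matrix.det_fin_three]
  simp only [Matrix.of_apply]
  have e0 : (0 : Fin (2 + 1)) = Fin.castAdd 1 (0 : Fin 2) := rfl
  have e1 : (1 : Fin (2 + 1)) = Fin.castAdd 1 (1 : Fin 2) := rfl
  have e2 : (2 : Fin (2 + 1)) = Fin.natAdd 2 (0 : Fin 1) := rfl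
  have c0 : (0 : Fin (2 + 1)).val = 0 := rfl
  have c1 : (1 : Fin (2 + 1)).val = 1 := rfl
  have c2 : (2 : Fin (2 + 1)).val = 2 := rfl
  rw [e2, e1, e0]
  simp only [Fin.addCases_left, Fin.addCases_right]
  simp [coeff_X, coeff_C]
  ring

omit [Fintype k] [DecidableEq k] in
-- The quadratic is parametrized so that dividing the cubic by it gives quotient `X - x` and a
-- remainder with leading coefficient `α`; only this linear remainder matters for the resultant.
lemma resultant_quadratic_cubic (A B x α : k) :
    resultant (X ^ 2 + C x * X + C (x ^ 2 + A - α)) (cubic A B) 2 3 =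
      -α ^ 3 + α ^ 2 * (3 * x ^ 2 + A) - 3 * α * x * (x ^ 3 + A * x + B)
        + (x ^ 3 + A * x + B) ^ 2 := by
  have hg : (X ^ 2 + C x * X + C (x ^ 2 + A - α) : k[X]).natDegree = 2 := by compute_degree!
  have hgm : (X ^ 2 + C x * X + C (x ^ 2 + A - α) : k[X]).coeff 2 = 1 := by
    have : (C x ^ 2 : k[X]).coeff 2 = 0 := by rw [← C_pow, coeff_C, if_neg two_ne_zero]
    simp [this]
  have h1 : cubic A B = (C α * X + C (B + x * (x ^ 2 + A - α))) +
      (X ^ 2 + C x * X + C (x ^ 2 + A - α)) * (X - C x) := by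
    simp only [cubic, map_add, map_sub, map_mul, map_pow]
    ring
  rw [h1, resultant_add_mul_right _ _ _ _ _ (by rw [natDegree_X_sub_C]) hg.le]
  have h2 := resultant_add_right_deg (X ^ 2 + C x * X + C (x ^ 2 + A - α))
    (C α * X + C (B + x * (x ^ 2 + A - α))) 2 1 2 natDegree_linear_le
  rw [hgm, one_pow, one_mul] at h2
  rw [show 3 = 1 + 2 from rfl, h2, resultant_quadratic_linear]
  ring

/-- Sum `sum_cubic_weight` over `x`: the constant 1 gives the cardinality of `k`, the double sum has
the factor `∑ χ(v) = 0`, and the double-root correction removes the cardinality exactly when the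
discriminant vanishes. -/
lemma monicSum_cubicWeight_two (hF : ringChar k ≠ 2) (h3 : (3 : k) ≠ 0) (A B : k) :
    monicSum (cubicWeight A B) 2 =
      if 4 * A ^ 3 + 27 * B ^ 2 = 0 then 0 else (Fintype.card k : ℤ) := by
  have h2 : (2 : k) ≠ 0 := Ring.two_ne_zero hF
  rw [monicSum, sum_monics, ← Equiv.sum_comp (finTwoArrowEquiv k).symm, Fintype.sum_prod_type,
    sum_comm]
  have hval : ∀ x w : k, cubicWeight A B (ofCoeffs ((finTwoArrowEquiv k).symm (w, x))) =
      quadraticChar k (resultant (X ^ 2 + C x * X + C w) (cubic A B) 2 3) := by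
    intro x w
    rw [cubicWeight, natDegree_ofCoeffs]
    congr 2
    simp [ofCoeffs]
    ring
  have hin : ∀ x : k, ∑ w, cubicWeight A B (ofCoeffs ((finTwoArrowEquiv k).symm (w, x))) =
      1 + (∑ v, quadraticChar k v * quadraticChar k ((x + v) ^ 3 + A * (x + v) + B)) -
        (if x ^ 3 + A * x + B = 0 ∧ 3 * x ^ 2 + 4 * A = 0 then (Fintype.card k : ℤ) else 0) := by
    intro x
    rw [← sum_cubic_weight hF, ← Equiv.sum_comp (Equiv.subLeft (x ^ 2 + A))]
    refine sum_congr rfl fun α _ => ?_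
    rw [hval, Equiv.subLeft_apply, resultant_quadratic_cubic]
  simp_rw [hin]
  rw [sum_sub_distrib, sum_add_distrib, sum_comm]
  have hz : ∑ v, ∑ x, quadraticChar k v * quadraticChar k ((x + v) ^ 3 + A * (x + v) + B) = 0 := by
    have : ∀ v : k, ∑ x, quadraticChar k v * quadraticChar k ((x + v) ^ 3 + A * (x + v) + B) =
        quadraticChar k v * ∑ x, quadraticChar k (x ^ 3 + A * x + B) := by
      intro v
      rw [mul_sum]
      exact Equiv.sum_comp (Equiv.addRight v)
        (fun x => quadraticChar k v * quadraticChar k (x ^ 3 + A * x + B))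
    simp_rw [this]
    rw [← sum_mul, quadraticChar_sum_zero hF, zero_mul]
  rw [hz, ← sum_filter, sum_const, sum_const, card_double_roots h2 h3 A B]
  split_ifs <;> simp

/-- In degree at least 3, the residue of `g` modulo the cubic can be multiplied by a nonsquare `c`
while `g` stays monic of the same degree. This permutes the monic polynomials and scales the
resultant by `c³`, so the sum equals its own negative. -/
lemma monicSum_cubicWeight_eq_zero (hF : ringChar k ≠ 2) (A B : k) {n : ℕ} (hn : 3 ≤ n) :
    monicSum (cubicWeight A B) n = 0 := by
  obtain ⟨c, hc⟩ := quadraticChar_exists_neg_one hF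
  have hc0 : c ≠ 0 := by
    rintro rfl
    simp at hc
  set f := cubic A B with hf
  have hfm : f.Monic := monic_cubic A B
  have hfd : f.natDegree = 3 := natDegree_cubic A B
  have hdeg : ∀ g : k[X], (g %ₘ f).natDegree < 3 := fun g => by
    rw [← hfd]; exact natDegree_modByMonic_lt g hfm (by intro h; rw [h] at hfd; simp at hfd)
  let T : k → k[X] → k[X] := fun d g => g + C (d - 1) * (g %ₘ f)
  have hTm : ∀ d g, g ∈ monics k n → T d g ∈ monics k n := by
    intro d g hg
    rw [mem_monics] at hg ⊢
    have : (C (d - 1) * (g %ₘ f)).degree < g.degree := by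
      refine degree_lt_degree (lt_of_le_of_lt (natDegree_C_mul_le _ _) ?_)
      have := hdeg g
      omega
    exact ⟨hg.1.add_of_left this, by
      rw [natDegree_add_eq_left_of_degree_lt this, hg.2]⟩
  have hTmod : ∀ d g, T d g %ₘ f = C d * (g %ₘ f) := by
    intro d g
    simp only [T]
    rw [add_modByMonic, ← smul_eq_C_mul, smul_modByMonic, (modByMonic_eq_self_iff hfm).mpr
      (degree_modByMonic_lt g hfm), smul_eq_C_mul, map_sub, map_one]
    ring
  have hTT : ∀ d e g, d * e = 1 → T d (T e g) = g := by
    intro d e g hde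
    have : T d (T e g) = T e g + C (d - 1) * (T e g %ₘ f) := rfl
    rw [this, hTmod]
    have h3 : C d * C e = (1 : k[X]) := by rw [← C_mul, hde, C_1]
    simp only [T, map_sub, map_one]
    linear_combination (g %ₘ f) * h3
  have hlam : ∀ g ∈ monics k n, cubicWeight A B (T c g) = - cubicWeight A B g := by
    intro g hg
    have hTg := hTm c g hg
    rw [mem_monics] at hg hTg
    have hq : (g /ₘ f).natDegree + 3 ≤ n := by
      rw [natDegree_divByMonic _ hfm, hfd, hg.2]; omega
    have e1 : g = g %ₘ f + f * (g /ₘ f) := (modByMonic_add_div g f).symm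
    have e2 : T c g = C c * (g %ₘ f) + f * (g /ₘ f) := by
      simp only [T]
      nth_rewrite 1 [e1]
      simp only [map_sub, map_one]
      ring
    rw [cubicWeight, cubicWeight, hg.2, hTg.2, ← hf, e2, resultant_add_mul_left _ _ _ _ _ hq hfd.le,
      resultant_C_mul_left, map_mul, map_pow, hc]
    nth_rewrite 2 [e1]
    rw [resultant_add_mul_left _ _ _ _ _ hq hfd.le]
    ring
  have hsum : monicSum (cubicWeight A B) n = - monicSum (cubicWeight A B) n := by
    rw [monicSum, ← sum_neg_distrib]
    refine sum_bij' (fun g _ => T c⁻¹ g) (fun g _ => T c g) (fun g => hTm _ g)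
      (fun g => hTm _ g) (fun g _ => hTT _ _ _ (mul_inv_cancel₀ hc0))
      (fun g _ => hTT _ _ _ (inv_mul_cancel₀ hc0)) ?_
    intro g hg
    rw [← hlam _ (hTm _ _ hg), hTT _ _ _ (mul_inv_cancel₀ hc0)]
  omega

omit [Fintype k] [DecidableEq k] in
-- Over `k(x)`, the norm of `f(x)` is the product of `f` over the conjugates of `x`, which is the
-- resultant with the minimal polynomial; separability makes conjugates and roots correspond
-- bijectively. The exponent is the degree of `L` over `k(x)`.
lemma norm_aeval_eq_resultant [PerfectField k] {L : Type*} [Field L] [Algebra k L]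
    [FiniteDimensional k L] (f : k[X]) {n : ℕ} (hn : f.natDegree ≤ n) (x : L) :
    Algebra.norm k (aeval x f) = resultant (minpoly k x) f (minpoly k x).natDegree n ^
      (Module.finrank k L / (minpoly k x).natDegree) := by
  have hx : IsIntegral k x := Algebra.IsIntegral.isIntegral x
  have h1 := IntermediateField.adjoin.finrank hx
  have h2 := Module.finrank_mul_finrank k (IntermediateField.adjoin k {x}) L
  set F := IntermediateField.adjoin k {x} with hF
  set θ : F := IntermediateField.AdjoinSimple.gen k x with hθ
  have hmin : minpoly k θ = minpoly k x := IntermediateField.minpoly_gen k x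
  have e1 : aeval x f = algebraMap F L (aeval θ f) := by
    rw [← aeval_algebraMap_apply]
    rfl
  rw [e1, ← Algebra.norm_norm (S := F),
    Algebra.norm_algebraMap_of_basis (Module.Free.chooseBasis F L),
    ← Module.finrank_eq_card_chooseBasisIndex, map_pow]
  rw [← h2, h1, Nat.mul_div_cancel_left _ (minpoly.natDegree_pos hx)]
  congr 1
  apply FaithfulSMul.algebraMap_injective k (AlgebraicClosure k)
  rw [Algebra.norm_eq_prod_embeddings k (AlgebraicClosure k)]
  set E := AlgebraicClosure k
  set φ := algebraMap k E
  have hsplit : ((minpoly k x).map φ).Splits := IsAlgClosed.splits _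
  rw [← resultant_map_map, ← natDegree_map (p := minpoly k x) φ,
    resultant_eq_prod_eval _ _ _ (natDegree_map_le.trans hn) hsplit,
    ((minpoly.monic hx).map φ).leadingCoeff, one_pow, one_mul]
  have hsep : (minpoly k x).Separable := Algebra.IsSeparable.isSeparable k x
  have hnd : ((minpoly k x).map φ).roots.Nodup := nodup_roots (hsep.map)
  let pb := IntermediateField.adjoin.powerBasis hx
  have hpb : pb.gen = θ := IntermediateField.adjoin.powerBasis_gen hx
  have hmin' : minpoly k pb.gen = minpoly k x := by rw [hpb, hmin]
  let := Classical.decEq E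
  rw [Fintype.prod_equiv pb.liftEquiv' _ (fun y => aeval (y : E) f), Finset.prod_mem_multiset
    ((minpoly k pb.gen).aroots E) _ (fun y => aeval y f) (fun _ => rfl)]
  · rw [hmin', Finset.prod_eq_multiset_prod, Multiset.toFinset_val, aroots,
      Multiset.dedup_eq_self.mpr hnd]
    simp only [eval_map_algebraMap, φ]
  · intro σ
    rw [PowerBasis.liftEquiv'_apply_coe, hpb, aeval_algHom_apply]

/-- Euler's criterion on both sides: the norm is the power `1 + q + ⋯ + q^(n-1)`, and this times `(q
- 1)/2` is `(q^n - 1)/2`. The comparison is made in `L`, where the values `-1, 0, 1` stay distinct.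
-/
lemma quadraticChar_norm (hF : ringChar k ≠ 2) {L : Type*} [Field L] [Fintype L] [DecidableEq L]
    [Algebra k L] (y : L) : quadraticChar k (Algebra.norm k y) = quadraticChar L y := by
  have hchar : ringChar L = ringChar k := (Algebra.ringChar_eq k L).symm
  have hFL : ringChar L ≠ 2 := by rwa [hchar]
  apply Int.cast_injOn_of_ringChar_ne_two hFL
    (by simpa using quadraticChar_isQuadratic k (Algebra.norm k y))
    (by simpa using quadraticChar_isQuadratic L y)
  have h1 := quadraticChar_eq_pow_of_char_ne_two' hF (Algebra.norm k y)
  have h2 := congrArg (algebraMap k L) h1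
  rw [map_intCast, map_pow, FiniteField.algebraMap_norm_eq_pow_sum, ← pow_mul] at h2
  rw [h2, quadraticChar_eq_pow_of_char_ne_two' hFL]
  congr 1
  have hodd := FiniteField.odd_card_of_char_ne_two hF
  have hcard := Module.card_eq_pow_finrank (K := k) (V := L)
  rw [hcard, ← Nat.card_eq_fintype_card (α := k)]
  rw [← Nat.card_eq_fintype_card] at hodd
  obtain ⟨m, hm⟩ : ∃ m, Nat.card k = 2 * m + 1 := ⟨Nat.card k / 2, by omega⟩
  have hg := geom_sum_mul_add (2 * m) (Module.finrank k L)
  rw [hm]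
  generalize ∑ i ∈ range (Module.finrank k L), (2 * m + 1) ^ i = S at hg ⊢
  rw [← hg, show (2 * m + 1) / 2 = m by omega, show S * (2 * m) + 1 = 2 * (S * m) + 1 by ring]
  omega

lemma primeSum_cubicWeight (hF : ringChar k ≠ 2) (A B : k) {L : Type*} [Field L] [Fintype L]
    [DecidableEq L] [Algebra k L] :
    primeSum (cubicWeight A B) (Module.finrank k L) =
      ∑ x : L, quadraticChar L (x ^ 3 + algebraMap k L A * x + algebraMap k L B) := by
  rw [primeSum_eq_sum]
  refine sum_congr rfl fun x _ => ?_
  rw [cubicWeight, ← map_pow, ← norm_aeval_eq_resultant _ (natDegree_cubic A B).le,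
    quadraticChar_norm hF]
  simp [cubic]

/-- The power sums of the roots of `1 - a T + c T²`. -/
def powerSum (a c : ℤ) : ℕ → ℤ
  | 0 => 2
  | 1 => a
  | n + 2 => a * powerSum a c (n + 1) - c * powerSum a c n

/-- The character sums of a cubic polynomial over the extensions of a finite field are given by
a quadratic polynomial. -/
theorem powerSum_eq_neg_sum (hF : ringChar k ≠ 2) (h3 : (3 : k) ≠ 0) (A B : k) {L : Type*}
    [Field L] [Fintype L] [DecidableEq L] [Algebra k L] :
    powerSum (-∑ x, quadraticChar k (x ^ 3 + A * x + B))
      (if 4 * A ^ 3 + 27 * B ^ 2 = 0 then 0 else (Fintype.card k : ℤ)) (Module.finrank k L) =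
      -∑ x : L, quadraticChar L (x ^ 3 + algebraMap k L A * x + algebraMap k L B) := by
  rw [← primeSum_cubicWeight hF]
  have h0 : monicSum (cubicWeight A B) 0 = 1 := by
    rw [monicSum, monics_zero, sum_singleton, cubicWeight_one]
  have h1 := monicSum_cubicWeight_one A B
  have h2 := monicSum_cubicWeight_two hF h3 A B
  have hN := natCast_mul_monicSum (cubicWeight A B) (cubicWeight_one A B) (cubicWeight_mul A B)
  rw [← h1, ← h2]
  have hp1 : primeSum (cubicWeight A B) 1 = monicSum (cubicWeight A B) 1 := by
    have := hN 1
    rw [Icc_self, sum_singleton, Nat.sub_self, h0] at this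
    simpa using this.symm
  -- The generating series is `1 + S₁ T + S₂ T²`, so Newton's identity becomes the recursion of
  -- `powerSum` with `a = -S₁` and `c = S₂`.
  have key : ∀ n, powerSum (-monicSum (cubicWeight A B) 1) (monicSum (cubicWeight A B) 2) (n + 1) =
      -primeSum (cubicWeight A B) (n + 1) := by
    intro n
    induction n using Nat.strong_induction_on with
    | _ n ih =>
      match n with
      | 0 => rw [hp1]; rfl
      | 1 =>
        have := hN 2
        rw [sum_Icc_succ_top (by omega), Icc_self, sum_singleton, Nat.sub_self, h0, hp1,
          show 2 - 1 = 1 from rfl] at this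
        simp only [powerSum]
        push_cast at this
        linear_combination -this
      | n + 2 =>
        have := hN (n + 3)
        rw [monicSum_cubicWeight_eq_zero hF A B (by omega), mul_zero, sum_Icc_succ_top (by omega),
          sum_Icc_succ_top (by omega), sum_Icc_succ_top (by omega), Nat.sub_self, h0,
          show n + 3 - (n + 2) = 1 by omega, show n + 3 - (n + 1) = 2 by omega,
          sum_eq_zero, zero_add] at this
        · rw [powerSum, ih (n + 1) (by omega), ih n (by omega)]
          linear_combination -this
        · intro j hj
          rw [mem_Icc] at hj
          rw [monicSum_cubicWeight_eq_zero hF A B (by omega), mul_zero]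
  obtain ⟨n, hn⟩ := Nat.exists_eq_add_of_le' (Module.finrank_pos (R := k) (M := L))
  rw [hn, key]

end CubicSums

/-! ### Point counts and minimal models of Weierstrass curves -/

section PointCount

open Finset

variable {k : Type*} [Field k]

/-- Completing the square and the cube; the two equations differ by the factor `46656 = 2⁶ · 3⁶`. -/
lemma equation_iff_cubic (h2 : (2 : k) ≠ 0) (h3 : (3 : k) ≠ 0) (W : WeierstrassCurve k) (x y : k) :
    W.toAffine.Equation x y ↔ (108 * (2 * y + W.a₁ * x + W.a₃)) ^ 2 =
      (36 * x + 3 * W.b₂) ^ 3 + -27 * W.c₄ * (36 * x + 3 * W.b₂) + -54 * W.c₆ := by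
  have h : (46656 : k) ≠ 0 := by
    rw [show (46656 : k) = 2 ^ 6 * 3 ^ 6 by norm_num]
    exact mul_ne_zero (pow_ne_zero _ h2) (pow_ne_zero _ h3)
  have key : (108 * (2 * y + W.a₁ * x + W.a₃)) ^ 2 -
      ((36 * x + 3 * W.b₂) ^ 3 + -27 * W.c₄ * (36 * x + 3 * W.b₂) + -54 * W.c₆) =
      46656 * (y ^ 2 + W.a₁ * x * y + W.a₃ * y - (x ^ 3 + W.a₂ * x ^ 2 + W.a₄ * x + W.a₆)) := by
    simp only [WeierstrassCurve.c₄, WeierstrassCurve.c₆, WeierstrassCurve.b₂, WeierstrassCurve.b₄,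
      WeierstrassCurve.b₆]
    ring
  rw [WeierstrassCurve.Affine.equation_iff', ← sub_eq_zero (a := (108 * _) ^ 2), key,
    mul_eq_zero, or_iff_right h]

variable [Fintype k] [DecidableEq k]

lemma card_sq_eq (hF : ringChar k ≠ 2) (f : k → k) :
    (Nat.card {P : k × k // P.2 ^ 2 = f P.1} : ℤ) =
      Fintype.card k + ∑ x, quadraticChar k (f x) := by
  rw [Nat.card_eq_fintype_card, Fintype.card_subtype, card_filter, ← univ_product_univ,
    sum_product]
  push_cast
  have : ∀ x : k, ∑ y : k, (if y ^ 2 = f x then 1 else 0 : ℤ) = 1 + quadraticChar k (f x) := by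
    intro x
    rw [add_comm, ← quadraticChar_card_sqrts hF (f x), ← sum_filter, sum_const]
    simp only [nsmul_eq_mul, mul_one, Nat.cast_inj]
    congr 1
    ext y
    simp
  simp_rw [this]
  rw [sum_add_distrib]
  simp

/-- The character sum that gives the trace of Frobenius of a Weierstrass curve with invariants
`c₄`, `c₆`. -/
def frobSum (k : Type*) [Field k] [Fintype k] [DecidableEq k] (c₄ c₆ : k) : ℤ :=
  ∑ x, quadraticChar k (x ^ 3 + -27 * c₄ * x + -54 * c₆)

lemma card_equation (hF : ringChar k ≠ 2) (h3 : (3 : k) ≠ 0) (W : WeierstrassCurve k) :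
    (Nat.card {P : k × k // W.toAffine.Equation P.1 P.2} : ℤ) =
      Fintype.card k + frobSum k W.c₄ W.c₆ := by
  have h2 : (2 : k) ≠ 0 := Ring.two_ne_zero hF
  rw [frobSum, ← card_sq_eq hF]
  have h36 : (36 : k) ≠ 0 := by
    rw [show (36 : k) = 2 ^ 2 * 3 ^ 2 by norm_num]
    exact mul_ne_zero (pow_ne_zero _ h2) (pow_ne_zero _ h3)
  have h216 : (216 : k) ≠ 0 := by
    rw [show (216 : k) = 2 ^ 3 * 3 ^ 3 by norm_num]
    exact mul_ne_zero (pow_ne_zero _ h2) (pow_ne_zero _ h3)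
  congr 1
  refine Nat.card_congr (Equiv.subtypeEquiv
    { toFun := fun P => (36 * P.1 + 3 * W.b₂, 108 * (2 * P.2 + W.a₁ * P.1 + W.a₃))
      invFun := fun P => ((P.1 - 3 * W.b₂) / 36,
        P.2 / 216 - (W.a₁ * ((P.1 - 3 * W.b₂) / 36) + W.a₃) / 2)
      left_inv := ?_
      right_inv := ?_ } ?_)
  · rintro ⟨x, y⟩
    have e1 : (36 * x + 3 * W.b₂ - 3 * W.b₂) / 36 = x := by
      rw [add_sub_cancel_right, mul_div_cancel_left₀ _ h36]
    simp only [e1, Prod.mk.injEq, true_and]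
    rw [show (216 : k) = 108 * 2 by norm_num] at h216 ⊢
    have h108 := left_ne_zero_of_mul h216
    field_simp
    ring
  · rintro ⟨x, y⟩
    have e1 : 36 * ((x - 3 * W.b₂) / 36) + 3 * W.b₂ = x := by
      rw [mul_div_cancel₀ _ h36, sub_add_cancel]
    simp only [e1, Prod.mk.injEq, true_and]
    rw [show (216 : k) = 108 * 2 by norm_num] at h216 ⊢
    have h108 := left_ne_zero_of_mul h216
    generalize (x - 3 * W.b₂) / 36 = z
    field_simp
    ring
  · rintro ⟨x, y⟩
    exact equation_iff_cubic h2 h3 W x y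

/-- Replacing `x` by `u² x` pulls out the square `(u³)²`. Hence models that differ by a unit scaling
give the same trace. -/
lemma frobSum_scale {u : k} (hu : u ≠ 0) (c₄ c₆ : k) :
    frobSum k (u ^ 4 * c₄) (u ^ 6 * c₆) = frobSum k c₄ c₆ := by
  rw [frobSum, frobSum, ← Equiv.sum_comp (Equiv.mulLeft₀ (u ^ 2) (pow_ne_zero 2 hu))]
  refine sum_congr rfl fun x _ => ?_
  rw [Equiv.mulLeft₀_apply, show (u ^ 2 * x) ^ 3 + -27 * (u ^ 4 * c₄) * (u ^ 2 * x) +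
    -54 * (u ^ 6 * c₆) = (u ^ 3) ^ 2 * (x ^ 3 + -27 * c₄ * x + -54 * c₆) by ring, map_mul,
    quadraticChar_sq_one' (pow_ne_zero 3 hu), one_mul]

lemma frobSum_zero (hF : ringChar k ≠ 2) : frobSum k 0 0 = 0 := by
  rw [frobSum, ← quadraticChar_sum_zero hF]
  refine sum_congr rfl fun x _ => ?_
  by_cases hx : x = 0
  · simp [hx]
  · rw [show x ^ 3 + -27 * 0 * x + -54 * 0 = x ^ 2 * x by ring, map_mul, quadraticChar_sq_one' hx,
      one_mul]

/-- One formula covers smooth and singular cubics, because the second eigenvalue parameter is 0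
exactly when the discriminant vanishes, which is the convention for a bad Euler factor. -/
lemma powerSum_frobSum (hF : ringChar k ≠ 2) (h3 : (3 : k) ≠ 0) (W : WeierstrassCurve k)
    [Decidable (W.Δ = 0)] {L : Type*}
    [Field L] [Fintype L] [DecidableEq L] [Algebra k L] :
    powerSum (-frobSum k W.c₄ W.c₆) (if W.Δ = 0 then 0 else (Fintype.card k : ℤ))
      (Module.finrank k L) = -frobSum L (algebraMap k L W.c₄) (algebraMap k L W.c₆) := by
  have h2 : (2 : k) ≠ 0 := Ring.two_ne_zero hF
  have h := powerSum_eq_neg_sum hF h3 (-27 * W.c₄) (-54 * W.c₆) (L := L)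
  have hdisc : (4 * (-27 * W.c₄) ^ 3 + 27 * (-54 * W.c₆) ^ 2 = 0) ↔ W.Δ = 0 := by
    have hc := W.c_relation
    have h0 : ((2 ^ 8 * 3 ^ 12 : k)) ≠ 0 := mul_ne_zero (pow_ne_zero _ h2) (pow_ne_zero _ h3)
    rw [show 4 * (-27 * W.c₄) ^ 3 + 27 * (-54 * W.c₆) ^ 2 = -(2 ^ 8 * 3 ^ 12) * W.Δ by
      linear_combination 78732 * hc]
    simp [h0]
  simp only [hdisc] at h
  simp only [map_mul, map_neg, map_ofNat] at h
  exact h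

end PointCount

/-! ### Comparison with a minimal model over a discrete valuation ring -/

section Minimal

variable {R : Type*} [CommRing R] [IsDomain R] [IsDiscreteValuationRing R]
variable {K : Type*} [Field K] [Algebra R K] [IsFractionRing R K]

open IsDiscreteValuationRing IsDedekindDomain.HeightOneSpectrum WeierstrassCurve

lemma valuation_maximalIdeal_eq_one_iff (r : R) :
    valuation K (maximalIdeal R) (algebraMap R K r) = 1 ↔ IsUnit r := by
  have h := valuation_lt_one_iff_mem (K := K) (maximalIdeal R) r
  have h2 := valuation_le_one (K := K) (maximalIdeal R) r
  rw [← not_iff_not, ← mem_nonunits_iff, ← IsLocalRing.mem_maximalIdeal]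
  exact (show ¬ _ ↔ _ from (lt_iff_le_and_ne.trans (and_iff_right h2)).symm).trans h

/-- An integral model with unit `Δ` or unit `c₄` is already minimal. If `w` is the scaling to the
minimal model `M`, maximality of the valuation of the discriminant of `M` gives `|w| ≥ 1`, while
integrality of `Δ` or `c₄` of `M` gives `|w| ≤ 1`; so `w` is a unit and the invariants change by its
powers. -/
lemma exists_unit_of_isMinimal (M W : WeierstrassCurve K) [IsMinimal R M] (C : VariableChange K)
    (hM : M = C • W) (W₀ : WeierstrassCurve R) (hW : W = W₀.map (algebraMap R K))
    (hΔ : W₀.Δ ≠ 0) (h : IsUnit W₀.Δ ∨ IsUnit W₀.c₄) :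
    ∃ r : R, IsUnit r ∧ (integralModel R M).c₄ = r ^ 4 * W₀.c₄ ∧
      (integralModel R M).c₆ = r ^ 6 * W₀.c₆ := by
  have hinj := IsFractionRing.injective R K
  set val := valuation K (maximalIdeal R)
  set w : K := ((C.u⁻¹ : Kˣ) : K) with hw
  have hMΔ : M.Δ = w ^ 12 * W.Δ := by rw [hM, variableChange_Δ]
  have hM4 : M.c₄ = w ^ 4 * W.c₄ := by rw [hM, variableChange_c₄]
  have hM6 : M.c₆ = w ^ 6 * W.c₆ := by rw [hM, variableChange_c₆]
  have hWΔ : W.Δ = algebraMap R K W₀.Δ := by rw [hW, map_Δ]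
  have hW4 : W.c₄ = algebraMap R K W₀.c₄ := by rw [hW, map_c₄]
  have hW6 : W.c₆ = algebraMap R K W₀.c₆ := by rw [hW, map_c₆]
  have hle : ∀ r : R, val (algebraMap R K r) ≤ 1 := fun r => valuation_le_one _ r
  have hMint : IsIntegral R W := ⟨W₀, hW⟩
  have hback : C⁻¹ • M = W := by rw [hM, inv_smul_smul]
  have hmax := (IsMinimal.val_Δ_maximal (R := R) (W := M)).2 (j := C⁻¹)
    (by simpa only [hback] using hMint)
  have hge : val W.Δ ≤ val M.Δ := by
    -- Maximality only says that a competitor at least as large is also at most as large; in the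
    -- remaining case the inequality is immediate.
    rcases le_total (valuation_Δ_aux R (C⁻¹ • M)) (valuation_Δ_aux R ((1 : VariableChange K) • M))
      with h1 | h1
    · rw [hback, one_smul] at h1
      have := Subtype.coe_le_coe.mpr h1
      rwa [valuation_Δ_aux_eq_of_isIntegral, valuation_Δ_aux_eq_of_isIntegral] at this
    · have h1 := hmax h1
      simp only [hback, one_smul] at h1
      have := Subtype.coe_le_coe.mpr h1
      rwa [valuation_Δ_aux_eq_of_isIntegral, valuation_Δ_aux_eq_of_isIntegral] at this
  have hΔ0 : val W.Δ ≠ 0 := by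
    rw [Valuation.ne_zero_iff, hWΔ]
    exact fun h0 => hΔ (hinj (by rw [h0, map_zero]))
  have hw1 : 1 ≤ val w := by
    rw [hMΔ, map_mul, map_pow] at hge
    by_contra hlt
    have : val w ^ 12 < 1 := pow_lt_one₀ zero_le (not_le.mp hlt) (by norm_num)
    have h3 := mul_lt_mul_of_pos_right this (zero_lt_iff.mpr hΔ0)
    rw [one_mul] at h3
    exact absurd hge (not_le.mpr h3)
  have hw2 : val w ≤ 1 := by
    rcases h with h | h
    · have h1 := hle (integralModel R M).Δ
      rw [integralModel_Δ_eq, hMΔ, map_mul, hWΔ, (valuation_maximalIdeal_eq_one_iff _).mpr h,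
        mul_one, map_pow] at h1
      exact (pow_le_one_iff (by norm_num)).mp h1
    · have h1 := hle (integralModel R M).c₄
      rw [integralModel_c₄_eq, hM4, map_mul, hW4, (valuation_maximalIdeal_eq_one_iff _).mpr h,
        mul_one, map_pow] at h1
      exact (pow_le_one_iff (by norm_num)).mp h1
  have hval : val w = 1 := le_antisymm hw2 hw1
  obtain ⟨r, hr⟩ := exists_lift_of_le_one (A := R) (K := K) hval.le
  refine ⟨r, ?_, ?_, ?_⟩
  · rw [← valuation_maximalIdeal_eq_one_iff (K := K), hr]; exact hval
  · apply hinj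
    rw [integralModel_c₄_eq, hM4, hW4, ← hr]; simp
  · apply hinj
    rw [integralModel_c₆_eq, hM6, hW6, ← hr]; simp

end Minimal

/-! ### The places of `F(t)` and the points of the projective line -/

section Places

variable {F : Type*} [Field F]

instance (v : Place F) : Algebra F v.residueField := v.constHom.toAlgebra

lemma Place.deg_eq_finrank (v : Place F) : v.deg = Module.finrank F v.residueField := rfl

lemma Place.ext_ring {v w : Place F} (h : v.ring = w.ring) : v = w := by
  cases v; cases w; congr

lemma Place.algebraMap_residueField (v : Place F) (c : F) :
    algebraMap F v.residueField c = IsLocalRing.residue v.ring ⟨RatFunc.C c, v.const_mem c⟩ := rfl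

lemma Place.exists_notMem (v : Place F) : ∃ x, x ∉ v.ring := by
  obtain ⟨ϖ, hϖ⟩ := IsDiscreteValuationRing.exists_irreducible v.ring
  refine ⟨(ϖ : RatFunc F)⁻¹, fun h => hϖ.not_isUnit ?_⟩
  refine IsUnit.of_mul_eq_one ⟨_, h⟩ (Subtype.ext ?_)
  exact mul_inv_cancel₀ (fun h0 => hϖ.ne_zero (Subtype.ext h0))

/-- The reduction of polynomials at a place where `t` is integral. -/
def Place.polyHom (v : Place F) (h : RatFunc.X ∈ v.ring) : F[X] →+* v.ring :=
  Polynomial.eval₂RingHom (RatFunc.C.codRestrict v.ring.toSubring v.const_mem) ⟨RatFunc.X, h⟩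

lemma Place.coe_polyHom (v : Place F) (h : RatFunc.X ∈ v.ring) (p : F[X]) :
    (v.polyHom h p : RatFunc F) = algebraMap F[X] (RatFunc F) p := by
  have : (v.ring.subtype : v.ring →+* RatFunc F).comp (v.polyHom h) =
      algebraMap F[X] (RatFunc F) := by
    refine Polynomial.ringHom_ext (fun c => ?_) ?_
    · simp only [Place.polyHom, RingHom.comp_apply, Polynomial.coe_eval₂RingHom,
        Polynomial.eval₂_C]
      rfl
    · simp only [Place.polyHom, RingHom.comp_apply, Polynomial.coe_eval₂RingHom,
        Polynomial.eval₂_X, RatFunc.algebraMap_X]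
      rfl
  exact DFunLike.congr_fun this p

/-- The value of the coordinate `t` at a place. -/
def Place.coord (v : Place F) (h : RatFunc.X ∈ v.ring) : v.residueField :=
  IsLocalRing.residue v.ring ⟨RatFunc.X, h⟩

lemma Place.residue_polyHom (v : Place F) (h : RatFunc.X ∈ v.ring) (p : F[X]) :
    IsLocalRing.residue v.ring (v.polyHom h p) = Polynomial.aeval (v.coord h) p := by
  rw [Place.polyHom, Polynomial.coe_eval₂RingHom, Polynomial.hom_eval₂]
  rfl

/-- The valuation ring is the local ring at the point `t = v.coord h`. Coprimality of numerator and
denominator excludes that both vanish there. -/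
lemma Place.mem_ring_iff (v : Place F) (h : RatFunc.X ∈ v.ring) (x : RatFunc F) :
    x ∈ v.ring ↔ Polynomial.aeval (v.coord h) x.denom ≠ 0 := by
  have hx : x * algebraMap F[X] (RatFunc F) x.denom = algebraMap F[X] (RatFunc F) x.num := by
    have := RatFunc.num_div_denom x
    rw [div_eq_iff (RatFunc.algebraMap_ne_zero x.denom_ne_zero)] at this
    exact this.symm
  constructor
  · intro hm h0
    have e : (⟨x, hm⟩ : v.ring) * v.polyHom h x.denom = v.polyHom h x.num := by
      apply Subtype.ext
      rw [v.coe_polyHom h, ← hx, ← v.coe_polyHom h]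
      rfl
    have e1 := congrArg (IsLocalRing.residue v.ring) e
    rw [map_mul, v.residue_polyHom, v.residue_polyHom, h0, mul_zero] at e1
    obtain ⟨a, b, hab⟩ := RatFunc.isCoprime_num_denom x
    have e2 := congrArg (Polynomial.aeval (v.coord h)) hab
    rw [map_add, map_mul, map_mul, h0, ← e1] at e2
    simp at e2
  · intro h0
    rw [← v.residue_polyHom, IsLocalRing.residue_ne_zero_iff_isUnit] at h0
    obtain ⟨u, hu⟩ := h0
    have : x = ((v.polyHom h x.num * (u⁻¹ : v.ringˣ) : v.ring) : RatFunc F) := by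
      have e : v.polyHom h x.denom * (u⁻¹ : v.ringˣ) = 1 := by rw [← hu, Units.mul_inv]
      have e1 := congrArg (Subtype.val) e
      have e2 : ((v.polyHom h x.denom : v.ring) : RatFunc F) * ((u⁻¹ : v.ringˣ) : v.ring) = 1 := e1
      rw [v.coe_polyHom h] at e2
      change x = (v.polyHom h x.num : RatFunc F) * (((u⁻¹ : v.ringˣ) : v.ring) : RatFunc F)
      rw [v.coe_polyHom h, ← hx, mul_assoc, e2, mul_one]
    rw [this]
    exact Subtype.prop _

lemma Place.residue_mul_aeval (v : Place F) (h : RatFunc.X ∈ v.ring) (x : v.ring) :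
    IsLocalRing.residue v.ring x * Polynomial.aeval (v.coord h) (x : RatFunc F).denom =
      Polynomial.aeval (v.coord h) (x : RatFunc F).num := by
  rw [← v.residue_polyHom h, ← v.residue_polyHom h, ← map_mul]
  congr 1
  apply Subtype.ext
  change (x : RatFunc F) * (v.polyHom h _ : RatFunc F) = _
  rw [v.coe_polyHom, v.coe_polyHom]
  have := RatFunc.num_div_denom (x : RatFunc F)
  rw [div_eq_iff (RatFunc.algebraMap_ne_zero (RatFunc.denom_ne_zero _))] at this
  exact this.symm

lemma Place.residue_eq_div (v : Place F) (h : RatFunc.X ∈ v.ring) (x : v.ring) :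
    IsLocalRing.residue v.ring x = Polynomial.aeval (v.coord h) (x : RatFunc F).num /
      Polynomial.aeval (v.coord h) (x : RatFunc F).denom := by
  rw [eq_div_iff ((v.mem_ring_iff h x).mp x.2), v.residue_mul_aeval]

/-- If the coordinate were transcendental, no denominator would vanish at it and the valuation ring
would be all of `F(t)`. -/
lemma Place.isIntegral_coord (v : Place F) (h : RatFunc.X ∈ v.ring) :
    IsIntegral F (v.coord h) := by
  rw [← isAlgebraic_iff_isIntegral]
  by_contra hn
  obtain ⟨x, hx⟩ := v.exists_notMem
  rw [v.mem_ring_iff h, not_not] at hx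
  exact hn ⟨x.denom, x.denom_ne_zero, hx⟩

lemma Place.adjoin_coord (v : Place F) (h : RatFunc.X ∈ v.ring) :
    IntermediateField.adjoin F {v.coord h} = ⊤ := by
  rw [eq_top_iff]
  rintro y -
  obtain ⟨x, rfl⟩ := IsLocalRing.residue_surjective y
  rw [v.residue_eq_div h]
  have : ∀ p : F[X], Polynomial.aeval (v.coord h) p ∈
      IntermediateField.adjoin F {v.coord h} := fun p => by
    have := Subtype.prop (Polynomial.aeval (IntermediateField.AdjoinSimple.gen F (v.coord h)) p)
    rwa [← IntermediateField.aeval_coe] at this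
  exact div_mem (this _) (this _)

lemma Place.algHom_ext (v : Place F) (h : RatFunc.X ∈ v.ring) {E : Type*} [Field E] [Algebra F E]
    {σ τ : v.residueField →ₐ[F] E} (hst : σ (v.coord h) = τ (v.coord h)) : σ = τ := by
  ext y
  obtain ⟨x, rfl⟩ := IsLocalRing.residue_surjective y
  rw [v.residue_eq_div h, map_div₀, map_div₀, ← Polynomial.aeval_algHom_apply,
    ← Polynomial.aeval_algHom_apply, ← Polynomial.aeval_algHom_apply,
    ← Polynomial.aeval_algHom_apply, hst]

lemma Place.eq_of_coord {v w : Place F} (hv : RatFunc.X ∈ v.ring) (hw : RatFunc.X ∈ w.ring)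
    {E : Type*} [Field E] [Algebra F E] (σ : v.residueField →ₐ[F] E) (τ : w.residueField →ₐ[F] E)
    (h : σ (v.coord hv) = τ (w.coord hw)) : v = w := by
  apply Place.ext_ring
  ext x
  rw [v.mem_ring_iff hv, w.mem_ring_iff hw, ← map_ne_zero σ, ← map_ne_zero τ,
    ← Polynomial.aeval_algHom_apply, ← Polynomial.aeval_algHom_apply, h]

/-- The place attached to a maximal ideal of `F[t]`. -/
def finitePlace (P : IsDedekindDomain.HeightOneSpectrum F[X]) : Place F where
  ring := (P.valuation (RatFunc F)).valuationSubring
  const_mem c := by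
    rw [Valuation.mem_valuationSubring_iff, ← RatFunc.algebraMap_C]
    exact P.valuation_le_one _
  isDVR := (P.valuation (RatFunc F)).valuationSubring_isDiscreteValuationRing

lemma X_mem_finitePlace (P : IsDedekindDomain.HeightOneSpectrum F[X]) :
    RatFunc.X ∈ (finitePlace P).ring := by
  change _ ∈ (P.valuation (RatFunc F)).valuationSubring
  rw [Valuation.mem_valuationSubring_iff, ← RatFunc.algebraMap_X]
  exact P.valuation_le_one _

lemma aeval_coord_finitePlace (P : IsDedekindDomain.HeightOneSpectrum F[X]) (p : F[X]) :
    Polynomial.aeval ((finitePlace P).coord (X_mem_finitePlace P)) p = 0 ↔ p ∈ P.asIdeal := by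
  rw [← Place.residue_polyHom, IsLocalRing.residue_eq_zero_iff,
    ← P.valuation_lt_one_iff_mem (K := RatFunc F)]
  change _ ↔ P.valuation (RatFunc F) (algebraMap F[X] (RatFunc F) p) < 1
  rw [← (finitePlace P).coe_polyHom (X_mem_finitePlace P)]
  exact Valuation.mem_maximalIdeal_iff (RatFunc F) (P.valuation (RatFunc F))

/-- Take the prime of `F[t]` that consists of the polynomials vanishing at `θ`. Evaluation of
fractions at `θ` is a local homomorphism on its valuation ring, so it factors through the residue
field. -/
theorem exists_place_of_isIntegral {E : Type*} [Field E] [Algebra F E] {θ : E}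
    (hθ : IsIntegral F θ) : ∃ (v : Place F) (h : RatFunc.X ∈ v.ring)
      (σ : v.residueField →ₐ[F] E), σ (v.coord h) = θ := by
  let P : IsDedekindDomain.HeightOneSpectrum F[X] :=
    { asIdeal := RingHom.ker (Polynomial.aeval θ : F[X] →ₐ[F] E)
      isPrime := RingHom.ker_isPrime _
      ne_bot := by
        intro h
        have : minpoly F θ ∈ RingHom.ker (Polynomial.aeval θ : F[X] →ₐ[F] E) := minpoly.aeval F θ
        rw [h] at this
        exact minpoly.ne_zero hθ this }
  set v := finitePlace P with hv
  have hX : RatFunc.X ∈ v.ring := X_mem_finitePlace P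
  have hmem : ∀ x : RatFunc F, x ∈ v.ring ↔ Polynomial.aeval θ x.denom ≠ 0 := by
    intro x
    rw [v.mem_ring_iff hX, ne_eq, aeval_coord_finitePlace]
    rfl
  let ev : v.ring → E := fun x => Polynomial.aeval θ (x : RatFunc F).num /
    Polynomial.aeval θ (x : RatFunc F).denom
  have hden : ∀ x : v.ring, Polynomial.aeval θ (x : RatFunc F).denom ≠ 0 := fun x =>
    (hmem x).mp x.2
  let f : v.ring →+* E :=
    { toFun := ev
      map_one' := by simp [ev]
      map_zero' := by simp [ev]
      map_add' := fun x y => by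
        have h := congrArg (Polynomial.aeval θ) (RatFunc.num_denom_add (x : RatFunc F) y)
        simp only [map_mul, map_add] at h
        have h1 := hden x
        have h2 := hden y
        have h3 := hden (x + y)
        simp only [ev]
        rw [div_add_div _ _ h1 h2, div_eq_div_iff h3 (mul_ne_zero h1 h2)]
        exact h
      map_mul' := fun x y => by
        have h := congrArg (Polynomial.aeval θ) (RatFunc.num_denom_mul (x : RatFunc F) y)
        simp only [map_mul] at h
        have h1 := hden x
        have h2 := hden y
        have h3 := hden (x * y)
        simp only [ev]
        rw [div_mul_div_comm, div_eq_div_iff h3 (mul_ne_zero h1 h2)]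
        exact h }
  have hloc : IsLocalHom f := by
    constructor
    intro x hx
    have hx0 : (x : RatFunc F) ≠ 0 := by
      intro h0
      have : x = 0 := Subtype.ext h0
      rw [this, map_zero] at hx
      exact not_isUnit_zero hx
    have hnum : Polynomial.aeval θ (x : RatFunc F).num ≠ 0 := by
      intro h0
      apply hx.ne_zero
      change Polynomial.aeval θ (x : RatFunc F).num / _ = 0
      rw [h0, zero_div]
    have hinv : (x : RatFunc F)⁻¹ ∈ v.ring := by
      rw [hmem]
      intro h0
      apply hnum
      obtain ⟨t, ht⟩ := RatFunc.denom_inv_dvd hx0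
      rw [ht, map_mul, h0, zero_mul]
    exact IsUnit.of_mul_eq_one ⟨_, hinv⟩ (Subtype.ext (mul_inv_cancel₀ hx0))
  refine ⟨v, hX, { IsLocalRing.ResidueField.lift f with commutes' := ?_ }, ?_⟩
  · intro c
    change Polynomial.aeval θ (RatFunc.C c).num / Polynomial.aeval θ (RatFunc.C c).denom = _
    simp
  · change Polynomial.aeval θ (RatFunc.X : RatFunc F).num /
      Polynomial.aeval θ (RatFunc.X : RatFunc F).denom = _
    simp

open Classical in
/-- The place at infinity. -/
def inftyPlace (F : Type*) [Field F] : Place F where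
  ring := (RatFunc.inftyValuation F).valuationSubring
  const_mem c := by
    rw [Valuation.mem_valuationSubring_iff]
    by_cases hc : c = 0
    · simp [hc]
    · rw [RatFunc.inftyValuation.C F hc]
  isDVR := (RatFunc.inftyValuation F).valuationSubring_isDiscreteValuationRing

lemma X_notMem_inftyPlace : RatFunc.X ∉ (inftyPlace F).ring := by
  classical
  intro h
  have h2 := (Valuation.mem_valuationSubring_iff _ _).mp h
  rw [RatFunc.inftyValuation.X, ← WithZero.exp_zero, WithZero.exp_le_exp] at h2
  omega

lemma Place.one_lt_valuation_X {v : Place F} (h : RatFunc.X ∉ v.ring) :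
    1 < v.ring.valuation RatFunc.X := by
  rw [← not_le, ValuationSubring.valuation_le_one_iff]
  exact h

instance (v : Place F) : v.ring.valuation.IsTrivialOn F where
  eq_one c hc := by
    have h : ∀ a : F, v.ring.valuation (RatFunc.C a) ≤ 1 := fun a =>
      (ValuationSubring.valuation_le_one_iff _ _).mpr (v.const_mem a)
    refine le_antisymm (h c) ?_
    have h1 := h c⁻¹
    rw [map_inv₀, map_inv₀] at h1
    have h0 : v.ring.valuation (RatFunc.C c) ≠ 0 := by simpa using hc
    exact (inv_le_one₀ (zero_lt_iff.mpr h0)).mp h1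

lemma eq_inftyPlace {v : Place F} (h : RatFunc.X ∉ v.ring) : v = inftyPlace F := by
  classical
  apply Place.ext_ring
  have h1 := RatFunc.valuation_isEquiv_inftyValuation_of_one_lt_valuation_X
    (Place.one_lt_valuation_X h)
  rw [Valuation.isEquiv_iff_valuationSubring, ValuationSubring.valuationSubring_valuation] at h1
  rw [h1]
  unfold inftyPlace
  congr

lemma mem_inftyPlace_iff {x : RatFunc F} (hx : x ≠ 0) :
    x ∈ (inftyPlace F).ring ↔ x.intDegree ≤ 0 := by
  classical
  have : x ∈ (inftyPlace F).ring ↔ _ := Valuation.mem_valuationSubring_iff _ _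
  rw [this, RatFunc.inftyValuation_apply, RatFunc.inftyValuation_of_nonzero _ hx,
    ← WithZero.exp_zero, WithZero.exp_le_exp]

lemma residue_inftyPlace_eq_zero {x : (inftyPlace F).ring} (h0 : (x : RatFunc F) ≠ 0)
    (hx : (x : RatFunc F).intDegree < 0) : IsLocalRing.residue (inftyPlace F).ring x = 0 := by
  rw [IsLocalRing.residue_eq_zero_iff, IsLocalRing.mem_maximalIdeal, mem_nonunits_iff]
  rintro ⟨u, hu⟩
  have h1 : (x : RatFunc F)⁻¹ ∈ (inftyPlace F).ring := by
    have e : (x * (u⁻¹ : (inftyPlace F).ringˣ) : (inftyPlace F).ring) = 1 := by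
      rw [← hu, Units.mul_inv]
    have e1 : (x : RatFunc F) * ((u⁻¹ : (inftyPlace F).ringˣ) : (inftyPlace F).ring) = 1 :=
      congrArg Subtype.val e
    rw [inv_eq_of_mul_eq_one_right e1]
    exact Subtype.prop _
  rw [mem_inftyPlace_iff (inv_ne_zero h0), RatFunc.intDegree_inv] at h1
  omega

/-- A function of degree 0 is congruent to the leading coefficient of its numerator (the denominator
being monic), since the difference has negative degree. So every residue class is constant. -/
lemma deg_inftyPlace : (inftyPlace F).deg = 1 := by
  classical
  rw [Place.deg_eq_finrank]
  have hsurj : Function.Surjective (algebraMap F (inftyPlace F).residueField) := by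
    intro y
    obtain ⟨x, rfl⟩ := IsLocalRing.residue_surjective y
    by_cases h0 : (x : RatFunc F) = 0
    · refine ⟨0, ?_⟩
      have : x = 0 := Subtype.ext h0
      rw [this, map_zero, map_zero]
    have hdeg := (mem_inftyPlace_iff h0).mp x.2
    rcases hdeg.lt_or_eq with hlt | heq
    · exact ⟨0, by rw [residue_inftyPlace_eq_zero h0 hlt, map_zero]⟩
    · set n := (x : RatFunc F).num with hn
      set e := (x : RatFunc F).denom with he
      have hn0 : n ≠ 0 := RatFunc.num_ne_zero h0
      have hem : e.Monic := RatFunc.monic_denom _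
      have hnd : n.natDegree = e.natDegree := by
        have : (n.natDegree : ℤ) - e.natDegree = 0 := heq
        omega
      refine ⟨n.leadingCoeff, ?_⟩
      rw [Place.algebraMap_residueField, eq_comm, ← sub_eq_zero, ← map_sub]
      set y : (inftyPlace F).ring := x - ⟨RatFunc.C n.leadingCoeff,
        (inftyPlace F).const_mem _⟩ with hy
      by_cases hy0 : (y : RatFunc F) = 0
      · have : y = 0 := Subtype.ext hy0
        rw [this, map_zero]
      apply residue_inftyPlace_eq_zero hy0
      have hyv : (y : RatFunc F) = algebraMap F[X] (RatFunc F)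
          (n - Polynomial.C n.leadingCoeff * e) / algebraMap F[X] (RatFunc F) e := by
        have h1 : (y : RatFunc F) = (x : RatFunc F) - RatFunc.C n.leadingCoeff := rfl
        have h2 : algebraMap F[X] (RatFunc F) e ≠ 0 :=
          RatFunc.algebraMap_ne_zero (RatFunc.denom_ne_zero _)
        rw [h1, ← RatFunc.num_div_denom (x : RatFunc F), ← hn, ← he, map_sub, map_mul,
          RatFunc.algebraMap_C, sub_div, mul_div_cancel_right₀ _ h2]
      have hnum0 : n - Polynomial.C n.leadingCoeff * e ≠ 0 := by
        intro h
        rw [h, map_zero, zero_div] at hyv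
        exact hy0 hyv
      rw [hyv, RatFunc.intDegree_div (RatFunc.algebraMap_ne_zero hnum0)
        (RatFunc.algebraMap_ne_zero hem.ne_zero), RatFunc.intDegree_polynomial,
        RatFunc.intDegree_polynomial]
      have hlt : (n - Polynomial.C n.leadingCoeff * e).degree < n.degree := by
        apply Polynomial.degree_sub_lt_left _ hn0
        · rw [Polynomial.leadingCoeff_mul, Polynomial.leadingCoeff_C, hem.leadingCoeff, mul_one]
        · rw [Polynomial.degree_C_mul (Polynomial.leadingCoeff_ne_zero.mpr hn0),
            Polynomial.degree_eq_natDegree hn0, Polynomial.degree_eq_natDegree hem.ne_zero, hnd]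
      have := Polynomial.natDegree_lt_natDegree hnum0 hlt
      omega
  let e := AlgEquiv.ofBijective (Algebra.ofId F (inftyPlace F).residueField)
    ⟨RingHom.injective _, hsurj⟩
  rw [← e.toLinearEquiv.finrank_eq, Module.finrank_self]

lemma Place.finiteDimensional (v : Place F) : FiniteDimensional F v.residueField := by
  by_cases h : RatFunc.X ∈ v.ring
  · have := IntermediateField.adjoin.finiteDimensional (v.isIntegral_coord h)
    rw [v.adjoin_coord h] at this
    exact IntermediateField.topEquiv.toLinearEquiv.finiteDimensional
  · rw [eq_inftyPlace h]
    apply Module.finite_of_finrank_pos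
    rw [← Place.deg_eq_finrank, deg_inftyPlace]
    exact one_pos

lemma Place.deg_pos (v : Place F) : 0 < v.deg := by
  have := v.finiteDimensional
  exact Module.finrank_pos

section FiniteField

variable [Finite F]

lemma Place.finite_residueField (v : Place F) : Finite v.residueField := by
  have := v.finiteDimensional
  exact Module.finite_of_finite F

/-- Choose an embedding of each residue field into the extension of degree `n`; the image of the
coordinate determines the place, and only the infinite place has no coordinate. -/
lemma finite_places_deg (n : ℕ) : {v : Place F | v.deg = n}.Finite := by
  classical
  rcases Nat.eq_zero_or_pos n with rfl | hn
  · convert Set.finite_empty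
    ext v
    simpa using v.deg_pos.ne'
  obtain ⟨p, hp⟩ := CharP.exists F
  have : Fact p.Prime := ⟨CharP.char_is_prime F p⟩
  have : NeZero n := ⟨hn.ne'⟩
  let E := FiniteField.Extension F p n
  have hE : Module.finrank F E = n := FiniteField.finrank_extension F p n
  have hfin : {v : Place F | v.deg = n ∧ RatFunc.X ∈ v.ring}.Finite := by
    have hex : ∀ v : {v : Place F | v.deg = n ∧ RatFunc.X ∈ v.ring},
        Nonempty (v.1.residueField →ₐ[F] E) := fun v =>
      FiniteField.nonempty_algHom_of_finrank_dvd (by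
        rw [hE, ← v.1.deg_eq_finrank, v.2.1])
    rw [← Set.finite_coe_iff]
    refine Finite.of_injective (fun v => (hex v).some (v.1.coord v.2.2)) ?_
    intro v w h
    exact Subtype.ext (Place.eq_of_coord _ _ _ _ h)
  refine (hfin.union (Set.finite_singleton (inftyPlace F))).subset ?_
  intro v hv
  by_cases h : RatFunc.X ∈ v.ring
  · exact Or.inl ⟨hv, h⟩
  · exact Or.inr (eq_inftyPlace h)

lemma finite_places_deg_le (n : ℕ) : {v : Place F | v.deg ≤ n}.Finite := by
  refine ((Set.finite_Iic n).biUnion (fun m _ => finite_places_deg (F := F) m)).subset ?_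
  intro v hv
  exact Set.mem_biUnion (x := v.deg) hv rfl

omit [Finite F] in
open Classical in
/-- Summation over the points of the affine line with values in an extension of degree `n`,
grouped by places. -/
theorem sum_places_eq_sum {E : Type*} [Field E] [Fintype E] [Algebra F E] {R : Type*} [CommRing R]
    (S : Finset (Place F)) (hS : ∀ v : Place F, v.deg ∣ Module.finrank F E → v ∈ S)
    (g : Place F → R) (G : E → R)
    (hg : ∀ (v : Place F) (h : RatFunc.X ∈ v.ring) (σ : v.residueField →ₐ[F] E),
      g v = G (σ (v.coord h))) :
    ∑ v ∈ S with (v.deg ∣ Module.finrank F E ∧ RatFunc.X ∈ v.ring), (v.deg : R) * g v =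
      ∑ x, G x := by
  set T := S.filter (fun v => v.deg ∣ Module.finrank F E ∧ RatFunc.X ∈ v.ring) with hT
  have hTm : ∀ v : T, v.1.deg ∣ Module.finrank F E ∧ RatFunc.X ∈ v.1.ring := fun v =>
    (Finset.mem_filter.mp v.2).2
  have hfd : ∀ v : Place F, FiniteDimensional F v.residueField := fun v => v.finiteDimensional
  have hfin : ∀ v : Place F, Fintype (v.residueField →ₐ[F] E) := fun v => Fintype.ofFinite _
  rw [← Finset.sum_coe_sort T]
  have h1 : ∀ v : T, (v.1.deg : R) * g v.1 =
      ∑ σ : v.1.residueField →ₐ[F] E, G (σ (v.1.coord (hTm v).2)) := by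
    intro v
    rw [Finset.sum_congr rfl fun σ _ => (hg v.1 (hTm v).2 σ).symm, Finset.sum_const,
      Finset.card_univ, ← Nat.card_eq_fintype_card,
      FiniteField.natCard_algHom_of_finrank_dvd (hTm v).1, nsmul_eq_mul]
    rfl
  rw [Finset.sum_congr rfl fun v _ => h1 v]
  refine (Fintype.sum_sigma (fun (x : Σ v : T, (v.1.residueField →ₐ[F] E)) =>
      G (x.2 (x.1.1.coord (hTm x.1).2)))).symm.trans ?_
  -- A point of `E` is the same as a place together with an embedding of its residue field; a place
  -- whose degree divides `[E : F]` has `deg v` such embeddings.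
  refine Function.Bijective.sum_comp (e := fun (x : Σ v : T, (v.1.residueField →ₐ[F] E)) =>
      x.2 (x.1.1.coord (hTm x.1).2)) ⟨?_, ?_⟩ G
  · rintro ⟨⟨v, hv⟩, σ⟩ ⟨⟨w, hw⟩, τ⟩ h
    obtain rfl := Place.eq_of_coord _ _ _ _ h
    congr
    exact Place.algHom_ext _ _ h
  · intro x
    have : Finite E := inferInstance
    have hint : IsIntegral F x := by
      have : Module.Finite F E := Module.Finite.of_finite
      exact Algebra.IsIntegral.isIntegral x
    obtain ⟨v, h, σ, hσ⟩ := exists_place_of_isIntegral hint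
    have hd : v.deg ∣ Module.finrank F E :=
      FiniteField.nonempty_algHom_iff_finrank_dvd.mp ⟨σ⟩
    exact ⟨⟨⟨v, Finset.mem_filter.mpr ⟨hS v hd, hd, h⟩⟩, σ⟩, hσ⟩

end FiniteField

end Places

/-! ### Logarithmic derivatives of power series and infinite products -/

section LogDeriv

open PowerSeries Finset

variable {R : Type*} [CommRing R]

/-- `s` is the logarithmic derivative `X f' / f` of `f`. -/
def IsLogDeriv (f s : PowerSeries R) : Prop := X * derivative R f = f * s

lemma IsLogDeriv.one : IsLogDeriv (1 : PowerSeries R) 0 := by simp [IsLogDeriv]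

lemma IsLogDeriv.mul {f g s t : PowerSeries R} (hf : IsLogDeriv f s) (hg : IsLogDeriv g t) :
    IsLogDeriv (f * g) (s + t) := by
  unfold IsLogDeriv at *
  rw [Derivation.leibniz, smul_eq_mul, smul_eq_mul]
  linear_combination g * hf + f * hg

lemma IsLogDeriv.prod {ι : Type*} (S : Finset ι) {f s : ι → PowerSeries R}
    (h : ∀ i ∈ S, IsLogDeriv (f i) (s i)) : IsLogDeriv (∏ i ∈ S, f i) (∑ i ∈ S, s i) := by
  classical
  induction S using Finset.induction_on with
  | empty => simpa using IsLogDeriv.one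
  | insert a S ha ih =>
    rw [prod_insert ha, sum_insert ha]
    exact (h a (mem_insert_self _ _)).mul (ih fun i hi => h i (mem_insert_of_mem hi))

lemma IsLogDeriv.of_mul_eq_one {f g s : PowerSeries R} (hf : IsLogDeriv f s) (h : f * g = 1) :
    IsLogDeriv g (-s) := by
  unfold IsLogDeriv at *
  have h1 : f * derivative R g + g * derivative R f = 0 := by
    have := Derivation.leibniz (derivative R) f g
    rw [h, Derivation.map_one_eq_zero, smul_eq_mul, smul_eq_mul] at this
    exact this.symm
  linear_combination X * g * h1 - g * g * hf - (X * derivative R g + g * s) * h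

lemma IsLogDeriv.map {S : Type*} [CommRing S] (φ : R →+* S) {f s : PowerSeries R}
    (h : IsLogDeriv f s) : IsLogDeriv (PowerSeries.map φ f) (PowerSeries.map φ s) := by
  unfold IsLogDeriv at *
  rw [← map_mul, ← h, map_mul, map_X]
  congr 1
  ext n
  simp [coeff_derivative]

/-- The relation determines the coefficients recursively: since `s` has no constant term, `n + 1`
times coefficient `n + 1` depends only on earlier ones, and `n + 1` is cancellable in characteristic
zero. -/
lemma IsLogDeriv.unique [IsDomain R] [CharZero R] {f g s : PowerSeries R}
    (hf : IsLogDeriv f s) (hg : IsLogDeriv g s) (hs : constantCoeff s = 0)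
    (h0 : constantCoeff f = constantCoeff g) : f = g := by
  have key : ∀ (f : PowerSeries R), IsLogDeriv f s → ∀ n, ((n + 1 : ℕ) : R) * coeff (n + 1) f =
      ∑ i ∈ range (n + 1), coeff i f * coeff (n + 1 - i) s := by
    intro f hf n
    have h := congrArg (coeff (n + 1)) hf
    rw [coeff_succ_X_mul, coeff_derivative, coeff_mul, Nat.sum_antidiagonal_eq_sum_range_succ
      (fun i j => coeff i f * coeff j s), sum_range_succ, Nat.sub_self, coeff_zero_eq_constantCoeff,
      hs, mul_zero, add_zero] at h
    rw [← h]
    push_cast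
    ring
  ext n
  induction n using Nat.strong_induction_on with
  | _ n ih =>
    cases n with
    | zero => simpa using h0
    | succ n =>
      have hne : ((n + 1 : ℕ) : R) ≠ 0 := Nat.cast_ne_zero.mpr (by omega)
      apply mul_left_cancel₀ hne
      rw [key f hf, key g hg]
      refine sum_congr rfl fun i hi => ?_
      rw [ih i (by simpa using hi)]

/-- The series `∑ k p(n / k) Xⁿ` over the positive multiples `n` of `k`. -/
def dilate (k : ℕ) (p : ℕ → R) : PowerSeries R :=
  mk fun n => if n ≠ 0 ∧ k ∣ n then (k : R) * p (n / k) else 0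

/-- In the variable `Y = X^k`, the recursion says `(1 - aY + cY²) ∑ p(n) Yⁿ = aY - 2cY²`, with the
sum starting at `n = 1`; the `2c` reflects the two eigenvalues. Substituting `Y = X^k` gives the
factor `k` of `dilate`. The case `c = 0` serves the linear factors of `P`. -/
lemma isLogDeriv_quadratic (a c : R) (p : ℕ → R) (h1 : p 1 = a) (h2 : p 2 = a * p 1 - 2 * c)
    (h3 : ∀ n, p (n + 3) = a * p (n + 2) - c * p (n + 1)) {k : ℕ} (hk : k ≠ 0) :
    IsLogDeriv (1 - C a * X ^ k + C c * X ^ (2 * k)) (-dilate k p) := by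
  set S : PowerSeries R := mk fun n => if n = 0 then 0 else p n with hS
  have base : (1 - C a * X + C c * X ^ 2) * S = C a * X - 2 * C c * X ^ 2 := by
    have e : (1 - C a * X + C c * X ^ 2) * S = S - C a * (X * S) + C c * (X * (X * S)) := by ring
    have e2 : C a * X - 2 * C c * X ^ 2 = C a * X - C (2 * c) * (X * (X : PowerSeries R)) := by
      rw [map_mul, map_ofNat]; ring
    rw [e, e2]
    ext n
    match n with
    | 0 => simp [hS]
    | 1 =>
      change coeff (0 + 1) _ = coeff (0 + 1) _
      simp only [map_add, map_sub, coeff_C_mul, coeff_succ_X_mul, hS, coeff_mk, coeff_X]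
      simp [h1]
    | 2 =>
      rw [show (2 : ℕ) = 0 + 1 + 1 from rfl]
      simp only [map_add, map_sub, coeff_C_mul, coeff_succ_X_mul, hS, coeff_mk, coeff_X]
      simp [h2]
    | n + 3 =>
      rw [show n + 3 = n + 1 + 1 + 1 from rfl]
      simp only [map_add, map_sub, coeff_C_mul, coeff_succ_X_mul, hS, coeff_mk, coeff_X]
      simp [h3]
  have hexp := congrArg (expand k hk) base
  simp only [map_mul, map_add, map_sub, map_one, map_pow, expand_X, expand_C, map_ofNat] at hexp
  have hdil : dilate k p = (k : PowerSeries R) * expand k hk S := by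
    ext n
    rw [dilate, coeff_mk, ← map_natCast (C (R := R)), coeff_C_mul, coeff_expand]
    by_cases hkn : k ∣ n
    · obtain ⟨m, rfl⟩ := hkn
      have : k * m / k = m := Nat.mul_div_cancel_left _ (Nat.pos_of_ne_zero hk)
      by_cases hm : m = 0
      · simp [hm, hS]
      · simp [hm, hk, this, hS]
    · simp [hkn]
  have hd : X * derivative R (1 - C a * X ^ k + C c * X ^ (2 * k)) =
      -((k : PowerSeries R) * (C a * X ^ k - 2 * C c * (X ^ k) ^ 2)) := by
    obtain ⟨m, rfl⟩ := Nat.exists_eq_succ_of_ne_zero hk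
    rw [map_add, map_sub, Derivation.map_one_eq_zero, Derivation.leibniz, Derivation.leibniz,
      derivative_C, derivative_C, Derivation.leibniz_pow, Derivation.leibniz_pow, derivative_X]
    simp only [smul_eq_mul, nsmul_eq_mul, Nat.succ_eq_add_one, Nat.add_sub_cancel,
      show 2 * (m + 1) - 1 = 2 * m + 1 by omega]
    push_cast
    ring
  unfold IsLogDeriv
  rw [hd, hdil, ← hexp]
  ring

end LogDeriv

/-! ### Convergence of infinite products in `ℤ⟦X⟧` -/

section InfiniteProduct

open PowerSeries Finset Filter Topology

variable {ι : Type*} (f : ι → PowerSeries ℤ) (deg : ι → ℕ)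

lemma X_pow_dvd_prod_sub_one (S : Finset ι) (n : ℕ)
    (h : ∀ i ∈ S, (X : PowerSeries ℤ) ^ n ∣ f i - 1) : X ^ n ∣ ∏ i ∈ S, f i - 1 := by
  classical
  induction S using Finset.induction_on with
  | empty => simp
  | insert a S ha ih =>
    rw [prod_insert ha, show f a * ∏ i ∈ S, f i - 1 =
      (f a - 1) * ∏ i ∈ S, f i + (∏ i ∈ S, f i - 1) by ring]
    exact dvd_add (Dvd.dvd.mul_right (h a (mem_insert_self _ _)) _)
      (ih fun i hi => h i (mem_insert_of_mem hi))

lemma coeff_prod_eq_of_subset {S T : Finset ι} (hST : S ⊆ T) {n : ℕ}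
    (h : ∀ i ∈ T, i ∉ S → (X : PowerSeries ℤ) ^ (n + 1) ∣ f i - 1) {m : ℕ} (hm : m ≤ n) :
    coeff m (∏ i ∈ T, f i) = coeff m (∏ i ∈ S, f i) := by
  classical
  rw [← sub_eq_zero, ← map_sub, ← prod_sdiff hST,
    show (∏ i ∈ T \ S, f i) * ∏ i ∈ S, f i - ∏ i ∈ S, f i =
      (∏ i ∈ T \ S, f i - 1) * ∏ i ∈ S, f i by ring]
  have h1 := X_pow_dvd_prod_sub_one f (T \ S) (n + 1) (fun i hi => by
    rw [Finset.mem_sdiff] at hi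
    exact h i hi.1 hi.2)
  exact X_pow_dvd_iff.mp (Dvd.dvd.mul_right h1 _) m (by omega)

variable {f deg}

/-- Factors congruent to 1 modulo `X^(n+1)` do not affect coefficient `n`, which is therefore
constant once a finite product contains all indices of degree at most `n`. -/
theorem hasProd_of_finite (hfin : ∀ n, {i | deg i ≤ n}.Finite)
    (hf : ∀ i, (X : PowerSeries ℤ) ^ deg i ∣ f i - 1) :
    HasProd f (mk fun n => coeff n (∏ i ∈ (hfin n).toFinset, f i)) := by
  rw [HasProd, SummationFilter.unconditional_filter, WithPiTopology.tendsto_iff_coeff_tendsto]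
  intro n
  rw [coeff_mk]
  refine tendsto_const_nhds.congr' ?_
  filter_upwards [eventually_ge_atTop (hfin n).toFinset] with T hT
  symm
  refine coeff_prod_eq_of_subset f hT (n := n) ?_ le_rfl
  intro i _ hi
  rw [Set.Finite.mem_toFinset, Set.mem_ofPred_eq, not_le] at hi
  exact (pow_dvd_pow _ hi).trans (hf i)

/-- The logarithmic derivative of an infinite product. -/
theorem isLogDeriv_tprod (hfin : ∀ n, {i | deg i ≤ n}.Finite)
    (hf : ∀ i, (X : PowerSeries ℤ) ^ deg i ∣ f i - 1) (s : ι → PowerSeries ℤ)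
    (hs : ∀ i, IsLogDeriv (f i) (s i)) (t : PowerSeries ℤ)
    (ht : ∀ N n, n ≤ N → ∑ i ∈ (hfin N).toFinset, coeff n (s i) = coeff n t) :
    IsLogDeriv (∏' i, f i) t := by
  have hcoeff : ∀ N n, n ≤ N → coeff n (∏' i, f i) = coeff n (∏ i ∈ (hfin N).toFinset, f i) := by
    intro N n hn
    rw [(hasProd_of_finite hfin hf).tprod_eq, coeff_mk]
    symm
    refine coeff_prod_eq_of_subset f ?_ (n := n) ?_ le_rfl
    · intro i hi
      rw [Set.Finite.mem_toFinset, Set.mem_ofPred_eq] at hi ⊢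
      omega
    · intro i _ hi
      rw [Set.Finite.mem_toFinset, Set.mem_ofPred_eq, not_le] at hi
      exact (pow_dvd_pow _ hi).trans (hf i)
  unfold IsLogDeriv
  ext n
  have h := congrArg (coeff n) (IsLogDeriv.prod (hfin n).toFinset fun i _ => hs i)
  have e1 : coeff n (X * derivative ℤ (∏' i, f i)) =
      coeff n (X * derivative ℤ (∏ i ∈ (hfin n).toFinset, f i)) := by
    cases n with
    | zero => simp
    | succ n =>
      rw [coeff_succ_X_mul, coeff_succ_X_mul, coeff_derivative, coeff_derivative,
        hcoeff (n + 1) (n + 1) le_rfl]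
  rw [e1, h, coeff_mul, coeff_mul]
  refine sum_congr rfl fun x hx => ?_
  rw [HasAntidiagonal.mem_antidiagonal] at hx
  rw [hcoeff n x.1 (by omega), ← ht n x.2 (by omega), map_sum]

end InfiniteProduct

/-! ### The logarithmic derivative of the `L`-function -/

section EulerFactors

open PowerSeries

variable {F : Type*} [Field F] (W : WeierstrassCurve (RatFunc F)) (v : Place F)

open Classical in
/-- The product of the Frobenius eigenvalues at `v`, or `0` at a place of bad reduction. -/
def normAt : ℤ := if (W.minimal v.ring).HasGoodReduction v.ring then (v.card : ℤ) else 0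

lemma coe_eulerPolynomial : (eulerPolynomial W v : PowerSeries ℤ) =
    1 - C (traceAt W v) * X ^ v.deg + C (normAt W v) * X ^ (2 * v.deg) := by
  unfold eulerPolynomial normAt
  split_ifs <;> simp [-eq_intCast, -map_natCast, -map_intCast]

lemma eulerPolynomial_mul_eulerFactor :
    (eulerPolynomial W v : PowerSeries ℤ) * eulerFactor W v = 1 := by
  apply PowerSeries.mul_invOfUnit
  rw [coe_eulerPolynomial]
  simp [v.deg_pos.ne']

lemma X_pow_deg_dvd_eulerFactor_sub_one : X ^ v.deg ∣ eulerFactor W v - 1 := by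
  have h : eulerFactor W v - 1 = X ^ v.deg *
      (eulerFactor W v * (C (traceAt W v) - C (normAt W v) * X ^ v.deg)) := by
    have := eulerPolynomial_mul_eulerFactor W v
    rw [coe_eulerPolynomial] at this
    linear_combination this
  exact ⟨_, h⟩

lemma isLogDeriv_eulerFactor : IsLogDeriv (eulerFactor W v)
    (dilate v.deg (powerSum (traceAt W v) (normAt W v))) := by
  have h := (isLogDeriv_quadratic (traceAt W v) (normAt W v)
    (powerSum (traceAt W v) (normAt W v)) ?_ ?_ (fun n => ?_) v.deg_pos.ne').of_mul_eq_one
    (by rw [← coe_eulerPolynomial]; exact eulerPolynomial_mul_eulerFactor W v)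
  · rwa [neg_neg] at h
  · rfl
  · simp only [powerSum]; ring
  · rfl

theorem multipliable_eulerFactor [Finite F] : Multipliable (eulerFactor W) :=
  (hasProd_of_finite finite_places_deg_le (X_pow_deg_dvd_eulerFactor_sub_one W)).multipliable

/-- A place of degree larger than `n` has degree not dividing a positive `n`, so the sum for
coefficient `n` may be cut off at degree `n`. -/
theorem isLogDeriv_LFunction [Finite F] : IsLogDeriv (LFunction W)
    (mk fun n => ∑ v ∈ (finite_places_deg_le (F := F) n).toFinset,
      coeff n (dilate v.deg (powerSum (traceAt W v) (normAt W v)))) := by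
  refine isLogDeriv_tprod finite_places_deg_le (X_pow_deg_dvd_eulerFactor_sub_one W) _
    (isLogDeriv_eulerFactor W) _ fun N n hn => ?_
  rw [coeff_mk]
  symm
  refine Finset.sum_subset (fun v hv => ?_) (fun v _ hv => ?_)
  · rw [Set.Finite.mem_toFinset, Set.mem_ofPred_eq] at hv ⊢
    omega
  · rw [Set.Finite.mem_toFinset, Set.mem_ofPred_eq] at hv
    rw [dilate, coeff_mk, if_neg]
    rintro ⟨h0, h1⟩
    exact hv (Nat.le_of_dvd (Nat.pos_of_ne_zero h0) h1)

end EulerFactors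

/-! ### Local Euler data seen from an extension of the constants -/

section LocalData

variable {F : Type*} [Field F] [Finite F] (W : WeierstrassCurve (RatFunc F)) (v : Place F)
variable {E : Type*} [Field E] [Fintype E] [DecidableEq E] [Algebra F E]

/-- Good and bad places are treated together: `traceAt` is minus the character sum of the reduction,
and `normAt` vanishes exactly when the reduced discriminant does. `powerSum_frobSum` then passes
from the residue field to `E` along `σ`. -/
lemma powerSum_local (h2 : (2 : F) ≠ 0) (h3 : (3 : F) ≠ 0) (σ : v.residueField →ₐ[F] E) :
    powerSum (traceAt W v) (normAt W v) (Module.finrank F E / v.deg) =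
      -frobSum E (σ ((W.minimal v.ring).reduction v.ring).c₄)
        (σ ((W.minimal v.ring).reduction v.ring).c₆) := by
  classical
  have := v.finite_residueField
  let _ : Fintype v.residueField := Fintype.ofFinite _
  let _ : Algebra v.residueField E := σ.toRingHom.toAlgebra
  have : IsScalarTower F v.residueField E := IsScalarTower.of_algebraMap_eq fun x =>
    (σ.commutes x).symm
  have h2' : ringChar v.residueField ≠ 2 := by
    intro h
    have h0 : (2 : v.residueField) = 0 := by
      have := ringChar.Nat.cast_ringChar (R := v.residueField)
      rw [h] at this
      exact_mod_cast this
    rw [← map_ofNat (algebraMap F v.residueField), map_eq_zero] at h0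
    exact h2 h0
  have h3' : (3 : v.residueField) ≠ 0 := by
    rw [← map_ofNat (algebraMap F v.residueField), map_ne_zero]
    exact h3
  set M := (W.minimal v.ring).reduction v.ring with hM
  have hdiv : Module.finrank F E / v.deg = Module.finrank v.residueField E := by
    rw [← Module.finrank_mul_finrank F v.residueField E, v.deg_eq_finrank]
    exact Nat.mul_div_cancel_left _ v.deg_pos
  have htr : traceAt W v = -frobSum v.residueField M.c₄ M.c₆ := by
    have := card_equation h2' h3' M
    unfold traceAt cubicPointCount
    rw [← hM, Nat.cast_add, this, Place.card, Nat.card_eq_fintype_card]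
    push_cast
    ring
  have hn : normAt W v = if M.Δ = 0 then 0 else (Fintype.card v.residueField : ℤ) := by
    unfold normAt
    rw [WeierstrassCurve.hasGoodReduction_iff_isElliptic_reduction, ← hM,
      WeierstrassCurve.isElliptic_iff, isUnit_iff_ne_zero, Place.card, Nat.card_eq_fintype_card]
    split_ifs <;> first | rfl | contradiction
  rw [hdiv, htr, hn, powerSum_frobSum h2' h3' M]
  rfl

/-- Replaces the unspecified minimal model by an explicit integral one; the unit from
`exists_unit_of_isMinimal` is absorbed by `frobSum_scale`. -/
lemma powerSum_local_of_isUnit (h2 : (2 : F) ≠ 0) (h3 : (3 : F) ≠ 0)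
    (σ : v.residueField →ₐ[F] E) (C : WeierstrassCurve.VariableChange (RatFunc F))
    (W₀ : WeierstrassCurve v.ring) (hW : C • W = W₀.map (algebraMap v.ring (RatFunc F)))
    (h : IsUnit W₀.Δ ∨ IsUnit W₀.c₄) (hΔ : W₀.Δ ≠ 0) :
    powerSum (traceAt W v) (normAt W v) (Module.finrank F E / v.deg) =
      -frobSum E (σ (IsLocalRing.residue v.ring W₀.c₄)) (σ (IsLocalRing.residue v.ring W₀.c₆)) := by
  obtain ⟨C', hC'⟩ : ∃ C', W.minimal v.ring = C' • W := ⟨_, rfl⟩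
  obtain ⟨r, hr, h4, h6⟩ := exists_unit_of_isMinimal (R := v.ring) (W.minimal v.ring) (C • W)
    (C' * C⁻¹) (by rw [hC', mul_smul, inv_smul_smul]) W₀ hW hΔ h
  rw [powerSum_local W v h2 h3 σ, WeierstrassCurve.reduction, WeierstrassCurve.map_c₄,
    WeierstrassCurve.map_c₆, h4, h6, map_mul, map_mul, map_mul, map_mul, map_pow, map_pow,
    map_pow, map_pow, frobSum_scale]
  rw [map_ne_zero, IsLocalRing.residue_ne_zero_iff_isUnit]
  exact hr

end LocalData

/-! ### Fibres of `y² + xy - tᵈy = x³` over the projective line -/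

section Hessian

open RatFunc

/-- The curve `y² + x y - a y = x³`. -/
def hessianCurve {R : Type*} [CommRing R] (a : R) : WeierstrassCurve R := ⟨1, 0, -a, 0, 0⟩

section Invariants

variable {R : Type*} [CommRing R] (a : R)

lemma hessianCurve_c₄ : (hessianCurve a).c₄ = 1 + 24 * a := by
  simp [hessianCurve, WeierstrassCurve.c₄, WeierstrassCurve.b₂, WeierstrassCurve.b₄]

lemma hessianCurve_Δ : (hessianCurve a).Δ = -(a ^ 3 * (1 + 27 * a)) := by
  simp only [hessianCurve, WeierstrassCurve.Δ, WeierstrassCurve.b₂, WeierstrassCurve.b₄,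
    WeierstrassCurve.b₆, WeierstrassCurve.b₈]
  ring

lemma map_hessianCurve {S : Type*} [CommRing S] (f : R →+* S) :
    (hessianCurve a).map f = hessianCurve (f a) := by
  simp [hessianCurve, WeierstrassCurve.map]

end Invariants

variable {F : Type*} [Field F] [Finite F]
variable {E : Type*} [Field E] [Fintype E] [DecidableEq E] [Algebra F E]

omit [Finite F] in
lemma hessian_eq (d : ℕ) : hessian F d = hessianCurve (X ^ d : RatFunc F) := rfl

omit [Finite F] in
lemma one_add_mul_X_pow_ne_zero (c : ℕ) (hc : (c : F) ≠ 0) {d : ℕ} (hd : d ≠ 0) :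
    (1 + (c : RatFunc F) * X ^ d) ≠ 0 ∧ (1 + (c : RatFunc F) * X ^ d).intDegree = (d : ℤ) := by
  have e : (1 + (c : RatFunc F) * X ^ d) =
      algebraMap F[X] (RatFunc F) (1 + Polynomial.C (c : F) * Polynomial.X ^ d) := by
    simp
  have hdeg : (1 + Polynomial.C (c : F) * Polynomial.X ^ d).natDegree = d := by
    rw [add_comm, Polynomial.natDegree_add_eq_left_of_natDegree_lt,
      Polynomial.natDegree_C_mul_X_pow _ _ hc]
    rw [Polynomial.natDegree_C_mul_X_pow _ _ hc, Polynomial.natDegree_one]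
    omega
  rw [e, RatFunc.intDegree_polynomial, hdeg]
  refine ⟨RatFunc.algebraMap_ne_zero fun h => hd ?_, rfl⟩
  rw [← hdeg, h, Polynomial.natDegree_zero]

/-- The given equation is minimal at every finite place: with `a = tᵈ`, the invariants `Δ = -a³(1 +
27a)` and `c₄ = 1 + 24a` have no common zero outside characteristic 3, since `a = 0` gives `c₄ = 1`,
and otherwise subtracting gives `3a = 0`. -/
lemma powerSum_hessian_finite (h2 : (2 : F) ≠ 0) (h3 : (3 : F) ≠ 0) {d : ℕ} (hd : d ≠ 0)
    (v : Place F) (h : X ∈ v.ring) (σ : v.residueField →ₐ[F] E) :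
    powerSum (traceAt (hessian F d) v) (normAt (hessian F d) v) (Module.finrank F E / v.deg) =
      -frobSum E (hessianCurve (σ (v.coord h) ^ d)).c₄ (hessianCurve (σ (v.coord h) ^ d)).c₆ := by
  set x : v.ring := ⟨X, h⟩ with hx
  have hmap : hessian F d = (hessianCurve (x ^ d)).map (algebraMap v.ring (RatFunc F)) := by
    rw [map_hessianCurve, map_pow, hessian_eq]
    rfl
  have hσ : hessianCurve (σ (v.coord h) ^ d) =
      (((hessianCurve (x ^ d)).map (IsLocalRing.residue v.ring)).map (σ : v.residueField →+* E)) := by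
    rw [map_hessianCurve, map_hessianCurve, map_pow, map_pow]
    rfl
  rw [powerSum_local_of_isUnit (hessian F d) v h2 h3 σ 1 (hessianCurve (x ^ d))
    (by rw [one_smul, hmap]), hσ, WeierstrassCurve.map_c₄, WeierstrassCurve.map_c₆,
    WeierstrassCurve.map_c₄, WeierstrassCurve.map_c₆]
  · rfl
  · have h3' : (3 : v.residueField) ≠ 0 := by
      rw [← map_ofNat (algebraMap F v.residueField), map_ne_zero]
      exact h3
    rw [← IsLocalRing.residue_ne_zero_iff_isUnit, ← IsLocalRing.residue_ne_zero_iff_isUnit]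
    by_contra! hc
    rw [hessianCurve_c₄, hessianCurve_Δ] at hc
    simp only [map_neg, map_mul, map_add, map_one, map_pow, map_ofNat] at hc
    set y := IsLocalRing.residue v.ring x ^ d
    have hy : y ≠ 0 := by
      intro h0
      rw [h0] at hc
      simp at hc
    have h1 : 1 + 27 * y = 0 := by
      have := hc.1
      rw [neg_eq_zero, mul_eq_zero] at this
      exact this.resolve_left (pow_ne_zero 3 hy)
    have h4 : 3 * y = 0 := by linear_combination h1 - hc.2
    exact (mul_ne_zero h3' hy) h4
  · intro h0
    have h1 : (hessian F d).Δ = 0 := by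
      rw [hmap, WeierstrassCurve.map_Δ, h0, map_zero]
    rw [hessian_eq, hessianCurve_Δ, neg_eq_zero, mul_eq_zero] at h1
    rcases h1 with h1 | h1
    · exact pow_ne_zero 3 (pow_ne_zero d RatFunc.X_ne_zero) h1
    · have h27 : ((27 : ℕ) : F) ≠ 0 := by
        rw [show ((27 : ℕ) : F) = 3 ^ 3 by norm_num]
        exact pow_ne_zero 3 h3
      have := (one_add_mul_X_pow_ne_zero 27 h27 hd).1
      exact this (by exact_mod_cast h1)

/-- For `d = 3e`, scaling by `u = tᵉ` gives `y² + t⁻ᵉxy - y = x³`, which reduces to `y² - y = x³` of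
discriminant `-27`. -/
lemma powerSum_hessian_infty_of_dvd (h2 : (2 : F) ≠ 0) (h3 : (3 : F) ≠ 0) {d : ℕ} (hd : d ≠ 0)
    (h : 3 ∣ d) (σ : (inftyPlace F).residueField →ₐ[F] E) :
    powerSum (traceAt (hessian F d) (inftyPlace F)) (normAt (hessian F d) (inftyPlace F))
      (Module.finrank F E) =
      -frobSum E (⟨0, 0, -1, 0, 0⟩ : WeierstrassCurve E).c₄
        (⟨0, 0, -1, 0, 0⟩ : WeierstrassCurve E).c₆ := by
  obtain ⟨e, rfl⟩ := h
  have he : e ≠ 0 := by omega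
  have hXe : (X : RatFunc F) ^ e ≠ 0 := pow_ne_zero e RatFunc.X_ne_zero
  set v := inftyPlace F with hv
  have hdeg : ((X : RatFunc F) ^ e)⁻¹.intDegree < 0 := by
    rw [RatFunc.intDegree_inv, ← RatFunc.algebraMap_X, ← map_pow, RatFunc.intDegree_polynomial,
      Polynomial.natDegree_X_pow]
    omega
  have hmem : ((X : RatFunc F) ^ e)⁻¹ ∈ v.ring :=
    (mem_inftyPlace_iff (inv_ne_zero hXe)).mpr hdeg.le
  set y : v.ring := ⟨_, hmem⟩ with hy
  have hy0 : IsLocalRing.residue v.ring y = 0 :=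
    residue_inftyPlace_eq_zero (inv_ne_zero hXe) hdeg
  set W₀ : WeierstrassCurve v.ring := ⟨y, 0, -1, 0, 0⟩ with hW₀
  have hred : (W₀.map (IsLocalRing.residue v.ring)).map (σ : v.residueField →+* E) =
      ⟨0, 0, -1, 0, 0⟩ := by
    simp [WeierstrassCurve.map, hW₀, hy0]
  have hC : (⟨Units.mk0 _ hXe, 0, 0, 0⟩ : WeierstrassCurve.VariableChange (RatFunc F)) •
      hessian F (3 * e) = W₀.map (algebraMap v.ring (RatFunc F)) := by
    rw [WeierstrassCurve.variableChange_def]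
    ext
    · simp [WeierstrassCurve.map, hW₀, hessian]
      rfl
    · simp [WeierstrassCurve.map, hW₀, hessian]
    · simp [WeierstrassCurve.map, hW₀, hessian]
      rw [mul_comm 3 e, pow_mul, inv_mul_cancel₀ (pow_ne_zero 3 hXe)]
    · simp [WeierstrassCurve.map, hW₀, hessian]
    · simp [WeierstrassCurve.map, hW₀, hessian]
  have hΔ : IsUnit W₀.Δ := by
    have h27 : (27 : v.residueField) ≠ 0 := by
      rw [← map_ofNat (algebraMap F v.residueField), map_ne_zero,
        show (27 : F) = 3 ^ 3 by norm_num]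
      exact pow_ne_zero 3 h3
    rw [← IsLocalRing.residue_ne_zero_iff_isUnit, ← WeierstrassCurve.map_Δ]
    simp only [WeierstrassCurve.map, hW₀, hy0, WeierstrassCurve.Δ, WeierstrassCurve.b₂,
      WeierstrassCurve.b₄, WeierstrassCurve.b₆, WeierstrassCurve.b₈]
    simpa using h27
  have hmain := powerSum_local_of_isUnit (hessian F (3 * e)) v h2 h3 σ _ W₀ hC (Or.inl hΔ) hΔ.ne_zero
  have hdeg1 : v.deg = 1 := deg_inftyPlace
  rw [hdeg1, Nat.div_one] at hmain
  rw [hmain, ← hred, WeierstrassCurve.map_c₄, WeierstrassCurve.map_c₆,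
    WeierstrassCurve.map_c₄, WeierstrassCurve.map_c₆]
  rfl

/-- No explicit minimal model is needed. After any scaling the degrees of `Δ` and `c₄` are `12w +
4d` and `4w + d`. Integrality makes the first nonpositive and `3 ∤ d` makes it nonzero; then `3w + d
< 0`, hence `4w + d < 0` too. So `c₄` and `c₆` reduce to 0, and the cusp has character sum 0. -/
lemma powerSum_hessian_infty_of_not_dvd (h2 : (2 : F) ≠ 0) (h3 : (3 : F) ≠ 0) {d : ℕ}
    (h : ¬ 3 ∣ d) (σ : (inftyPlace F).residueField →ₐ[F] E) :
    powerSum (traceAt (hessian F d) (inftyPlace F)) (normAt (hessian F d) (inftyPlace F))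
      (Module.finrank F E) = 0 := by
  have hd : d ≠ 0 := by rintro rfl; exact h (dvd_zero 3)
  have hmain := powerSum_local (hessian F d) (inftyPlace F) h2 h3 σ
  rw [deg_inftyPlace, Nat.div_one] at hmain
  set v := inftyPlace F with hv
  obtain ⟨C, hC⟩ : ∃ C, (hessian F d).minimal v.ring = C • hessian F d := ⟨_, rfl⟩
  set M := (hessian F d).minimal v.ring with hM
  set w : RatFunc F := ((C.u⁻¹ : (RatFunc F)ˣ) : RatFunc F) with hw
  have hw0 : w ≠ 0 := Units.ne_zero _
  have h27 := one_add_mul_X_pow_ne_zero 27 (F := F) (by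
    rw [show ((27 : ℕ) : F) = 3 ^ 3 by norm_num]; exact pow_ne_zero 3 h3) hd
  have h24 := one_add_mul_X_pow_ne_zero 24 (F := F) (by
    rw [show ((24 : ℕ) : F) = 2 ^ 3 * 3 by norm_num]
    exact mul_ne_zero (pow_ne_zero 3 h2) h3) hd
  have hXd : (X : RatFunc F) ^ d ≠ 0 := pow_ne_zero d RatFunc.X_ne_zero
  have hpow : ∀ n : ℕ, ∀ x : RatFunc F, x ≠ 0 → (x ^ n).intDegree = n * x.intDegree := by
    intro n x hx
    induction n with
    | zero => simp
    | succ n ih =>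
      rw [pow_succ, RatFunc.intDegree_mul (pow_ne_zero n hx) hx, ih]
      push_cast
      ring
  have hΔ : (M.Δ ≠ 0) ∧ M.Δ.intDegree = 12 * w.intDegree + 4 * d := by
    have e : M.Δ = -(w ^ 12 * ((X ^ d) ^ 3 * (1 + ((27 : ℕ) : RatFunc F) * X ^ d))) := by
      rw [hC, WeierstrassCurve.variableChange_Δ, ← hw, hessian_eq, hessianCurve_Δ]
      push_cast
      ring
    have h1 := mul_ne_zero (pow_ne_zero 3 hXd) h27.1
    rw [e]
    refine ⟨neg_ne_zero.mpr (mul_ne_zero (pow_ne_zero 12 hw0) h1), ?_⟩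
    rw [RatFunc.intDegree_neg, RatFunc.intDegree_mul (pow_ne_zero 12 hw0) h1,
      RatFunc.intDegree_mul (pow_ne_zero 3 hXd) h27.1, h27.2, hpow _ _ hw0, hpow _ _ hXd,
      hpow _ _ RatFunc.X_ne_zero, RatFunc.intDegree_X]
    push_cast
    ring
  have hc₄ : (M.c₄ ≠ 0) ∧ M.c₄.intDegree = 4 * w.intDegree + d := by
    have e : M.c₄ = w ^ 4 * (1 + ((24 : ℕ) : RatFunc F) * X ^ d) := by
      rw [hC, WeierstrassCurve.variableChange_c₄, ← hw, hessian_eq, hessianCurve_c₄]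
      push_cast
      rfl
    rw [e]
    refine ⟨mul_ne_zero (pow_ne_zero 4 hw0) h24.1, ?_⟩
    rw [RatFunc.intDegree_mul (pow_ne_zero 4 hw0) h24.1, h24.2, hpow _ _ hw0]
    push_cast
    ring
  have eΔ : ((M.integralModel v.ring).Δ : RatFunc F) = M.Δ :=
    WeierstrassCurve.integralModel_Δ_eq v.ring M
  have ec₄ : ((M.integralModel v.ring).c₄ : RatFunc F) = M.c₄ :=
    WeierstrassCurve.integralModel_c₄_eq v.ring M
  have hneg : M.Δ.intDegree < 0 := by
    have h1 : M.Δ ∈ v.ring := by rw [← eΔ]; exact Subtype.prop _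
    have h1 := (mem_inftyPlace_iff hΔ.1).mp h1
    omega
  have rΔ : (M.reduction v.ring).Δ = 0 := by
    rw [WeierstrassCurve.reduction, WeierstrassCurve.map_Δ]
    exact residue_inftyPlace_eq_zero (by rw [eΔ]; exact hΔ.1) (by rw [eΔ]; exact hneg)
  have rc₄ : (M.reduction v.ring).c₄ = 0 := by
    rw [WeierstrassCurve.reduction, WeierstrassCurve.map_c₄]
    exact residue_inftyPlace_eq_zero (by rw [ec₄]; exact hc₄.1) (by rw [ec₄]; omega)
  have rc₆ : (M.reduction v.ring).c₆ = 0 := by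
    have := (M.reduction v.ring).c_relation
    rw [rΔ, rc₄] at this
    simpa using this.symm
  rw [hmain, rc₄, rc₆, map_zero, frobSum_zero, neg_zero]
  intro h
  have h0 : (2 : E) = 0 := by
    have := ringChar.Nat.cast_ringChar (R := E)
    rw [h] at this
    exact_mod_cast this
  rw [← map_ofNat (algebraMap F E), map_eq_zero] at h0
  exact h2 h0

open Classical in
/-- The trace of Frobenius over an extension `E` of the field of constants, as a sum over the
projective line. -/
theorem coeff_logDeriv_LFunction_hessian (h2 : (2 : F) ≠ 0) (h3 : (3 : F) ≠ 0) {d : ℕ}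
    (hd : d ≠ 0) :
    ∑ v ∈ (finite_places_deg_le (F := F) (Module.finrank F E)).toFinset,
      PowerSeries.coeff (Module.finrank F E) (dilate v.deg (powerSum (traceAt (hessian F d) v)
        (normAt (hessian F d) v))) =
    -(∑ x : E, frobSum E (hessianCurve (x ^ d)).c₄ (hessianCurve (x ^ d)).c₆ +
      if 3 ∣ d then frobSum E (⟨0, 0, -1, 0, 0⟩ : WeierstrassCurve E).c₄
        (⟨0, 0, -1, 0, 0⟩ : WeierstrassCurve E).c₆ else 0) := by
  set n := Module.finrank F E with hn
  have hn0 : n ≠ 0 := by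
    have : Module.Finite F E := Module.Finite.of_finite
    exact Module.finrank_pos.ne'
  set S := (finite_places_deg_le (F := F) n).toFinset with hS
  have hSm : ∀ v : Place F, v.deg ∣ n → v ∈ S := fun v hv => by
    rw [Set.Finite.mem_toFinset]
    exact Nat.le_of_dvd (Nat.pos_of_ne_zero hn0) hv
  set g : Place F → ℤ := fun v => powerSum (traceAt (hessian F d) v) (normAt (hessian F d) v)
    (n / v.deg) with hg
  have hinf : inftyPlace F ∈ S := hSm _ (by rw [deg_inftyPlace]; exact one_dvd n)
  obtain ⟨σ⟩ : Nonempty ((inftyPlace F).residueField →ₐ[F] E) := by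
    have := (inftyPlace F).finiteDimensional
    refine FiniteField.nonempty_algHom_of_finrank_dvd ?_
    rw [← Place.deg_eq_finrank, deg_inftyPlace]
    exact one_dvd _
  have h1 : ∀ v ∈ S, PowerSeries.coeff n (dilate v.deg (powerSum (traceAt (hessian F d) v)
        (normAt (hessian F d) v))) =
      (if v.deg ∣ n ∧ X ∈ v.ring then (v.deg : ℤ) * g v else 0) +
        if v = inftyPlace F then g v else 0 := by
    intro v _
    rw [dilate, PowerSeries.coeff_mk]
    by_cases hX : X ∈ v.ring
    · have : v ≠ inftyPlace F := by rintro rfl; exact X_notMem_inftyPlace hX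
      simp [hX, this, hn0, hg]
    · obtain rfl := eq_inftyPlace hX
      simp [X_notMem_inftyPlace, deg_inftyPlace, hn0, hg]
  rw [Finset.sum_congr rfl h1, Finset.sum_add_distrib, ← Finset.sum_filter,
    sum_places_eq_sum S hSm g (fun x => -frobSum E (hessianCurve (x ^ d)).c₄
      (hessianCurve (x ^ d)).c₆)
      (fun v h σ => powerSum_hessian_finite h2 h3 hd v h σ), Finset.sum_ite_eq' S, if_pos hinf,
    Finset.sum_neg_distrib, neg_add]
  congr 1
  simp only [hg, deg_inftyPlace, Nat.div_one]
  split_ifs with h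
  · exact powerSum_hessian_infty_of_dvd h2 h3 hd h σ
  · rw [powerSum_hessian_infty_of_not_dvd h2 h3 h σ, neg_zero]

end Hessian

/-! ### Power residue characters of finite fields -/

section Characters

open Finset

variable {k Q : Type*} [Field k] [Fintype k] [Field Q]

lemma sum_eq_zero_of_map_ne_one (χ : k →* Q) {c : k} (hc : c ≠ 0) (h : χ c ≠ 1) :
    ∑ x, χ x = 0 := by
  have h1 := Equiv.sum_comp (Equiv.mulLeft₀ c hc) χ
  simp only [Equiv.mulLeft₀_apply, map_mul, ← mul_sum] at h1
  have h2 : (χ c - 1) * ∑ x, χ x = 0 := by rw [sub_mul, h1, one_mul, sub_self]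
  exact (mul_eq_zero.mp h2).resolve_left (sub_ne_zero.mpr h)

variable {Ω : Type*} [Field Ω] (T : Ω →*₀ Q) (k) [Algebra k Ω] {d : ℕ} [NeZero d]

/-- The character `x ↦ T(x) ^ ((#k - 1) m / d)` of `k`. -/
def powChar (m : ZMod d) : k →* Q :=
  (powMonoidHom ((Fintype.card k - 1) * m.val / d)).comp
    ((T : Ω →* Q).comp (algebraMap k Ω : k →* Ω))

omit [NeZero d] in
lemma powChar_apply (m : ZMod d) (x : k) :
    powChar k T m x = T (algebraMap k Ω x) ^ ((Fintype.card k - 1) * m.val / d) := rfl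

variable {k T}

lemma dvd_card_sub_one_mul {m : ZMod d} (hm : (Fintype.card k : ZMod d) * m = m) :
    d ∣ (Fintype.card k - 1) * m.val := by
  rw [← ZMod.natCast_eq_zero_iff, Nat.cast_mul, Nat.cast_sub Fintype.card_pos, ZMod.natCast_val,
    ZMod.cast_id', id_eq, Nat.cast_one, sub_mul, hm, one_mul, sub_self]

omit [NeZero d] in
lemma powChar_zero : powChar k T (0 : ZMod d) = 1 := by
  ext x
  simp [powChar_apply]

omit [NeZero d] in
lemma powChar_zero_apply (x : k) : powChar k T (0 : ZMod d) x = 1 := by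
  rw [powChar_zero, MonoidHom.one_apply]

lemma exponent_pos {m : ZMod d} (hm : (Fintype.card k : ZMod d) * m = m) (h0 : m ≠ 0) :
    0 < (Fintype.card k - 1) * m.val / d := by
  have h1 : 1 < Fintype.card k := Fintype.one_lt_card
  refine Nat.div_pos (Nat.le_of_dvd ?_ (dvd_card_sub_one_mul hm)) (NeZero.pos d)
  exact Nat.mul_pos (by omega) (Nat.pos_of_ne_zero ((ZMod.val_ne_zero m).mpr h0))

lemma powChar_apply_zero {m : ZMod d} (hm : (Fintype.card k : ZMod d) * m = m) (h0 : m ≠ 0) :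
    powChar k T m 0 = 0 := by
  rw [powChar_apply, map_zero, map_zero, zero_pow (exponent_pos hm h0).ne']

lemma map_pow_card_sub_one {x : k} (hx : x ≠ 0) :
    T (algebraMap k Ω x) ^ (Fintype.card k - 1) = 1 := by
  rw [← map_pow, ← map_pow, FiniteField.pow_card_sub_one_eq_one x hx, map_one, map_one]

/-- The representative of `m + m'` differs from the sum of representatives by a multiple of `d`,
which changes the exponent by a multiple of `#k - 1`. -/
lemma powChar_add {m m' : ZMod d} (hm : (Fintype.card k : ZMod d) * m = m)
    (hm' : (Fintype.card k : ZMod d) * m' = m') {x : k} (hx : x ≠ 0) :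
    powChar k T (m + m') x = powChar k T m x * powChar k T m' x := by
  have hs : (Fintype.card k : ZMod d) * (m + m') = m + m' := by rw [mul_add, hm, hm']
  have hd : 0 < d := NeZero.pos d
  simp only [powChar_apply]
  obtain ⟨a, ha⟩ := dvd_card_sub_one_mul hm
  obtain ⟨b, hb⟩ := dvd_card_sub_one_mul hm'
  obtain ⟨c, hc⟩ := dvd_card_sub_one_mul hs
  rw [ha, hb, hc, Nat.mul_div_cancel_left _ hd, Nat.mul_div_cancel_left _ hd,
    Nat.mul_div_cancel_left _ hd, ← pow_add]
  have hv := Nat.mod_add_div (m.val + m'.val) d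
  rw [← ZMod.val_add] at hv
  have : a + b = c + (Fintype.card k - 1) * ((m.val + m'.val) / d) := by
    generalize (m.val + m'.val) / d = t at hv
    apply Nat.eq_of_mul_eq_mul_left hd
    rw [mul_add, mul_add, ← ha, ← hb, ← hc, ← mul_add, ← hv]
    ring
  rw [this, pow_add, pow_mul, map_pow_card_sub_one hx, one_pow, mul_one]

lemma powChar_natCast_mul {m : ZMod d} (hm : (Fintype.card k : ZMod d) * m = m) (j : ℕ) {x : k}
    (hx : x ≠ 0) : powChar k T ((j : ZMod d) * m) x = powChar k T m x ^ j := by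
  have hj : ∀ j : ℕ, (Fintype.card k : ZMod d) * (j * m) = j * m := fun j => by
    rw [mul_left_comm, hm]
  induction j with
  | zero => rw [Nat.cast_zero, zero_mul, powChar_zero_apply, pow_zero]
  | succ j ih =>
    rw [Nat.cast_succ, add_mul, one_mul, powChar_add (hj j) hm hx, ih, pow_succ]

/-- The exponent lies strictly between 0 and `#k - 1`, so it cannot annihilate the cyclic group of
units. -/
lemma exists_powChar_ne_one (hT : Function.Injective T) {m : ZMod d}
    (hm : (Fintype.card k : ZMod d) * m = m) (h0 : m ≠ 0) :
    ∃ x : k, x ≠ 0 ∧ powChar k T m x ≠ 1 := by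
  by_contra! h
  have h1 : Fintype.card k - 1 ∣ (Fintype.card k - 1) * m.val / d := by
    rw [← FiniteField.forall_pow_eq_one_iff]
    intro x
    have h2 := h x x.ne_zero
    rw [powChar_apply, ← map_pow, ← map_pow, ← map_one T] at h2
    have h3 := (algebraMap k Ω).injective ((hT h2).trans (map_one _).symm)
    exact Units.ext (by simpa using h3)
  have h4 := Nat.le_of_dvd (exponent_pos hm h0) h1
  have h5 : (Fintype.card k - 1) * m.val / d < Fintype.card k - 1 := by
    rw [Nat.div_lt_iff_lt_mul (NeZero.pos d)]
    have h1 : 1 < Fintype.card k := Fintype.one_lt_card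
    exact Nat.mul_lt_mul_of_pos_left (ZMod.val_lt m) (by omega)
  omega

lemma sum_powChar (hT : Function.Injective T) {m : ZMod d}
    (hm : (Fintype.card k : ZMod d) * m = m) (h0 : m ≠ 0) : ∑ x, powChar k T m x = 0 := by
  obtain ⟨x, hx, h⟩ := exists_powChar_ne_one hT hm h0
  exact sum_eq_zero_of_map_ne_one _ hx h

/-- The norm is the power `(#L - 1)/(#k - 1)`, which is exactly the ratio of the two exponents. -/
lemma powChar_norm {L : Type*} [Field L] [Fintype L] [Algebra k L] [Algebra L Ω]
    [IsScalarTower k L Ω] {m : ZMod d} (hm : (Fintype.card k : ZMod d) * m = m) (x : L) :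
    powChar k T m (Algebra.norm k x) = powChar L T m x := by
  rw [powChar_apply, powChar_apply, IsScalarTower.algebraMap_apply k L Ω,
    FiniteField.algebraMap_norm_eq_pow, map_pow, map_pow, ← pow_mul]
  congr 1
  have h1 : Nat.card k - 1 ∣ Nat.card L - 1 := by
    rw [Module.natCard_eq_pow_finrank (K := k) (V := L)]
    simpa using Nat.sub_dvd_pow_sub_pow (Nat.card k) 1 (Module.finrank k L)
  rw [Nat.card_eq_fintype_card, Nat.card_eq_fintype_card] at h1 ⊢
  obtain ⟨t, ht⟩ := h1
  have h2 : 0 < Fintype.card k - 1 := by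
    have : 1 < Fintype.card k := Fintype.one_lt_card
    omega
  obtain ⟨a, ha⟩ := dvd_card_sub_one_mul hm
  rw [ha, ht, Nat.mul_div_cancel_left _ h2, Nat.mul_div_cancel_left _ (NeZero.pos d),
    mul_right_comm, ha, mul_assoc, Nat.mul_div_cancel_left _ (NeZero.pos d), mul_comm]

/-- In a cyclic group of order `n`, the `e`-th powers lie in the kernel of the power `n / gcd(n,
e)`, and the two subgroups have the same order. -/
lemma exists_pow_eq_of_pow_eq_one (e : ℕ) {c : kˣ}
    (h : c ^ (Nat.card kˣ / (Nat.card kˣ).gcd e) = 1) : ∃ t : kˣ, t ^ e = c := by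
  set n := Nat.card kˣ
  set N := n / n.gcd e
  have hn : 0 < n := Nat.card_pos
  have hle : (powMonoidHom e : kˣ →* kˣ).range ≤ (powMonoidHom N : kˣ →* kˣ).ker := by
    rintro _ ⟨t, rfl⟩
    rw [MonoidHom.mem_ker, powMonoidHom_apply, powMonoidHom_apply, ← pow_mul]
    obtain ⟨s, hs⟩ := Nat.gcd_dvd_right n e
    have : e * N = n * s := by
      have h2 : n.gcd e * N = n := Nat.mul_div_cancel' (Nat.gcd_dvd_left n e)
      calc e * N = (n.gcd e * s) * N := by rw [← hs]
        _ = (n.gcd e * N) * s := by ring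
        _ = n * s := by rw [h2]
    rw [this, pow_mul, pow_card_eq_one', one_pow]
  have heq := Subgroup.eq_of_le_of_card_ge hle (by
    rw [IsCyclic.card_powMonoidHom_range, IsCyclic.card_powMonoidHom_ker]
    exact (Nat.gcd_eq_right (Nat.div_dvd_of_dvd (Nat.gcd_dvd_left n e))).le)
  have : c ∈ (powMonoidHom e : kˣ →* kˣ).range := by
    rw [heq, MonoidHom.mem_ker, powMonoidHom_apply]
    exact h
  exact this

variable (k) in
open Classical in
/-- The multiples of `q`-stable classes killed by `e`: they index the characters of `k` of order
dividing `e`. -/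
def torsionIndex (d e : ℕ) [NeZero d] : Finset (ZMod d) :=
  univ.filter fun m => (e : ZMod d) * m = 0 ∧ (Fintype.card k : ZMod d) * m = m

omit [Field k] in
lemma mem_torsionIndex {e : ℕ} {m : ZMod d} : m ∈ torsionIndex k d e ↔
    (e : ZMod d) * m = 0 ∧ (Fintype.card k : ZMod d) * m = m := by
  simp [torsionIndex]

/-- With `#k = n + 1`, the two conditions read `n m = 0` and `e m = 0`, that is, `gcd(n, e) m = 0`.
-/
lemma card_torsionIndex {e : ℕ} (he : e ∣ d) :
    (torsionIndex k d e).card = (Nat.card kˣ).gcd e := by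
  set n := Nat.card kˣ with hn
  set g := n.gcd e with hg
  have h1 : ∀ m : ZMod d, m ∈ torsionIndex k d e ↔ (g : ZMod d) * m = 0 := by
    intro m
    have hc : (Fintype.card k : ZMod d) = n + 1 := by
      rw [← Nat.cast_succ, Nat.succ_eq_add_one, hn, Nat.card_units, Nat.card_eq_fintype_card,
        Nat.sub_add_cancel Fintype.card_pos]
    rw [mem_torsionIndex, hc, add_mul, one_mul, add_eq_right]
    constructor
    · rintro ⟨h1, h2⟩
      have := congrArg (Int.cast : ℤ → ZMod d) (Nat.gcd_eq_gcd_ab n e)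
      push_cast at this
      rw [hg, this, add_mul, mul_right_comm, h2, mul_right_comm, h1]
      ring
    · intro h
      obtain ⟨a, ha⟩ := Nat.gcd_dvd_left n e
      obtain ⟨b, hb⟩ := Nat.gcd_dvd_right n e
      constructor
      · rw [hb, ← hg, Nat.cast_mul, mul_right_comm, h, zero_mul]
      · rw [ha, ← hg, Nat.cast_mul, mul_right_comm, h, zero_mul]
  have h2 := IsAddCyclic.card_nsmulAddMonoidHom_ker (ZMod d) g
  rw [Nat.card_eq_fintype_card (α := ZMod d), ZMod.card,
    Nat.gcd_eq_right ((Nat.gcd_dvd_right n e).trans he)] at h2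
  rw [hg, ← h2]
  exact (Nat.subtype_card _ fun m => by
    rw [h1, AddMonoidHom.mem_ker, nsmulAddMonoidHom_apply, nsmul_eq_mul]).symm

/-- The number of `e`-th roots as a sum of characters. -/
theorem natCast_card_pow_eq [DecidableEq k] (hT : Function.Injective T) {e : ℕ} (he : e ∣ d)
    (c : k) : ((univ.filter fun t : k => t ^ e = c).card : Q) =
      ∑ m ∈ torsionIndex k d e, powChar k T m c := by
  have he0 : e ≠ 0 := fun h => NeZero.ne d (by simpa [h] using he)
  by_cases hc : c = 0
  · subst hc
    have h1 : (univ.filter fun t : k => t ^ e = 0) = {0} := by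
      ext t
      simp [he0]
    rw [h1, card_singleton, sum_eq_single_of_mem 0 (by simp [mem_torsionIndex])]
    · rw [powChar_zero_apply, Nat.cast_one]
    · intro m hm h0
      exact powChar_apply_zero (mem_torsionIndex.mp hm).2 h0
  obtain ⟨c, rfl⟩ : ∃ u : kˣ, (u : k) = c := ⟨Units.mk0 c hc, rfl⟩
  by_cases hex : ∃ t : kˣ, t ^ e = c
  · obtain ⟨t, rfl⟩ := hex
    have h1 : ∀ m ∈ torsionIndex k d e, powChar k T m ((t ^ e : kˣ) : k) = 1 := by
      intro m hm
      rw [mem_torsionIndex] at hm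
      rw [Units.val_pow_eq_pow_val, map_pow, ← powChar_natCast_mul hm.2 e t.ne_zero, hm.1,
        powChar_zero_apply]
    rw [sum_congr rfl h1, sum_const, nsmul_one, card_torsionIndex he,
      ← IsCyclic.card_powMonoidHom_ker kˣ e,
      ← Nat.subtype_card (p := fun s : k => s ^ e = ((t ^ e : kˣ) : k)) _ (by simp)]
    congr 1
    symm
    refine Nat.card_eq_of_bijective (fun s => ⟨((s.1 * t : kˣ) : k), ?_⟩) ⟨?_, ?_⟩
    · have hs : s.1 ^ e = 1 := s.2
      rw [← Units.val_pow_eq_pow_val, mul_pow, hs, one_mul]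
    · intro s s' h
      rw [Subtype.mk.injEq, Units.val_inj] at h
      exact Subtype.ext (mul_right_cancel h)
    · rintro ⟨s, hs⟩
      have hs0 : s ≠ 0 := by
        rintro rfl
        rw [zero_pow he0] at hs
        exact (t ^ e).ne_zero hs.symm
      obtain ⟨s, rfl⟩ : ∃ u : kˣ, (u : k) = s := ⟨Units.mk0 s hs0, rfl⟩
      rw [← Units.val_pow_eq_pow_val, Units.val_inj] at hs
      refine ⟨⟨s * t⁻¹, ?_⟩, ?_⟩
      · rw [MonoidHom.mem_ker, powMonoidHom_apply, mul_pow, hs, ← mul_pow, mul_inv_cancel, one_pow]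
      · simp
  · have h1 : (univ.filter fun t : k => t ^ e = c) = ∅ := by
      rw [filter_eq_empty_iff]
      rintro t - ht
      have ht0 : t ≠ 0 := by
        rintro rfl
        rw [zero_pow he0] at ht
        exact c.ne_zero ht.symm
      exact hex ⟨Units.mk0 t ht0, Units.ext (by simpa using ht)⟩
    rw [h1, card_empty, Nat.cast_zero]
    set n := Nat.card kˣ with hn
    set g := n.gcd e with hg
    have hgd : g ∣ d := (Nat.gcd_dvd_right n e).trans he
    have hn0 : 0 < n := Nat.card_pos
    have hgn : g ∣ n := Nat.gcd_dvd_left n e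
    have hg0 : 0 < g := Nat.pos_of_dvd_of_pos hgn hn0
    have hcn : Fintype.card k = n + 1 := by
      rw [hn, Nat.card_units, Nat.card_eq_fintype_card, Nat.sub_add_cancel Fintype.card_pos]
    have hg1 : g ≠ 1 := by
      intro h
      apply hex
      apply exists_pow_eq_of_pow_eq_one
      rw [← hn, ← hg, h, Nat.div_one, pow_card_eq_one']
    have hgm : (g : ZMod d) * ((d / g : ℕ) : ZMod d) = 0 := by
      rw [← Nat.cast_mul, Nat.mul_div_cancel' hgd, ZMod.natCast_self]
    have hmem : ((d / g : ℕ) : ZMod d) ∈ torsionIndex k d e := by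
      rw [mem_torsionIndex]
      constructor
      · obtain ⟨b, hb⟩ := Nat.gcd_dvd_right n e
        rw [hb, ← hg, Nat.cast_mul, mul_right_comm, hgm, zero_mul]
      · obtain ⟨b, hb⟩ := hgn
        rw [hcn, hb, Nat.cast_add, Nat.cast_mul, add_mul, mul_right_comm, hgm, zero_mul, zero_add,
          Nat.cast_one, one_mul]
    -- The exponent attached to `m₀ = d/g` is `n/g`, and an element killed by this power is an
    -- `e`-th power. So this character is nontrivial at `c`, and translating the index set by `m₀`
    -- forces the sum to vanish.
    set m₀ : ZMod d := ((d / g : ℕ) : ZMod d) with hm₀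
    have hval : m₀.val = d / g :=
      ZMod.val_natCast_of_lt (Nat.div_lt_self (NeZero.pos d) (by omega))
    have hne : powChar k T m₀ c ≠ 1 := by
      intro h
      apply hex
      apply exists_pow_eq_of_pow_eq_one
      rw [powChar_apply, hval, hcn, Nat.add_sub_cancel, ← map_pow, ← map_pow, ← map_one T] at h
      have h3 := (algebraMap k Ω).injective ((hT h).trans (map_one _).symm)
      have h4 : n * (d / g) / d = n / g := by
        obtain ⟨b, hb⟩ := hgn
        rw [hb, Nat.mul_div_cancel_left _ hg0, mul_right_comm, Nat.mul_div_cancel' hgd,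
          Nat.mul_div_cancel_left _ (NeZero.pos d)]
      rw [h4] at h3
      exact Units.ext (by rw [Units.val_pow_eq_pow_val, Units.val_one]; exact h3)
    have hshift : ∑ m ∈ torsionIndex k d e, powChar k T (m + m₀) (c : k) =
        ∑ m ∈ torsionIndex k d e, powChar k T m (c : k) := by
      rw [mem_torsionIndex] at hmem
      refine sum_bij (fun m _ => m + m₀) ?_ ?_ ?_ ?_
      · intro m hm
        rw [mem_torsionIndex] at hm ⊢
        rw [mul_add, mul_add, hm.1, hm.2, hmem.1, hmem.2]
        exact ⟨add_zero _, rfl⟩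
      · intro a _ b _ h
        exact add_right_cancel h
      · intro m hm
        rw [mem_torsionIndex] at hm
        refine ⟨m - m₀, ?_, sub_add_cancel m m₀⟩
        rw [mem_torsionIndex, mul_sub, mul_sub, hm.1, hm.2, hmem.1, hmem.2]
        exact ⟨sub_zero _, rfl⟩
      · intros; rfl
    rw [mem_torsionIndex] at hmem
    rw [sum_congr rfl fun m hm => powChar_add (mem_torsionIndex.mp hm).2 hmem.2 c.ne_zero,
      ← sum_mul] at hshift
    have h2 : (∑ m ∈ torsionIndex k d e, powChar k T m (c : k)) * (powChar k T m₀ c - 1) = 0 := by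
      rw [mul_sub, hshift, mul_one, sub_self]
    exact ((mul_eq_zero.mp h2).resolve_right (sub_ne_zero.mpr hne)).symm

end Characters

/-! ### Jacobi sums -/

section JacobiSums

open Finset

variable {k Q : Type*} [Field k] [Fintype k] [Field Q]

open Classical in
/-- The sum of `∏ χᵢ(xᵢ)` over the points of the hyperplane `∑ xᵢ = s`. -/
def hyperplaneSum (χ : Fin 4 → k →* Q) (s : k) : Q :=
  ∑ x : Fin 4 → k with ∑ i, x i = s, ∏ i, χ i (x i)

/-- Scaling by `s` moves the hyperplane, and the product of the characters is trivial at `s`. -/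
lemma hyperplaneSum_eq_one {χ : Fin 4 → k →* Q} (h : ∀ x ≠ 0, ∏ i, χ i x = 1) {s : k}
    (hs : s ≠ 0) : hyperplaneSum χ s = hyperplaneSum χ 1 := by
  classical
  unfold hyperplaneSum
  symm
  refine sum_nbij' (fun x i => s * x i) (fun x i => s⁻¹ * x i) ?_ ?_ ?_ ?_ ?_
  · intro x hx
    simp only [mem_filter, mem_univ, true_and] at hx ⊢
    rw [← mul_sum, hx, mul_one]
  · intro x hx
    simp only [mem_filter, mem_univ, true_and] at hx ⊢
    rw [← mul_sum, hx, inv_mul_cancel₀ hs]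
  · intro x _
    funext i
    rw [inv_mul_cancel_left₀ hs]
  · intro x _
    funext i
    rw [mul_inv_cancel_left₀ hs]
  · intro x _
    simp only [map_mul, prod_mul_distrib, h s hs, one_mul]

lemma prod_sum_mul_eq (χ : Fin 4 → k →* Q) (ψ : AddChar k Q) :
    ∏ i, ∑ x, χ i x * ψ x = ∑ s, ψ s * hyperplaneSum χ s := by
  classical
  rw [prod_univ_sum, Fintype.piFinset_univ, ← sum_fiberwise (g := fun x : Fin 4 → k => ∑ i, x i)]
  refine sum_congr rfl fun s _ => ?_
  rw [hyperplaneSum, mul_sum]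
  refine sum_congr rfl fun x hx => ?_
  have hψ : ∏ i, ψ (x i) = ψ s := by
    rw [← (mem_filter.mp hx).2, Fin.sum_univ_four, Fin.prod_univ_four, AddChar.map_add_eq_mul,
      AddChar.map_add_eq_mul, AddChar.map_add_eq_mul]
  rw [prod_mul_distrib, mul_comm, hψ]

/-- The Jacobi sum `(#k - 1)⁻¹ ∑ ∏ χᵢ(xᵢ)` over the points of the hyperplane `∑ xᵢ = 0`. -/
def hyperplaneJacobi (χ : Fin 4 → k →* Q) : Q :=
  ((Fintype.card k : Q) - 1)⁻¹ * hyperplaneSum χ 0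

lemma card_sub_one_ne_zero [CharZero Q] : (Fintype.card k : Q) - 1 ≠ 0 := by
  have h1 : 1 < Fintype.card k := Fintype.one_lt_card
  rw [sub_ne_zero]
  exact_mod_cast h1.ne'

/-- Jacobi sums in terms of Gauss sums. -/
theorem prod_gaussSum_eq [CharZero Q] {χ : Fin 4 → k →* Q} (h : ∀ x ≠ 0, ∏ i, χ i x = 1)
    {j : Fin 4} (hj : ∑ x, χ j x = 0) {ψ : AddChar k Q} (hψ : ψ ≠ 1) :
    ∏ i, ∑ x, χ i x * ψ x = Fintype.card k * hyperplaneJacobi χ := by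
  classical
  have h1 : ∀ s : k, ∀ c : Q, c * hyperplaneSum χ s =
      c * hyperplaneSum χ 1 + if s = 0 then c * (hyperplaneSum χ 0 - hyperplaneSum χ 1) else 0 := by
    intro s c
    split_ifs with hs
    · rw [hs]; ring
    · rw [hyperplaneSum_eq_one h hs, add_zero]
  -- The trivial additive character gives a vanishing product because `χ j` sums to 0; this links
  -- the hyperplanes `s = 0` and `s = 1`.
  have h2 : hyperplaneSum χ 0 + ((Fintype.card k : Q) - 1) * hyperplaneSum χ 1 = 0 := by
    have e := prod_sum_mul_eq χ (1 : AddChar k Q)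
    simp only [AddChar.one_apply, mul_one] at e
    rw [prod_eq_zero (mem_univ j) hj, sum_congr rfl fun s _ => h1 s 1, sum_add_distrib,
      sum_ite_eq' univ, if_pos (mem_univ _), sum_const, card_univ, nsmul_eq_mul] at e
    linear_combination -e
  have hr := card_sub_one_ne_zero (k := k) (Q := Q)
  rw [prod_sum_mul_eq, sum_congr rfl fun s _ => h1 s (ψ s), sum_add_distrib, sum_ite_eq' univ,
    if_pos (mem_univ _), ← sum_mul, AddChar.sum_eq_zero_of_ne_one hψ, AddChar.map_zero_eq_one,
    hyperplaneJacobi]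
  field_simp
  linear_combination -h2

/-- A primitive additive character has values in a cyclotomic extension of `Q`, which embeds back
into the algebraically closed field `Q`. -/
lemma exists_addChar_ne_one [CharZero Q] [IsAlgClosed Q] : ∃ ψ : AddChar k Q, ψ ≠ 1 := by
  have hne : ringChar Q ≠ ringChar k := by
    rw [ringChar.eq_zero]
    intro h
    have := CharP.char_is_prime_or_zero k (ringChar k)
    have h2 : ringChar k ≠ 0 := CharP.ringChar_ne_zero_of_finite k
    exact h2 h.symm
  let φ := AddChar.FiniteField.primitiveChar k Q hne
  have : Algebra.IsAlgebraic Q (CyclotomicField φ.n Q) := by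
    have : NeZero ((φ.n : ℕ) : Q) := ⟨by exact_mod_cast φ.n.ne_zero⟩
    have := IsCyclotomicExtension.finite {(φ.n : ℕ)} Q (CyclotomicField φ.n Q)
    exact Algebra.IsAlgebraic.of_finite _ _
  let ι : CyclotomicField φ.n Q →ₐ[Q] Q := IsAlgClosed.lift
  have h1 : φ.char ≠ 1 := by
    have := φ.prim one_ne_zero
    rwa [AddChar.mulShift_one] at this
  refine ⟨(ι : CyclotomicField φ.n Q →* Q).compAddChar φ.char, fun h => h1 ?_⟩
  ext x
  have h2 := DFunLike.congr_fun h x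
  exact ι.toRingHom.injective (h2.trans (map_one ι.toRingHom).symm)

variable {Ω : Type*} [Field Ω] (T : Ω →*₀ Q) (k) [Algebra k Ω] {d : ℕ} [NeZero d]

/-- The Jacobi sum of the characters of `k` attached to `a`. -/
def jacobiAt (a : Fin 4 → ZMod d) : Q := hyperplaneJacobi fun i => powChar k T (a i)

variable {k T}

lemma prod_powChar {a : Fin 4 → ZMod d} (ha : ∀ i, (Fintype.card k : ZMod d) * a i = a i)
    (hs : ∑ i, a i = 0) {x : k} (hx : x ≠ 0) : ∏ i, powChar k T (a i) x = 1 := by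
  rw [Fin.sum_univ_four] at hs
  have h2 : (Fintype.card k : ZMod d) * (a 0 + a 1) = a 0 + a 1 := by rw [mul_add, ha, ha]
  have h3 : (Fintype.card k : ZMod d) * (a 0 + a 1 + a 2) = a 0 + a 1 + a 2 := by
    rw [mul_add, h2, ha]
  rw [Fin.prod_univ_four, ← powChar_add (ha 0) (ha 1) hx, ← powChar_add h2 (ha 2) hx,
    ← powChar_add h3 (ha 3) hx, hs, powChar_zero_apply]

/-- Express the Jacobi sum through four Gauss sums and apply Hasse-Davenport to each. The signs
cancel because there are four factors, and the cardinalities cancel because `#L = (#k)^n`. -/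
theorem jacobiAt_lift [CharZero Q] [IsAlgClosed Q] (hT : Function.Injective T)
    {L : Type*} [Field L] [Fintype L] [Algebra k L] [Algebra L Ω]
    [IsScalarTower k L Ω] {a : Fin 4 → ZMod d} (ha : ∀ i, (Fintype.card k : ZMod d) * a i = a i)
    (hs : ∑ i, a i = 0) (h0 : a ≠ 0) :
    jacobiAt L T a = jacobiAt k T a ^ Module.finrank k L := by
  obtain ⟨ψ, hψ⟩ := exists_addChar_ne_one (k := k) (Q := Q)
  obtain ⟨j, hj⟩ := Function.ne_iff.mp h0
  set n := Module.finrank k L with hn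
  have hcard : Fintype.card L = Fintype.card k ^ n := Module.card_eq_pow_finrank
  have haL : ∀ i, (Fintype.card L : ZMod d) * a i = a i := by
    intro i
    rw [hcard, Nat.cast_pow]
    induction n with
    | zero => rw [pow_zero, one_mul]
    | succ n ih => rw [pow_succ, mul_assoc, ha, ih]
  set ψL : AddChar L Q := ψ.compAddMonoidHom (Algebra.trace k L).toAddMonoidHom with hψL
  have hψL1 : ψL ≠ 1 := by
    obtain ⟨y, hy⟩ := AddChar.ne_one_iff.mp hψ
    obtain ⟨x, hx⟩ := Algebra.trace_surjective k L y
    refine AddChar.ne_one_iff.mpr ⟨x, ?_⟩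
    change ψ (Algebra.trace k L x) ≠ 1
    rwa [hx]
  have hk := prod_gaussSum_eq (fun x hx => prod_powChar (T := T) ha hs hx)
    (j := j) (sum_powChar hT (ha j) hj) hψ
  have hL := prod_gaussSum_eq (fun x hx => prod_powChar (T := T) haL hs hx)
    (j := j) (sum_powChar hT (haL j) hj) hψL1
  have hHD : ∀ i, ∑ x : L, powChar L T (a i) x * ψL x =
      -(-∑ x, powChar k T (a i) x * ψ x) ^ n := by
    intro i
    rw [hn, ← hasseDavenport (powChar k T (a i)) ψ hψ (L := L), neg_neg]
    refine sum_congr rfl fun x _ => ?_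
    rw [powChar_norm (ha i)]
    rfl
  have hprod : ∏ i, ∑ x : L, powChar L T (a i) x * ψL x =
      (∏ i, ∑ x, powChar k T (a i) x * ψ x) ^ n := by
    rw [prod_congr rfl fun i _ => hHD i, ← prod_pow]
    simp only [Fin.prod_univ_four]
    rcases Nat.even_or_odd n with h | h
    · simp only [h.neg_pow]
      ring
    · simp only [h.neg_pow]
      ring
  rw [hL, hk, mul_pow, hcard, Nat.cast_pow] at hprod
  have hr : ((Fintype.card k : Q) ^ n) ≠ 0 := pow_ne_zero _ (Nat.cast_ne_zero.mpr Fintype.card_ne_zero)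
  exact mul_left_cancel₀ hr hprod

lemma powChar_frobenius {F : Type*} [Field F] [Fintype F] [Algebra F k] {m : ZMod d}
    (hm : (Fintype.card k : ZMod d) * m = m) (x : k) :
    powChar k T ((Fintype.card F : ZMod d) * m) x = powChar k T m (x ^ Fintype.card F) := by
  by_cases hx : x = 0
  · subst hx
    rw [zero_pow Fintype.card_ne_zero]
    by_cases h0 : m = 0
    · rw [h0, mul_zero]
    · rw [powChar_apply_zero hm h0, powChar_apply_zero (by rw [mul_left_comm, hm])]
      intro h1
      obtain ⟨n, hn⟩ := Nat.exists_eq_add_of_le' (Module.finrank_pos (R := F) (M := k))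
      apply h0
      rw [← hm, Module.card_eq_pow_finrank (K := F) (V := k), hn, pow_succ, Nat.cast_mul, mul_assoc,
        h1, mul_zero]
  · rw [powChar_natCast_mul hm _ hx, map_pow]

/-- Frobenius over `F` permutes the points of the hyperplane, so the Jacobi sum depends only on the
orbit of `a`. -/
lemma jacobiAt_frobenius (F : Type*) [Field F] [Fintype F] [Algebra F k] {a : Fin 4 → ZMod d}
    (ha : ∀ i, (Fintype.card k : ZMod d) * a i = a i) :
    jacobiAt k T (fun i => (Fintype.card F : ZMod d) * a i) = jacobiAt k T a := by
  classical
  have : Algebra.IsAlgebraic F k := by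
    have : Module.Finite F k := Module.Finite.of_finite
    exact Algebra.IsAlgebraic.of_finite F k
  let φ := FiniteField.frobeniusAlgEquivOfAlgebraic F k
  unfold jacobiAt hyperplaneJacobi hyperplaneSum
  congr 1
  refine sum_nbij' (fun x i => φ (x i)) (fun x i => φ.symm (x i)) ?_ ?_ ?_ ?_ ?_
  · intro x hx
    simp only [mem_filter, mem_univ, true_and] at hx ⊢
    rw [← map_sum, hx, map_zero]
  · intro x hx
    simp only [mem_filter, mem_univ, true_and] at hx ⊢
    rw [← map_sum, hx, map_zero]
  · intro x _
    simp
  · intro x _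
    simp
  · intro x _
    refine prod_congr rfl fun i _ => ?_
    rw [powChar_frobenius (ha i)]
    rfl

end JacobiSums

/-! ### Counting points on the curves `y² + x y - tᵈ y = x³` -/

section PointSums

open Finset

variable {k Q : Type*} [Field k] [Fintype k] [Field Q]

/-- The sum of `χ` over the values of `w z (w + 1 - z)`. -/
def cubicCharSum (χ : k →* Q) : Q := ∑ w, ∑ z, χ (w * z * (w + 1 - z))

lemma sum_comp_mul {c : k} (hc : c ≠ 0) (f : k → Q) : ∑ x, f (c * x) = ∑ x, f x :=
  Equiv.sum_comp (Equiv.mulLeft₀ c hc) f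

/-- Substitute `y = xw`, then `x = wz`. The terms with a zero denominator vanish by `x / 0 = 0` and
`χ 0 = 0`, and the line `x = 0` contributes `∑ χ = 0`. -/
lemma sum_div_eq_cubicCharSum {χ : k →* Q} (h0 : χ 0 = 0) (hs : ∑ x, χ x = 0) :
    ∑ x, ∑ y, χ ((y ^ 2 + x * y - x ^ 3) / y) = cubicCharSum χ := by
  have h1 : ∀ x : k, ∑ y, χ ((y ^ 2 + x * y - x ^ 3) / y) =
      ∑ w, χ (x * (w ^ 2 + w - x) / w) := by
    intro x
    by_cases hx : x = 0
    · subst hx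
      simp only [zero_mul, zero_div, h0, sum_const_zero]
      rw [← hs]
      refine sum_congr rfl fun y _ => ?_
      by_cases hy : y = 0
      · simp [hy]
      · congr 1
        field_simp
        ring
    · rw [← sum_comp_mul hx]
      refine sum_congr rfl fun w _ => ?_
      by_cases hw : w = 0
      · simp [hw]
      · congr 1
        field_simp
  rw [sum_congr rfl fun x _ => h1 x, sum_comm, cubicCharSum]
  refine sum_congr rfl fun w _ => ?_
  by_cases hw : w = 0
  · simp [hw]
  · rw [← sum_comp_mul hw]
    refine sum_congr rfl fun z _ => ?_
    congr 1
    field_simp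

/-- A sum over a hyperplane in four-space as an iterated sum. -/
lemma hyperplaneSum_zero_eq (χ ω : k →* Q) : hyperplaneSum ![χ, χ, χ, ω] 0 =
    ∑ c, (∑ w, ∑ z, χ (-(w + z + c) * w * z)) * ω c := by
  classical
  have h1 : ∀ c, (∑ w, ∑ z, χ (-(w + z + c) * w * z)) * ω c =
      ∑ w, ∑ z, χ (-(w + z + c) * w * z) * ω c := fun c => by
    rw [sum_mul]
    exact sum_congr rfl fun w _ => sum_mul ..
  rw [sum_congr rfl fun c _ => h1 c, hyperplaneSum]
  rw [← sum_product', ← sum_product' (f := fun (p : k × k) z =>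
    χ (-(p.2 + z + p.1) * p.2 * z) * ω p.1)]
  refine sum_nbij' (fun x => ((x 3, x 1), x 2)) (fun p => ![-(p.1.2 + p.2 + p.1.1), p.1.2, p.2, p.1.1])
    ?_ ?_ ?_ ?_ ?_
  · intro x _
    simp
  · intro p _
    simp only [mem_filter, mem_univ, true_and, Fin.sum_univ_four]
    simp
    ring
  · intro x hx
    simp only [mem_filter, mem_univ, true_and, Fin.sum_univ_four] at hx
    funext i
    fin_cases i
    · simp
      linear_combination -hx
    · rfl
    · rfl
    · rfl
  · intro p _
    rfl
  · intro x hx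
    simp only [mem_filter, mem_univ, true_and, Fin.sum_univ_four] at hx
    simp only [Fin.prod_univ_four]
    have : x 0 = -(x 1 + x 2 + x 3) := by linear_combination hx
    simp [this, mul_assoc]

/-- The substitution `w ↦ cw`, `z ↦ -cz` extracts `c³` and leaves `wz(w + 1 - z)`. -/
lemma sum_sum_scale (χ : k →* Q) {c : k} (hc : c ≠ 0) :
    ∑ w, ∑ z, χ (-(w + z + c) * w * z) = χ c ^ 3 * cubicCharSum χ := by
  rw [← sum_comp_mul hc, cubicCharSum, mul_sum]
  refine sum_congr rfl fun w _ => ?_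
  rw [← sum_comp_mul (neg_ne_zero.mpr hc), mul_sum]
  refine sum_congr rfl fun z _ => ?_
  rw [← map_pow, ← map_mul]
  congr 1
  ring

/-- Slice the hyperplane by its last coordinate: the slice at 0 is killed by `ω 0 = 0`, and each of
the other `#k - 1` slices equals `cubicCharSum χ`, which cancels the normalization. -/
lemma hyperplaneJacobi_eq_cubicCharSum [CharZero Q] {χ ω : k →* Q} (h0 : ω 0 = 0)
    (h : ∀ x ≠ 0, χ x ^ 3 * ω x = 1) :
    hyperplaneJacobi ![χ, χ, χ, ω] = cubicCharSum χ := by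
  classical
  have h1 : ∀ c, (∑ w, ∑ z, χ (-(w + z + c) * w * z)) * ω c =
      cubicCharSum χ - if c = 0 then cubicCharSum χ else 0 := by
    intro c
    split_ifs with hc
    · rw [hc, h0, mul_zero, sub_self]
    · rw [sum_sum_scale χ hc, mul_right_comm, h c hc, one_mul, sub_zero]
  have hr := card_sub_one_ne_zero (k := k) (Q := Q)
  rw [hyperplaneJacobi, hyperplaneSum_zero_eq, sum_congr rfl fun c _ => h1 c, sum_sub_distrib,
    sum_ite_eq' univ, if_pos (mem_univ _), sum_const, card_univ, nsmul_eq_mul]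
  field_simp

lemma hyperplaneSum_eq_zero {χ ω : k →* Q} (hs : ∑ x, χ x = 0) (h : ∀ x, ω x = 1) :
    hyperplaneSum ![χ, χ, χ, ω] 0 = 0 := by
  rw [hyperplaneSum_zero_eq]
  simp only [h, mul_one]
  rw [sum_comm]
  refine sum_eq_zero fun w _ => ?_
  rw [sum_comm]
  refine sum_eq_zero fun z _ => ?_
  have h1 : ∀ c, χ (-(w + z + c) * w * z) = χ (-(w + z + c)) * χ (w * z) := fun c => by
    rw [← map_mul, mul_assoc]
  have h2 : ∑ c, χ (-(w + z + c)) = ∑ c, χ c :=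
    Equiv.sum_comp ((Equiv.addLeft (w + z)).trans (Equiv.neg k)) χ
  rw [sum_congr rfl fun c _ => h1 c, ← sum_mul, h2, hs, zero_mul]

/-- With `ω` trivial the full hyperplane sum is 0. Each slice with `c ≠ 0` gives `cubicCharSum χ`
because `χ³ = 1`, and the slice `c = 0` gives `(#k - 1) ∑ χ(z² - z)`; divide by `#k - 1`. -/
lemma cubicCharSum_eq_neg [CharZero Q] {χ : k →* Q} (h0 : χ 0 = 0) (hs : ∑ x, χ x = 0)
    (h : ∀ x ≠ 0, χ x ^ 3 = 1) : cubicCharSum χ = -∑ z, χ (z ^ 2 - z) := by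
  classical
  have hZ : ∑ w, ∑ z, χ (-(w + z + 0) * w * z) =
      ((Fintype.card k : Q) - 1) * ∑ z, χ (z ^ 2 - z) := by
    have h1 : ∀ c, ∑ z, χ (-(-c + z + 0) * -c * z) =
        ∑ z, χ (z ^ 2 - z) - if c = 0 then ∑ z, χ (z ^ 2 - z) else 0 := by
      intro c
      split_ifs with hc
      · simp [hc, h0]
      · rw [sub_zero, ← sum_comp_mul hc]
        refine sum_congr rfl fun z _ => ?_
        rw [show -(-c + c * z + 0) * -c * (c * z) = c ^ 3 * (z ^ 2 - z) by ring, map_mul, map_pow,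
          h c hc, one_mul]
    rw [← Equiv.sum_comp (Equiv.neg k)]
    simp only [Equiv.neg_apply]
    rw [sum_congr rfl fun c _ => h1 c, sum_sub_distrib,
      sum_ite_eq' univ, if_pos (mem_univ _), sum_const, card_univ, nsmul_eq_mul, sub_mul, one_mul]
  have h2 := hyperplaneSum_eq_zero (ω := 1) hs (fun _ => rfl)
  have h1 : ∀ c, (∑ w, ∑ z, χ (-(w + z + c) * w * z)) * (1 : k →* Q) c =
      cubicCharSum χ + if c = 0 then
        ((Fintype.card k : Q) - 1) * ∑ z, χ (z ^ 2 - z) - cubicCharSum χ else 0 := by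
    intro c
    rw [MonoidHom.one_apply, mul_one]
    split_ifs with hc
    · rw [hc, hZ]
      ring
    · rw [sum_sum_scale χ hc, h c hc, one_mul, add_zero]
  rw [hyperplaneSum_zero_eq, sum_congr rfl fun c _ => h1 c, sum_add_distrib,
    sum_ite_eq' univ, if_pos (mem_univ _), sum_const, card_univ, nsmul_eq_mul] at h2
  have hr := card_sub_one_ne_zero (k := k) (Q := Q)
  apply mul_left_cancel₀ hr
  linear_combination h2

variable {Ω : Type*} [Field Ω] {T : Ω →*₀ Q} [Algebra k Ω] {d : ℕ} [NeZero d]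

lemma sum_comp_pow [DecidableEq k] (hT : Function.Injective T) {e : ℕ} (he : e ∣ d) (f : k → Q) :
    ∑ x, f (x ^ e) = ∑ m ∈ torsionIndex k d e, ∑ c, powChar k T m c * f c := by
  rw [sum_comm, ← sum_fiberwise (g := fun x : k => x ^ e)]
  refine sum_congr rfl fun c _ => ?_
  rw [← sum_mul, ← natCast_card_pow_eq hT he, ← nsmul_eq_mul, ← sum_const]
  exact sum_congr rfl fun x hx => by rw [(mem_filter.mp hx).2]

variable [DecidableEq k]

/-- The equation is linear in `a`: for `y ≠ 0` it determines `a`, while `y = 0` forces `x = 0` and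
leaves `a` free. -/
lemma sum_indicator_hessianCurve (χ : k →* Q) :
    ∑ a, χ a * ∑ x, ∑ y, (if y ^ 2 + x * y - a * y = x ^ 3 then 1 else 0 : Q) =
      ∑ a, χ a + ∑ x : k, ∑ y : k, (if y = 0 then 0 else χ ((y ^ 2 + x * y - x ^ 3) / y)) := by
  have h1 : ∀ x y : k, ∑ a, χ a * (if y ^ 2 + x * y - a * y = x ^ 3 then 1 else 0 : Q) =
      (if y = 0 then if x = 0 then ∑ a, χ a else 0 else 0) +
        if y = 0 then 0 else χ ((y ^ 2 + x * y - x ^ 3) / y) := by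
    intro x y
    by_cases hy : y = 0
    · subst hy
      by_cases hx : x = 0
      · simp [hx]
      · simp [hx, Ne.symm (pow_ne_zero 3 hx)]
    · have : ∀ a, y ^ 2 + x * y - a * y = x ^ 3 ↔ a = (y ^ 2 + x * y - x ^ 3) / y := by
        intro a
        rw [eq_div_iff hy]
        constructor
        · intro h; linear_combination -h
        · intro h; linear_combination -h
      simp [this, hy]
  simp only [mul_sum]
  rw [sum_comm, sum_congr rfl fun x _ => sum_comm]
  simp only [h1, sum_add_distrib]
  simp

lemma natCast_card_equation (W : WeierstrassCurve k) :
    (Nat.card {P : k × k // W.toAffine.Equation P.1 P.2} : Q) = ∑ x, ∑ y,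
      if y ^ 2 + W.a₁ * x * y + W.a₃ * y = x ^ 3 + W.a₂ * x ^ 2 + W.a₄ * x + W.a₆ then 1 else 0 := by
  classical
  rw [Nat.card_eq_fintype_card, Fintype.card_subtype, card_filter, ← univ_product_univ,
    sum_product]
  push_cast
  simp only [WeierstrassCurve.Affine.equation_iff]

/-- The total number of points on the fibres `y² + x y - tᵈ y = x³`, `t ∈ k`. -/
theorem sum_frobSum_hessianCurve [CharZero Q] (hT : Function.Injective T)
    (h2 : ringChar k ≠ 2) (h3 : (3 : k) ≠ 0) :
    ((∑ x : k, frobSum k (hessianCurve (x ^ d)).c₄ (hessianCurve (x ^ d)).c₆ : ℤ) : Q) =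
      ∑ m ∈ (torsionIndex k d d).erase 0, cubicCharSum (powChar k T m) := by
  have hN : ∀ a : k, ((frobSum k (hessianCurve a).c₄ (hessianCurve a).c₆ : ℤ) : Q) =
      (∑ x, ∑ y, if y ^ 2 + x * y - a * y = x ^ 3 then 1 else 0) - Fintype.card k := by
    intro a
    have h := card_equation h2 h3 (hessianCurve a)
    have h' := natCast_card_equation (Q := Q) (hessianCurve a)
    rw [eq_sub_iff_add_eq, add_comm]
    have hc := congrArg (Int.cast : ℤ → Q) h
    push_cast at hc
    rw [← hc, h']
    refine sum_congr rfl fun x _ => sum_congr rfl fun y _ => ?_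
    simp [hessianCurve, sub_eq_add_neg]
  have h0 : (0 : ZMod d) ∈ torsionIndex k d d := by simp [mem_torsionIndex]
  rw [Int.cast_sum, sum_congr rfl fun x _ => hN (x ^ d), sum_sub_distrib,
    sum_comp_pow hT dvd_rfl (fun a => ∑ x, ∑ y, if y ^ 2 + x * y - a * y = x ^ 3 then 1 else 0),
    sum_congr rfl fun m _ => sum_indicator_hessianCurve (powChar k T m),
    ← add_sum_erase _ _ h0, add_comm, add_sub_assoc]
  -- The trivial character contributes `q + q(q - 1) = q²` with `q = #k`, which cancels the main
  -- term `q` of the `q` fibres.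
  have e0 : ∑ a, powChar k T (0 : ZMod d) a + ∑ x : k, ∑ y : k,
      (if y = 0 then 0 else powChar k T (0 : ZMod d) ((y ^ 2 + x * y - x ^ 3) / y)) =
      ∑ _x : k, (Fintype.card k : Q) := by
    simp only [powChar_zero_apply]
    have : ∀ y : k, (if y = 0 then 0 else 1 : Q) = 1 - if y = 0 then 1 else 0 := by
      intro y; split_ifs <;> simp
    simp only [this, sum_sub_distrib, sum_ite_eq', mem_univ, if_true]
    simp only [sum_const, card_univ, nsmul_eq_mul]
    ring
  rw [e0, sub_self, add_zero]
  refine sum_congr rfl fun m hm => ?_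
  rw [mem_erase, mem_torsionIndex] at hm
  have hz := powChar_apply_zero (T := T) hm.2.2 hm.1
  have hs := sum_powChar hT hm.2.2 hm.1
  rw [hs, zero_add, ← sum_div_eq_cubicCharSum hz hs]
  refine sum_congr rfl fun x _ => sum_congr rfl fun y _ => ?_
  split_ifs with hy
  · rw [hy, div_zero, hz]
  · rfl

/-- For each `y`, count the cube roots of `y² - y` by characters; the trivial one gives the main
term `#k`. -/
lemma frobSum_infty [CharZero Q] (hT : Function.Injective T)
    (h2 : ringChar k ≠ 2) (h3 : (3 : k) ≠ 0) (h : 3 ∣ d) :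
    ((frobSum k (⟨0, 0, -1, 0, 0⟩ : WeierstrassCurve k).c₄
      (⟨0, 0, -1, 0, 0⟩ : WeierstrassCurve k).c₆ : ℤ) : Q) =
      ∑ m ∈ (torsionIndex k d 3).erase 0, ∑ z, powChar k T m (z ^ 2 - z) := by
  have hc := congrArg (Int.cast : ℤ → Q) (card_equation h2 h3 ⟨0, 0, -1, 0, 0⟩)
  push_cast at hc
  rw [natCast_card_equation] at hc
  have h0 : (0 : ZMod d) ∈ torsionIndex k d 3 := by simp [mem_torsionIndex]
  have h1 : ∀ y : k, ∑ x : k, (if y ^ 2 + 0 * x * y + -1 * y = x ^ 3 + 0 * x ^ 2 + 0 * x + 0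
      then 1 else 0 : Q) = ∑ m ∈ torsionIndex k d 3, powChar k T m (y ^ 2 - y) := by
    intro y
    rw [← natCast_card_pow_eq hT h, card_filter]
    push_cast
    refine sum_congr rfl fun x _ => ?_
    congr 1
    rw [eq_comm, eq_iff_iff]
    simp [sub_eq_add_neg, eq_comm]
  rw [sum_comm, sum_congr rfl fun y _ => h1 y, sum_comm, ← add_sum_erase _ _ h0] at hc
  simp only [powChar_zero_apply, sum_const, card_univ, nsmul_one] at hc
  exact (add_left_cancel hc).symm

/-- The class `(m, m, m, -3 m)`. -/
def lamVec (m : ZMod d) : Fin 4 → ZMod d := ![m, m, m, -3 * m]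

open Classical in
/-- The total trace of Frobenius of the family as a sum of Jacobi sums. -/
theorem sum_frobSum_eq_sum_jacobiAt [CharZero Q] (hT : Function.Injective T)
    (h2 : ringChar k ≠ 2) (h3 : (3 : k) ≠ 0) :
    (((∑ x : k, frobSum k (hessianCurve (x ^ d)).c₄ (hessianCurve (x ^ d)).c₆) +
      if 3 ∣ d then frobSum k (⟨0, 0, -1, 0, 0⟩ : WeierstrassCurve k).c₄
        (⟨0, 0, -1, 0, 0⟩ : WeierstrassCurve k).c₆ else 0 : ℤ) : Q) =
      ∑ m ∈ (torsionIndex k d d).erase 0, jacobiAt k T (lamVec m) := by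
  have hvec : ∀ m : ZMod d, (fun i => powChar k T (lamVec m i)) =
      ![powChar k T m, powChar k T m, powChar k T m, powChar k T (-3 * m)] := by
    intro m
    funext i
    fin_cases i <;> rfl
  have hpow : ∀ m : ZMod d, (Fintype.card k : ZMod d) * m = m → ∀ x ≠ 0,
      powChar k T m x ^ 3 * powChar k T (-3 * m) x = 1 := by
    intro m hm x hx
    have h := prod_powChar (T := T) (a := lamVec m) (fun i => ?_) ?_ hx
    · simp only [Fin.prod_univ_four, lamVec] at h
      rw [← h]
      simp [pow_succ]
    · fin_cases i <;> simp [lamVec, hm, mul_left_comm _ (3 : ZMod d)]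
    · simp [Fin.sum_univ_four, lamVec]
      ring
  -- If `3m = 0`, the last character is trivial and the Jacobi sum is 0, whereas `cubicCharSum` is
  -- `-∑ χ(z² - z)`. The extra summand is exactly what the fibre at infinity supplies.
  have hJ : ∀ m ∈ (torsionIndex k d d).erase 0, jacobiAt k T (lamVec m) =
      cubicCharSum (powChar k T m) +
        if 3 * m = 0 then ∑ z, powChar k T m (z ^ 2 - z) else 0 := by
    intro m hm
    rw [mem_erase, mem_torsionIndex] at hm
    rw [jacobiAt, hvec]
    have hs := sum_powChar hT hm.2.2 hm.1
    split_ifs with h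
    · have h' : -3 * m = 0 := by rw [neg_mul, h, neg_zero]
      rw [hyperplaneJacobi, h', hyperplaneSum_eq_zero hs powChar_zero_apply, mul_zero,
        cubicCharSum_eq_neg (powChar_apply_zero hm.2.2 hm.1) hs, neg_add_cancel]
      intro x hx
      have := hpow m hm.2.2 x hx
      rwa [h', powChar_zero_apply, mul_one] at this
    · rw [add_zero, hyperplaneJacobi_eq_cubicCharSum _ (hpow m hm.2.2)]
      apply powChar_apply_zero
      · rw [mul_left_comm, hm.2.2]
      · rwa [neg_mul, neg_ne_zero]
  rw [sum_congr rfl hJ, sum_add_distrib, Int.cast_add, sum_frobSum_hessianCurve hT h2 h3]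
  congr 1
  split_ifs with h
  · rw [frobSum_infty hT h2 h3 h, ← sum_filter]
    refine sum_congr ?_ fun _ _ => rfl
    ext m
    simp only [mem_erase, mem_torsionIndex, mem_filter, CharP.cast_eq_zero, zero_mul, true_and]
    push_cast
    tauto
  · rw [Int.cast_zero]
    symm
    refine sum_eq_zero fun m hm => if_neg fun h' => (mem_erase.mp hm).1 ?_
    have hu : IsUnit (3 : ZMod d) := by
      have := (ZMod.isUnit_iff_coprime 3 d).mpr
        ((Nat.Prime.coprime_iff_not_dvd Nat.prime_three).mpr h)
      exact_mod_cast this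
    exact (hu.mul_right_eq_zero).mp h'

end PointSums

/-! ### Finite subfields of an algebraically closed field -/

section FixedFields

open Polynomial

variable (F Ω : Type*) [Field F] [Fintype F] [Field Ω] [Algebra F Ω]

/-- The subfield of fixed points of the `n`-th power of the Frobenius of `F`. -/
def frobFixed (n : ℕ) : IntermediateField F Ω where
  toSubalgebra := AlgHom.equalizer (FiniteField.frobeniusAlgHom F Ω ^ n) (AlgHom.id F Ω)
  inv_mem' x hx := by
    change (FiniteField.frobeniusAlgHom F Ω ^ n) x⁻¹ = x⁻¹
    rw [map_inv₀]
    exact congrArg _ hx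

variable {F Ω}

lemma mem_frobFixed {n : ℕ} {x : Ω} : x ∈ frobFixed F Ω n ↔ x ^ Fintype.card F ^ n = x := by
  have h : ∀ (n : ℕ) (x : Ω), (FiniteField.frobeniusAlgHom F Ω ^ n) x = x ^ Fintype.card F ^ n := by
    intro n x
    induction n with
    | zero => simp
    | succ n ih =>
      rw [pow_succ', AlgHom.mul_apply, ih, FiniteField.coe_frobeniusAlgHom]
      change (x ^ Fintype.card F ^ n) ^ Fintype.card F = _
      rw [← pow_mul, ← pow_succ]
  rw [← h]
  rfl

lemma frobFixed_le_of_dvd {m n : ℕ} (h : m ∣ n) : frobFixed F Ω m ≤ frobFixed F Ω n := by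
  obtain ⟨j, rfl⟩ := h
  intro x hx
  rw [mem_frobFixed] at hx ⊢
  induction j with
  | zero => simp
  | succ j ih => rw [Nat.mul_succ, pow_add, pow_mul, ih, hx]

variable [IsAlgClosed Ω]

lemma card_frobFixed {n : ℕ} (hn : n ≠ 0) :
    Nat.card (frobFixed F Ω n) = Fintype.card F ^ n := by
  classical
  obtain ⟨p, hp⟩ := CharP.exists F
  have : CharP Ω p := charP_of_injective_algebraMap' F p
  have h1 : 1 < Fintype.card F := Fintype.one_lt_card
  have hdvd : p ∣ Fintype.card F ^ n :=
    dvd_pow ((CharP.cast_eq_zero_iff F p _).mp (Nat.cast_card_eq_zero F)) hn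
  have hsep := galois_poly_separable (K := Ω) p _ hdvd
  have h2 := card_rootSet_eq_natDegree (K := Ω) hsep (IsAlgClosed.splits _)
  rw [FiniteField.X_pow_card_pow_sub_X_natDegree_eq Ω hn h1] at h2
  rw [← h2, ← Nat.card_eq_fintype_card]
  refine Nat.card_congr (Equiv.subtypeEquivRight fun x => ?_)
  rw [mem_frobFixed, mem_rootSet]
  simp [FiniteField.X_pow_card_pow_sub_X_ne_zero Ω hn h1, sub_eq_zero]

lemma finite_frobFixed {n : ℕ} (hn : n ≠ 0) : Finite (frobFixed F Ω n) :=
  Nat.finite_of_card_ne_zero (by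
    rw [card_frobFixed hn]
    exact pow_ne_zero _ Fintype.card_ne_zero)

lemma finrank_frobFixed {n : ℕ} (hn : n ≠ 0) : Module.finrank F (frobFixed F Ω n) = n := by
  have := finite_frobFixed (F := F) (Ω := Ω) hn
  have h := Module.natCard_eq_pow_finrank (K := F) (V := frobFixed F Ω n)
  rw [card_frobFixed hn, Nat.card_eq_fintype_card] at h
  exact (Nat.pow_right_injective Fintype.one_lt_card h).symm

end FixedFields

/-! ### The residue field of `ℤ̄` and the Teichmüller character -/

section Teichmuller

open Polynomial

variable {Qbar : Type*} [Field Qbar] (𝔓 : Ideal (integralClosure ℤ Qbar))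

lemma isMaximal_of_natCast_mem {p : ℕ} (hp : p.Prime) [𝔓.IsPrime]
    (h : (p : integralClosure ℤ Qbar) ∈ 𝔓) : 𝔓.IsMaximal := by
  apply Ideal.isMaximal_of_isIntegral_of_isMaximal_comap (R := ℤ)
  have h1 : Ideal.span {(p : ℤ)} ≤ 𝔓.comap (algebraMap ℤ (integralClosure ℤ Qbar)) := by
    rw [Ideal.span_singleton_le_iff_mem, Ideal.mem_comap, map_natCast]
    exact h
  have h2 : (Ideal.span {(p : ℤ)}).IsMaximal :=
    PrincipalIdealRing.isMaximal_of_irreducible (Nat.prime_iff_prime_int.mp hp).irreducible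
  rw [← h2.eq_of_le (Ideal.IsPrime.ne_top inferInstance) h1]
  exact h2

omit [Field Qbar] in
lemma exists_pow_eq_one_of_isIntegralElem {Ω : Type*} [Field Ω] (p : ℕ) [Fact p.Prime] [CharP Ω p]
    {x : Ω} (hx : x ≠ 0) (h : (Int.castRingHom Ω).IsIntegralElem x) :
    ∃ n : ℕ, 0 < n ∧ n.Coprime p ∧ x ^ n = 1 := by
  have hp : p.Prime := Fact.out
  let _ : Algebra (ZMod p) Ω := ZMod.algebra _ p
  have hint : IsIntegral (ZMod p) x := by
    obtain ⟨P, hP, he⟩ := h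
    refine ⟨P.map (Int.castRingHom (ZMod p)), hP.map _, ?_⟩
    rw [eval₂_map, ← he]
    congr 1
    exact RingHom.ext_int _ _
  have := IntermediateField.adjoin.finiteDimensional hint
  have : Finite (IntermediateField.adjoin (ZMod p) {x}) := Module.finite_of_finite (ZMod p)
  have := Fintype.ofFinite (IntermediateField.adjoin (ZMod p) {x})
  set K := IntermediateField.adjoin (ZMod p) {x}
  have hcard : Fintype.card K = p ^ Module.finrank (ZMod p) K := by
    rw [Module.card_eq_pow_finrank (K := ZMod p), ZMod.card]
  have hpos : Module.finrank (ZMod p) K ≠ 0 := Module.finrank_pos.ne'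
  have h1 : 1 < Fintype.card K := Fintype.one_lt_card
  refine ⟨Fintype.card K - 1, by omega, ?_, ?_⟩
  · rw [Nat.coprime_comm, hp.coprime_iff_not_dvd]
    intro h2
    have h3 : p ∣ Fintype.card K := by
      rw [hcard]
      exact dvd_pow_self p hpos
    have h4 : p ∣ 1 := by
      have := Nat.dvd_sub h3 h2
      rwa [Nat.sub_sub_self h1.le] at this
    exact hp.one_lt.ne' (Nat.dvd_one.mp h4)
  · have hx' : IntermediateField.AdjoinSimple.gen (ZMod p) x ≠ 0 := by
      intro h0
      apply hx
      rw [← IntermediateField.AdjoinSimple.coe_gen (ZMod p) x, h0]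
      rfl
    exact congrArg (Subtype.val) (FiniteField.pow_card_sub_one_eq_one _ hx')

variable [𝔓.IsMaximal]

attribute [local instance] Ideal.Quotient.field

lemma charP_residue {p : ℕ} (hp : p.Prime) (h : (p : integralClosure ℤ Qbar) ∈ 𝔓) :
    CharP (integralClosure ℤ Qbar ⧸ 𝔓) p := by
  have h0 : (p : integralClosure ℤ Qbar ⧸ 𝔓) = 0 := by
    rw [← map_natCast (Ideal.Quotient.mk 𝔓)]
    exact Ideal.Quotient.eq_zero_iff_mem.mpr h
  have := ringChar.charP (integralClosure ℤ Qbar ⧸ 𝔓)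
  have hdvd := (CharP.cast_eq_zero_iff _ (ringChar (integralClosure ℤ Qbar ⧸ 𝔓)) p).mp h0
  rcases (Nat.dvd_prime hp).mp hdvd with h1 | h1
  · exact absurd h1 (CharP.char_ne_one (integralClosure ℤ Qbar ⧸ 𝔓) _)
  · rwa [h1] at this

lemma exists_pow_eq_one_residue {p : ℕ} (hp : p.Prime) (h : (p : integralClosure ℤ Qbar) ∈ 𝔓)
    {x : integralClosure ℤ Qbar ⧸ 𝔓} (hx : x ≠ 0) : ∃ n : ℕ, 0 < n ∧ n.Coprime p ∧ x ^ n = 1 := by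
  have := charP_residue 𝔓 hp h
  have : Fact p.Prime := ⟨hp⟩
  refine exists_pow_eq_one_of_isIntegralElem p hx ?_
  obtain ⟨z, rfl⟩ := Ideal.Quotient.mk_surjective x
  obtain ⟨P, hP, he⟩ := Algebra.IsIntegral.isIntegral (R := ℤ) z
  refine ⟨P, hP, ?_⟩
  have h1 := congrArg (Ideal.Quotient.mk 𝔓) he
  rw [hom_eval₂, map_zero] at h1
  rw [← h1]
  congr 1

variable [CharZero Qbar] [IsAlgClosed Qbar]

omit [CharZero Qbar] in
-- Lift a monic polynomial to a monic one over `ℤ̄`; its root in `Qbar` is integral and can be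
-- reduced.
lemma isAlgClosed_residue : IsAlgClosed (integralClosure ℤ Qbar ⧸ 𝔓) := by
  apply IsAlgClosed.of_exists_root
  intro f hf hirr
  obtain ⟨g, hg, hdeg, hgm⟩ := lifts_and_natDegree_eq_and_monic
    ((mem_lifts f).mpr (map_surjective _ Ideal.Quotient.mk_surjective f)) hf
  obtain ⟨y, hy⟩ := IsAlgClosed.exists_root
    (g.map (algebraMap (integralClosure ℤ Qbar) Qbar)) (by
      rw [hgm.degree_map, degree_eq_natDegree hgm.ne_zero, hdeg]
      exact_mod_cast hirr.natDegree_pos.ne')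
  have hy1 : IsIntegral (integralClosure ℤ Qbar) y :=
    ⟨g, hgm, by rwa [IsRoot.def, eval_map] at hy⟩
  have hy2 : IsIntegral ℤ y := isIntegral_trans y hy1
  refine ⟨Ideal.Quotient.mk 𝔓 ⟨y, hy2⟩, ?_⟩
  rw [← hg, eval_map, eval₂_hom]
  have : eval ⟨y, hy2⟩ g = 0 := by
    apply Subtype.ext
    rw [IsRoot.def, eval_map] at hy
    have h1 := Polynomial.eval₂_hom (p := g) (algebraMap (integralClosure ℤ Qbar) Qbar) ⟨y, hy2⟩
    exact h1.symm.trans hy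
  rw [this, map_zero]

/-- Reduce the factorization of `Xⁿ - 1` over `ℤ̄` modulo `𝔓` and evaluate at `x`: one factor must
vanish. -/
lemma exists_root_of_unity_lift {n : ℕ} (hn : 0 < n) {x : integralClosure ℤ Qbar ⧸ 𝔓}
    (hx : x ^ n = 1) : ∃ z : integralClosure ℤ Qbar, z ^ n = 1 ∧ Ideal.Quotient.mk 𝔓 z = x := by
  have : NeZero n := ⟨hn.ne'⟩
  obtain ⟨ζ, hζ⟩ := HasEnoughRootsOfUnity.exists_primitiveRoot Qbar n
  have hint : IsIntegral ℤ ζ := IsIntegral.of_pow hn (by rw [hζ.pow_eq_one]; exact isIntegral_one)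
  have hprim : IsPrimitiveRoot (⟨ζ, hint⟩ : integralClosure ℤ Qbar) n :=
    IsPrimitiveRoot.of_map_of_injective (f := algebraMap (integralClosure ℤ Qbar) Qbar) hζ
      Subtype.val_injective
  have h1 := congrArg (fun P => eval₂ (Ideal.Quotient.mk 𝔓) x P) (X_pow_sub_one_eq_prod hn hprim)
  simp only [eval₂_sub, eval₂_pow, eval₂_X, eval₂_one, hx, sub_self, eval₂_finsetProd,
    eval₂_C] at h1
  obtain ⟨z, hz, h2⟩ := Finset.prod_eq_zero_iff.mp h1.symm
  exact ⟨z, (mem_nthRootsFinset hn _).mp hz, (sub_eq_zero.mp h2).symm⟩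

omit [CharZero Qbar] [IsAlgClosed Qbar] in
-- If the quotient `ζ = z/w`, written `w^(n-1) z`, were not 1, then `1 + ζ + ⋯ + ζ^(n-1) = 0`; but
-- `ζ` reduces to 1, so this would give `p ∣ n`.
lemma root_of_unity_unique {p : ℕ} (hp : p.Prime) (h : (p : integralClosure ℤ Qbar) ∈ 𝔓)
    {n : ℕ} (hn : n.Coprime p) {z w : integralClosure ℤ Qbar} (hz : z ^ n = 1) (hw : w ^ n = 1)
    (hzw : Ideal.Quotient.mk 𝔓 z = Ideal.Quotient.mk 𝔓 w) : z = w := by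
  have := charP_residue 𝔓 hp h
  by_contra hne
  have hn0 : n ≠ 0 := by
    rintro rfl
    rw [Nat.coprime_zero_left] at hn
    exact hp.one_lt.ne' hn
  have hw1 : w ^ (n - 1) * w = 1 := by
    rw [← pow_succ, Nat.sub_add_cancel (Nat.pos_of_ne_zero hn0), hw]
  set ζ := w ^ (n - 1) * z with hζ
  have hζn : ζ ^ n = 1 := by
    rw [hζ, mul_pow, hz, ← pow_mul, mul_comm, mul_comm (n - 1), pow_mul, hw, one_pow, one_mul]
  have hζ1 : ζ - 1 ≠ 0 := by
    intro h0
    apply hne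
    have : w * (w ^ (n - 1) * z) = w * 1 := by rw [← hζ, sub_eq_zero.mp h0]
    rw [← mul_assoc, mul_comm w, hw1, one_mul, mul_one] at this
    exact this
  have hsum : ∑ i ∈ Finset.range n, ζ ^ i = 0 := by
    have := geom_sum_mul ζ n
    rw [hζn, sub_self, mul_eq_zero] at this
    exact this.resolve_right hζ1
  have hmk : Ideal.Quotient.mk 𝔓 ζ = 1 := by
    rw [hζ, map_mul, hzw, ← map_mul, hw1, map_one]
  have h2 := congrArg (Ideal.Quotient.mk 𝔓) hsum
  rw [map_sum, Finset.sum_congr rfl fun i _ => by rw [map_pow, hmk, one_pow], map_zero,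
    Finset.sum_const, Finset.card_range, nsmul_one, CharP.cast_eq_zero_iff _ p] at h2
  rw [Nat.coprime_comm, hp.coprime_iff_not_dvd] at hn
  exact hn h2

variable {p f q : ℕ}

lemma teich_spec (hp : p.Prime) (h : (p : integralClosure ℤ Qbar) ∈ 𝔓) (hq : q = p ^ f)
    {x : integralClosure ℤ Qbar ⧸ 𝔓} (hx : x ≠ 0) :
    (∃ n : ℕ, 0 < n ∧ n.Coprime q ∧ teich 𝔓 q x ^ n = 1) ∧
      Ideal.Quotient.mk 𝔓 (teich 𝔓 q x) = x := by
  have hex : ∃ z ∈ {z : integralClosure ℤ Qbar | ∃ n : ℕ, 0 < n ∧ n.Coprime q ∧ z ^ n = 1},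
      Ideal.Quotient.mk 𝔓 z = x := by
    obtain ⟨n, hn, hnp, hxn⟩ := exists_pow_eq_one_residue 𝔓 hp h hx
    obtain ⟨z, hz, hzx⟩ := exists_root_of_unity_lift 𝔓 hn hxn
    exact ⟨z, ⟨n, hn, hq ▸ Nat.Coprime.pow_right f hnp, hz⟩, hzx⟩
  exact ⟨Function.invFunOn_mem hex, Function.invFunOn_eq hex⟩

lemma teich_eq (hp : p.Prime) (h : (p : integralClosure ℤ Qbar) ∈ 𝔓) (hf : f ≠ 0) (hq : q = p ^ f)
    {x : integralClosure ℤ Qbar ⧸ 𝔓} (hx : x ≠ 0) {z : integralClosure ℤ Qbar} {n : ℕ}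
    (hn : n.Coprime q) (hz : z ^ n = 1) (hzx : Ideal.Quotient.mk 𝔓 z = x) :
    teich 𝔓 q x = z := by
  obtain ⟨⟨m, hm, hmq, ht⟩, htx⟩ := teich_spec 𝔓 hp h hq hx
  rw [hq, Nat.coprime_pow_right_iff (Nat.pos_of_ne_zero hf)] at hn hmq
  refine root_of_unity_unique 𝔓 hp h (n := m * n) (hmq.mul_left hn) ?_ ?_ (htx.trans hzx.symm)
  · rw [pow_mul, ht, one_pow]
  · rw [mul_comm, pow_mul, hz, one_pow]

open Classical in
/-- The Teichmüller lift, extended by `0`. -/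
def teichHom (hp : p.Prime) (h : (p : integralClosure ℤ Qbar) ∈ 𝔓) (hf : f ≠ 0) (hq : q = p ^ f) :
    (integralClosure ℤ Qbar ⧸ 𝔓) →*₀ Qbar where
  toFun x := if x = 0 then 0 else (teich 𝔓 q x : Qbar)
  map_zero' := if_pos rfl
  map_one' := by
    rw [if_neg one_ne_zero, teich_eq 𝔓 hp h hf hq one_ne_zero (Nat.coprime_one_left q)
      (one_pow 1) (map_one _)]
    rfl
  map_mul' x y := by
    by_cases hx : x = 0
    · simp [hx]
    by_cases hy : y = 0
    · simp [hy]
    obtain ⟨⟨m, hm, hmq, ht⟩, htx⟩ := teich_spec 𝔓 hp h hq hx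
    obtain ⟨⟨n, hn, hnq, hs⟩, hsy⟩ := teich_spec 𝔓 hp h hq hy
    rw [if_neg hx, if_neg hy, if_neg (mul_ne_zero hx hy), ← MulMemClass.coe_mul]
    congr 1
    refine teich_eq 𝔓 hp h hf hq (mul_ne_zero hx hy) (n := m * n) (hmq.mul_left hnq) ?_ ?_
    · rw [mul_pow, pow_mul, ht, one_pow, mul_comm m, pow_mul, hs, one_pow, one_mul]
    · rw [map_mul, htx, hsy]

variable (hp : p.Prime) (h : (p : integralClosure ℤ Qbar) ∈ 𝔓) (hf : f ≠ 0) (hq : q = p ^ f)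

lemma teichHom_apply {x : integralClosure ℤ Qbar ⧸ 𝔓} (hx : x ≠ 0) :
    teichHom 𝔓 hp h hf hq x = (teich 𝔓 q x : Qbar) := if_neg hx

lemma teichHom_injective : Function.Injective (teichHom 𝔓 hp h hf hq) := by
  intro x y hxy
  by_cases hx : x = 0
  · rw [hx, map_zero, eq_comm, map_eq_zero] at hxy
    rw [hx, hxy]
  by_cases hy : y = 0
  · rw [hy, map_zero, map_eq_zero] at hxy
    rw [hy, hxy]
  rw [teichHom_apply 𝔓 hp h hf hq hx, teichHom_apply 𝔓 hp h hf hq hy] at hxy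
  rw [← (teich_spec 𝔓 hp h hq hx).2, ← (teich_spec 𝔓 hp h hq hy).2, Subtype.ext hxy]

lemma chi_eq_powChar {k : Type*} [Field k] [Fintype k] [Algebra k (integralClosure ℤ Qbar ⧸ 𝔓)]
    {d : ℕ} [NeZero d] {m : ZMod d} (hm : (Fintype.card k : ZMod d) * m = m) (x : k) :
    chi 𝔓 q (Fintype.card k) m (algebraMap k (integralClosure ℤ Qbar ⧸ 𝔓) x) =
      powChar k (teichHom 𝔓 hp h hf hq) m x := by
  unfold chi
  by_cases hx : x = 0
  · subst hx
    rw [map_zero, if_pos rfl]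
    split_ifs with hm0
    · rw [hm0, powChar_zero_apply]
    · rw [powChar_apply_zero hm hm0]
  · have hx' : algebraMap k (integralClosure ℤ Qbar ⧸ 𝔓) x ≠ 0 := (_root_.map_ne_zero _).mpr hx
    rw [if_neg hx', powChar_apply, teichHom_apply 𝔓 hp h hf hq hx']

lemma jacobi_eq_jacobiAt {F : Type*} [Field F] [Fintype F] (hF : Fintype.card F = q)
    [Algebra F (integralClosure ℤ Qbar ⧸ 𝔓)] {d : ℕ} [NeZero d] (a : G d)
    {l : ℕ} (hl : l ≠ 0) (hla : (orbit q a).ncard = l)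
    [Fintype (frobFixed F (integralClosure ℤ Qbar ⧸ 𝔓) l)]
    (ha : ∀ i, ((q ^ l : ℕ) : ZMod d) * (a : Fin 4 → ZMod d) i = (a : Fin 4 → ZMod d) i) :
    jacobi 𝔓 q a = jacobiAt (frobFixed F (integralClosure ℤ Qbar ⧸ 𝔓) l)
      (teichHom 𝔓 hp h hf hq) (a : Fin 4 → ZMod d) := by
  have := isAlgClosed_residue 𝔓
  have hcard : Fintype.card (frobFixed F (integralClosure ℤ Qbar ⧸ 𝔓) l) = q ^ l := by
    rw [← Nat.card_eq_fintype_card, card_frobFixed hl, hF]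
  unfold jacobi jacobiAt hyperplaneJacobi hyperplaneSum
  rw [hla, hcard]
  congr 1
  rw [← finsum_mem_coe_finset]
  symm
  refine finsum_mem_eq_of_bijOn (fun (x : Fin 4 → frobFixed F (integralClosure ℤ Qbar ⧸ 𝔓) l) i =>
    (x i : integralClosure ℤ Qbar ⧸ 𝔓))
    ⟨?_, ?_, ?_⟩ ?_
  · intro x hx
    replace hx := (@Finset.mem_filter _ _ (_) _ _).mp hx
    refine ⟨fun i => ?_, ?_⟩
    · have := (x i).2
      rwa [mem_frobFixed, hF] at this
    · have := congrArg (Subtype.val) hx.2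
      rwa [AddSubmonoidClass.coe_finsetSum] at this
  · intro x _ y _ hxy
    funext i
    exact Subtype.ext (congrFun hxy i)
  · intro y hy
    refine ⟨fun i => ⟨y i, by rw [mem_frobFixed, hF]; exact hy.1 i⟩, ?_, rfl⟩
    refine (@Finset.mem_filter _ _ (_) _ _).mpr ⟨Finset.mem_univ _, Subtype.ext ?_⟩
    rw [AddSubmonoidClass.coe_finsetSum]
    exact hy.2
  · intro x _
    refine Finset.prod_congr rfl fun i _ => ?_
    rw [← chi_eq_powChar 𝔓 hp h hf hq (by rw [hcard]; exact ha i), hcard]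
    rfl

end Teichmuller

/-! ### Orbits of multiplication by `q` -/

section Orbits

open Finset Function

variable {d : ℕ} [NeZero d] {q : ℕ}

omit [NeZero d] in
lemma iterate_nsmul (a : G d) (n : ℕ) : (fun b : G d => q • b)^[n] a = q ^ n • a := by
  induction n with
  | zero => simp
  | succ n ih => rw [iterate_succ_apply', ih, smul_smul, pow_succ']

omit [NeZero d] in
lemma mem_orbit_self (a : G d) : a ∈ orbit q a := ⟨0, by simp⟩

omit [NeZero d] in
lemma natCast_pow_totient (hq : d.Coprime q) : (q : ZMod d) ^ d.totient = 1 := by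
  rw [← Nat.cast_pow, ← Nat.cast_one]
  exact (ZMod.natCast_eq_natCast_iff _ _ _).mpr (Nat.ModEq.pow_totient hq.symm)

omit [NeZero d] in
lemma nsmul_apply (n : ℕ) (a : G d) (i : Fin 4) :
    ((n • a : G d) : Fin 4 → ZMod d) i = (n : ZMod d) * (a : Fin 4 → ZMod d) i := by
  rw [AddSubgroup.coe_nsmul, Pi.smul_apply, nsmul_eq_mul]

omit [NeZero d] in
lemma pow_totient_smul (hq : d.Coprime q) (a : G d) : q ^ d.totient • a = a := by
  apply Subtype.ext
  funext i
  rw [nsmul_apply, Nat.cast_pow, natCast_pow_totient hq, one_mul]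

lemma orbit_eq_of_mem (hq : d.Coprime q) {a b : G d} (h : b ∈ orbit q a) :
    orbit q b = orbit q a := by
  obtain ⟨k, rfl⟩ := h
  have h1 : ∀ j, (q ^ d.totient) ^ j • a = a := by
    intro j
    induction j with
    | zero => simp
    | succ j ih => rw [pow_succ', mul_smul, ih, pow_totient_smul hq]
  apply Set.Subset.antisymm
  · rintro _ ⟨j, rfl⟩
    exact ⟨j + k, by simp only [pow_add, mul_smul]⟩
  · rintro _ ⟨j, rfl⟩
    have ht : 0 < d.totient := Nat.totient_pos.mpr (NeZero.pos d)
    -- Since `q^φ(d)` acts trivially, the exponent `φ(d)k - k` inverts the action of `q^k`.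
    refine ⟨j + (d.totient * k - k), ?_⟩
    simp only
    rw [smul_smul, ← pow_add, add_assoc, Nat.sub_add_cancel (Nat.le_mul_of_pos_left k ht), pow_add,
      mul_smul, pow_mul, h1]

omit [NeZero d] in
lemma isPeriodicPt (hq : d.Coprime q) (a : G d) :
    IsPeriodicPt (fun b : G d => q • b) d.totient a := by
  rw [IsPeriodicPt, IsFixedPt, iterate_nsmul, pow_totient_smul hq]

lemma ncard_orbit (hq : d.Coprime q) (a : G d) :
    (orbit q a).ncard = minimalPeriod (fun b : G d => q • b) a := by
  set f := fun b : G d => q • b with hf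
  have ht : 0 < d.totient := Nat.totient_pos.mpr (NeZero.pos d)
  have hpos : 0 < minimalPeriod f a := (isPeriodicPt hq a).minimalPeriod_pos ht
  have h : orbit q a = (fun n => f^[n] a) '' Set.Iio (minimalPeriod f a) := by
    ext b
    constructor
    · rintro ⟨k, rfl⟩
      refine ⟨k % minimalPeriod f a, Nat.mod_lt _ hpos, ?_⟩
      simp only
      rw [iterate_mod_minimalPeriod_eq, hf, iterate_nsmul]
    · rintro ⟨k, _, rfl⟩
      exact ⟨k, (iterate_nsmul a k).symm⟩
  rw [h, Set.InjOn.ncard_image iterate_injOn_Iio_minimalPeriod, ← Finset.coe_Iio,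
    Set.ncard_coe_finset, Nat.card_Iio]

lemma ncard_orbit_ne_zero (hq : d.Coprime q) (a : G d) : (orbit q a).ncard ≠ 0 := by
  rw [ncard_orbit hq]
  exact ((isPeriodicPt hq a).minimalPeriod_pos (Nat.totient_pos.mpr (NeZero.pos d))).ne'

lemma pow_smul_eq_iff (hq : d.Coprime q) (a : G d) (n : ℕ) :
    q ^ n • a = a ↔ (orbit q a).ncard ∣ n := by
  rw [ncard_orbit hq, ← isPeriodicPt_iff_minimalPeriod_dvd, IsPeriodicPt, IsFixedPt, iterate_nsmul]

/-- The element `(m, m, m, -3 m)` of `G_d`. -/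
def lamElt (m : ZMod d) : G d := ⟨lamVec m, by
  change ∑ i, lamVec m i = 0
  simp [Fin.sum_univ_four, lamVec]
  ring⟩

omit [NeZero d] in
lemma lamElt_injective : Injective (lamElt : ZMod d → G d) := fun m m' h => by
  have := congrFun (congrArg Subtype.val h) 0
  exact this

omit [NeZero d] in
lemma lamVec_ne_zero {m : ZMod d} (hm : m ≠ 0) : lamVec m ≠ 0 := fun h => hm (congrFun h 0)

omit [NeZero d] in
lemma nsmul_lamElt (n : ℕ) (m : ZMod d) : n • lamElt m = lamElt ((n : ZMod d) * m) := by
  apply Subtype.ext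
  funext i
  rw [nsmul_apply]
  change (n : ZMod d) * lamVec m i = lamVec ((n : ZMod d) * m) i
  fin_cases i <;> simp [lamVec]
  ring

omit [NeZero d] in
lemma nsmul_lamElt_eq_iff (n : ℕ) (m : ZMod d) : n • lamElt m = lamElt m ↔ (n : ZMod d) * m = m := by
  rw [nsmul_lamElt, lamElt_injective.eq_iff]

omit [NeZero d] in
lemma mul_lamVec {c m : ZMod d} (h : c * m = m) (i : Fin 4) : c * lamVec m i = lamVec m i := by
  fin_cases i <;> simp [lamVec, h, mul_left_comm c]

omit [NeZero d] in
lemma Lam_eq : Lam d = lamElt '' {m : ZMod d | m ≠ 0} := by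
  ext a
  constructor
  · rintro ⟨⟨m, hm⟩, h0⟩
    have ha : lamElt m = a := Subtype.ext hm.symm
    refine ⟨m, ?_, ha⟩
    rintro rfl
    apply h0
    rw [Set.mem_singleton_iff, ← ha]
    apply Subtype.ext
    funext i
    fin_cases i <;> simp [lamElt, lamVec]
  · rintro ⟨m, hm, rfl⟩
    refine ⟨⟨m, rfl⟩, fun h => hm ?_⟩
    exact congrFun (congrArg Subtype.val (Set.mem_singleton_iff.mp h)) 0

omit [NeZero d] in
lemma mem_orbit_lamElt {m : ZMod d} {b : G d} (h : b ∈ orbit q (lamElt m)) :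
    ∃ k : ℕ, b = lamElt ((q : ZMod d) ^ k * m) := by
  obtain ⟨k, rfl⟩ := h
  exact ⟨k, by simp only [nsmul_lamElt, Nat.cast_pow]⟩

omit [NeZero d] in
lemma isUnit_natCast_pow (hq : d.Coprime q) (k : ℕ) : IsUnit ((q : ZMod d) ^ k) :=
  ((ZMod.isUnit_iff_coprime q d).mpr hq.symm).pow k

open Classical in
/-- A sum over orbits weighted by their lengths is a sum over elements. -/
lemma sum_orbits {R : Type*} [CommRing R] (hq : d.Coprime q) (h : Set (G d) → R) :
    ∑ A ∈ (univ.filter fun m : ZMod d => m ≠ 0).image (fun m => orbit q (lamElt m)),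
      (A.ncard : R) * h A = ∑ m : ZMod d with m ≠ 0, h (orbit q (lamElt m)) := by
  rw [← sum_fiberwise_of_maps_to (g := fun m => orbit q (lamElt m))
    (fun m hm => mem_image_of_mem (fun m => orbit q (lamElt m)) hm)]
  refine sum_congr rfl fun A hA => ?_
  rw [sum_congr rfl fun m hm => by rw [(mem_filter.mp hm).2], sum_const, nsmul_eq_mul]
  congr 2
  obtain ⟨m₀, hm₀, rfl⟩ := mem_image.mp hA
  rw [← Set.ncard_coe_finset, ← Set.ncard_image_of_injective _ lamElt_injective]
  congr 1
  ext b
  constructor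
  · intro hb
    obtain ⟨k, rfl⟩ := mem_orbit_lamElt hb
    refine ⟨_, ?_, rfl⟩
    rw [mem_coe, mem_filter, mem_filter]
    refine ⟨⟨mem_univ _, fun h0 => (mem_filter.mp hm₀).2 ?_⟩, orbit_eq_of_mem hq hb⟩
    exact ((isUnit_natCast_pow hq k).mul_right_eq_zero).mp h0
  · rintro ⟨m, hm, rfl⟩
    rw [mem_coe, mem_filter] at hm
    rw [← hm.2]
    exact mem_orbit_self _

end Orbits

/-! ### Logarithmic derivative of `P` for `Λ_d` -/

section OrbitProduct

open Finset

variable {Qbar : Type*} [Field Qbar] (𝔓 : Ideal (integralClosure ℤ Qbar))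
variable {d : ℕ} [NeZero d] {q : ℕ}

open Classical in
lemma P_Lam_eq : P 𝔓 q (Lam d) =
    ∏ A ∈ (univ.filter fun m : ZMod d => m ≠ 0).image (fun m => orbit q (lamElt m)),
      (1 - Polynomial.C (jacobi 𝔓 q (Classical.epsilon fun a => a ∈ A)) *
        Polynomial.X ^ A.ncard) := by
  have h : orbit q '' Lam d =
      ((univ.filter fun m : ZMod d => m ≠ 0).image (fun m => orbit q (lamElt m)) :
        Finset (Set (G d))) := by
    rw [Lam_eq, Set.image_image, coe_image, coe_filter_univ]
  rw [P, h, finprod_mem_coe_finset]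

omit [NeZero d] in
lemma epsilon_mem_orbit (a : G d) : Classical.epsilon (fun b => b ∈ orbit q a) ∈ orbit q a :=
  Classical.epsilon_spec (p := fun b => b ∈ orbit q a) ⟨a, mem_orbit_self a⟩

open Classical PowerSeries in
lemma isLogDeriv_P_Lam (hq : d.Coprime q) : IsLogDeriv ((P 𝔓 q (Lam d) : Qbar[X]) : PowerSeries Qbar)
    (∑ A ∈ (univ.filter fun m : ZMod d => m ≠ 0).image (fun m => orbit q (lamElt m)),
      -dilate A.ncard fun j => jacobi 𝔓 q (Classical.epsilon fun a => a ∈ A) ^ j) := by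
  rw [P_Lam_eq, ← Polynomial.coeToPowerSeries.ringHom_apply, map_prod]
  refine IsLogDeriv.prod _ fun A hA => ?_
  obtain ⟨m, hm, rfl⟩ := mem_image.mp hA
  have h := isLogDeriv_quadratic (jacobi 𝔓 q (Classical.epsilon fun a => a ∈ orbit q (lamElt m))) 0
    (fun j => jacobi 𝔓 q (Classical.epsilon fun a => a ∈ orbit q (lamElt m)) ^ j) (pow_one _)
    (by ring) (fun n => by ring) (ncard_orbit_ne_zero hq (lamElt m))
  rw [map_zero, zero_mul, add_zero] at h
  simpa using h

open Classical in
-- The factor `A.ncard` in `dilate` is the number of `m` in the orbit, so the sum over orbits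
-- spreads out to one over all `m ≠ 0`.
lemma coeff_logDeriv_P_Lam (hq : d.Coprime q) {n : ℕ} (hn : n ≠ 0) :
    PowerSeries.coeff n (∑ A ∈ (univ.filter fun m : ZMod d => m ≠ 0).image
        (fun m => orbit q (lamElt m)),
      -dilate A.ncard fun j => jacobi 𝔓 q (Classical.epsilon fun a => a ∈ A) ^ j) =
    -∑ m : ZMod d with m ≠ 0, if (orbit q (lamElt m)).ncard ∣ n then
      jacobi 𝔓 q (Classical.epsilon fun a => a ∈ orbit q (lamElt m)) ^
        (n / (orbit q (lamElt m)).ncard) else 0 := by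
  rw [← sum_orbits hq (fun A => if A.ncard ∣ n then
      jacobi 𝔓 q (Classical.epsilon fun a => a ∈ A) ^ (n / A.ncard) else 0), map_sum,
    ← sum_neg_distrib]
  refine sum_congr rfl fun A _ => ?_
  rw [map_neg, dilate, PowerSeries.coeff_mk]
  simp [hn]

end OrbitProduct

/-! ### Jacobi sums over the finite subfields of an algebraically closed field -/

section FixedFieldJacobi

variable {F Ω Q : Type*} [Field F] [Fintype F] [Field Ω] [Algebra F Ω] [IsAlgClosed Ω]
variable [Field Q] [CharZero Q] [IsAlgClosed Q] {T : Ω →*₀ Q} {d : ℕ} [NeZero d]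

lemma fintypeCard_frobFixed {n : ℕ} (hn : n ≠ 0) [Fintype (frobFixed F Ω n)] :
    Fintype.card (frobFixed F Ω n) = Fintype.card F ^ n := by
  rw [← Nat.card_eq_fintype_card, card_frobFixed hn]

lemma jacobiAt_frobFixed (hT : Function.Injective T) {l n : ℕ} (hl : l ≠ 0) (hn : n ≠ 0)
    (hln : l ∣ n) [Fintype (frobFixed F Ω l)] [Fintype (frobFixed F Ω n)] {a : Fin 4 → ZMod d}
    (ha : ∀ i, ((Fintype.card F ^ l : ℕ) : ZMod d) * a i = a i) (hs : ∑ i, a i = 0) (h0 : a ≠ 0) :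
    jacobiAt (frobFixed F Ω n) T a = jacobiAt (frobFixed F Ω l) T a ^ (n / l) := by
  let _ : Algebra (frobFixed F Ω l) (frobFixed F Ω n) :=
    (IntermediateField.inclusion (frobFixed_le_of_dvd hln)).toRingHom.toAlgebra
  have : IsScalarTower (frobFixed F Ω l) (frobFixed F Ω n) Ω :=
    IsScalarTower.of_algebraMap_eq fun x => rfl
  have hr : Module.finrank (frobFixed F Ω l) (frobFixed F Ω n) = n / l := by
    have h := Module.card_eq_pow_finrank (K := frobFixed F Ω l) (V := frobFixed F Ω n)
    rw [fintypeCard_frobFixed hl, fintypeCard_frobFixed hn, ← pow_mul] at h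
    have h2 : n = l * _ := Nat.pow_right_injective Fintype.one_lt_card h
    exact (Nat.div_eq_of_eq_mul_right (Nat.pos_of_ne_zero hl) h2).symm
  rw [jacobiAt_lift (k := frobFixed F Ω l) hT (by rw [fintypeCard_frobFixed hl]; exact ha) hs h0, hr]

omit [CharZero Q] [IsAlgClosed Q] in
lemma jacobiAt_frobFixed_mul_pow {l : ℕ} (hl : l ≠ 0) [Fintype (frobFixed F Ω l)] {m : ZMod d}
    (hm : ((Fintype.card F ^ l : ℕ) : ZMod d) * m = m) (i : ℕ) :
    jacobiAt (frobFixed F Ω l) T (lamVec ((Fintype.card F : ZMod d) ^ i * m)) =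
      jacobiAt (frobFixed F Ω l) T (lamVec m) := by
  induction i with
  | zero => rw [pow_zero, one_mul]
  | succ i ih =>
    have hi : ((Fintype.card F ^ l : ℕ) : ZMod d) * ((Fintype.card F : ZMod d) ^ i * m) =
        (Fintype.card F : ZMod d) ^ i * m := by rw [mul_left_comm, hm]
    rw [← ih, ← jacobiAt_frobenius F (a := lamVec ((Fintype.card F : ZMod d) ^ i * m))]
    · congr 1
      funext j
      fin_cases j <;> simp [lamVec, pow_succ', mul_assoc]
      ring
    · rw [fintypeCard_frobFixed hl]
      exact mul_lamVec hi

end FixedFieldJacobi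

/-! ### The `L`-function and special values -/

section SpecialValues

/-- Root multiplicity, division and evaluation of polynomials all commute with a field embedding, so
the rational special value can be computed in `Qbar`. -/
lemma map_polySpecialValue {k K : Type*} [Field k] [Field K] (φ : k →+* K) (q : ℕ) (f : k[X]) :
    φ (polySpecialValue q f) = polySpecialValue q (f.map φ) := by
  have h : ((q : K)⁻¹) = φ (q : k)⁻¹ := by rw [map_inv₀, map_natCast]
  unfold polySpecialValue
  rw [h, ← Polynomial.eq_rootMultiplicity_map φ.injective,
    ← Polynomial.eval_map_apply, Polynomial.map_div]
  simp

lemma LSpecialValue_eq {F : Type*} [Field F] (W : WeierstrassCurve (RatFunc F)) {f : ℤ[X]}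
    (hf : LFunction W = (f : PowerSeries ℤ)) :
    LSpecialValue W = polySpecialValue (Nat.card F) (f.map (Int.castRingHom ℚ)) := by
  have h : ∃ f : ℤ[X], (f : PowerSeries ℤ) = LFunction W := ⟨f, hf.symm⟩
  unfold LSpecialValue
  rw [dif_pos h]
  congr 2
  exact Polynomial.coe_injective ℤ (h.choose_spec.trans hf)

end SpecialValues

/-! ### Comparison of the two logarithmic derivatives -/

section LFunctionEqP

open PowerSeries Finset

lemma nonempty_ringHom_of_isAlgClosed (F Ω : Type*) [Field F] [Finite F] [Field Ω] [IsAlgClosed Ω]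
    (p : ℕ) [Fact p.Prime] [CharP F p] [CharP Ω p] : Nonempty (F →+* Ω) := by
  let _ : Algebra (ZMod p) F := ZMod.algebra F p
  let _ : Algebra (ZMod p) Ω := ZMod.algebra Ω p
  have : Module.Finite (ZMod p) F := Module.Finite.of_finite
  exact ⟨(IsAlgClosed.lift : F →ₐ[ZMod p] Ω).toRingHom⟩

lemma constantCoeff_LFunction {F : Type*} [Field F] [Finite F]
    (W : WeierstrassCurve (RatFunc F)) : constantCoeff (LFunction W) = 1 := by
  have h := (hasProd_of_finite (finite_places_deg_le (F := F))
    (X_pow_deg_dvd_eulerFactor_sub_one W)).tprod_eq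
  have h0 : (finite_places_deg_le (F := F) 0).toFinset = ∅ := by
    rw [eq_empty_iff_forall_notMem]
    intro v hv
    rw [Set.Finite.mem_toFinset, Set.mem_ofPred_eq] at hv
    have := v.deg_pos
    omega
  rw [LFunction, h, ← coeff_zero_eq_constantCoeff_apply, coeff_mk, h0, prod_empty, coeff_zero_one]

lemma constantCoeff_P_Lam {Qbar : Type*} [Field Qbar] (𝔓 : Ideal (integralClosure ℤ Qbar))
    {d : ℕ} [NeZero d] {q : ℕ} (hq : d.Coprime q) :
    constantCoeff ((P 𝔓 q (Lam d) : Qbar[X]) : PowerSeries Qbar) = 1 := by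
  classical
  rw [P_Lam_eq, ← Polynomial.coeToPowerSeries.ringHom_apply, map_prod, map_prod]
  refine prod_eq_one fun A hA => ?_
  obtain ⟨m, _, rfl⟩ := mem_image.mp hA
  simp [ncard_orbit_ne_zero hq]

theorem map_LFunction_eq_P {F : Type*} [Field F] [Finite F] (p : ℕ) [CharP F p] (hp : 5 ≤ p)
    {Qbar : Type*} [Field Qbar] [CharZero Qbar] [IsAlgClosed Qbar]
    (𝔓 : Ideal (integralClosure ℤ Qbar)) [𝔓.IsPrime] (h𝔓 : (p : integralClosure ℤ Qbar) ∈ 𝔓)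
    {d : ℕ} (hd : d ≠ 0) (hdq : d.Coprime (Nat.card F)) :
    PowerSeries.map (Int.castRingHom Qbar) (LFunction (hessian F d)) =
      ((P 𝔓 (Nat.card F) (Lam d) : Qbar[X]) : PowerSeries Qbar) := by
  classical
  have := Fintype.ofFinite F
  have : NeZero d := ⟨hd⟩
  rw [Nat.card_eq_fintype_card] at hdq ⊢
  obtain ⟨f, hpp, hcard⟩ := FiniteField.card F p
  have hf : (f : ℕ) ≠ 0 := f.ne_zero
  have : 𝔓.IsMaximal := isMaximal_of_natCast_mem 𝔓 hpp h𝔓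
  let _ : Field (integralClosure ℤ Qbar ⧸ 𝔓) := Ideal.Quotient.field 𝔓
  have : IsAlgClosed (integralClosure ℤ Qbar ⧸ 𝔓) := isAlgClosed_residue 𝔓
  have : CharP (integralClosure ℤ Qbar ⧸ 𝔓) p := charP_residue 𝔓 hpp h𝔓
  have : Fact p.Prime := ⟨hpp⟩
  -- Any embedding of `F` will do: `P` depends on `F` only through its cardinality.
  obtain ⟨ι⟩ := nonempty_ringHom_of_isAlgClosed F (integralClosure ℤ Qbar ⧸ 𝔓) p
  let _ : Algebra F (integralClosure ℤ Qbar ⧸ 𝔓) := ι.toAlgebra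
  have hsmall : ∀ n : ℕ, 0 < n → n < p → (n : F) ≠ 0 := fun n h0 hn h => by
    rw [CharP.cast_eq_zero_iff F p] at h
    exact absurd (Nat.le_of_dvd h0 h) (by omega)
  have h2 : (2 : F) ≠ 0 := by exact_mod_cast hsmall 2 (by omega) (by omega)
  have h3 : (3 : F) ≠ 0 := by exact_mod_cast hsmall 3 (by omega) (by omega)
  set T := teichHom 𝔓 hpp h𝔓 hf hcard with hT
  have hTi : Function.Injective T := teichHom_injective 𝔓 hpp h𝔓 hf hcard
  refine ((isLogDeriv_LFunction (hessian F d)).map (Int.castRingHom Qbar)).unique ?_ ?_ ?_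
  rotate_left
  · rw [← coeff_zero_eq_constantCoeff_apply, coeff_map, coeff_mk]
    simp [dilate]
  · rw [constantCoeff_P_Lam 𝔓 hdq, ← coeff_zero_eq_constantCoeff_apply, coeff_map,
      coeff_zero_eq_constantCoeff_apply, constantCoeff_LFunction, map_one]
  convert isLogDeriv_P_Lam 𝔓 hdq using 1
  ext n
  rw [coeff_map, coeff_mk]
  by_cases hn : n = 0
  · subst hn
    simp [dilate]
  rw [coeff_logDeriv_P_Lam 𝔓 hdq hn]
  have hfin : ∀ l : ℕ, l ≠ 0 → Nonempty (Fintype (frobFixed F (integralClosure ℤ Qbar ⧸ 𝔓) l)) :=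
    fun l hl => by
      have := finite_frobFixed (F := F) (Ω := integralClosure ℤ Qbar ⧸ 𝔓) hl
      exact ⟨Fintype.ofFinite _⟩
  obtain ⟨hfn⟩ := hfin n hn
  have hcoeff := coeff_logDeriv_LFunction_hessian (F := F)
    (E := frobFixed F (integralClosure ℤ Qbar ⧸ 𝔓) n) h2 h3 hd
  rw [finrank_frobFixed hn] at hcoeff
  have h3' : (3 : frobFixed F (integralClosure ℤ Qbar ⧸ 𝔓) n) ≠ 0 := by
    rw [← map_ofNat (algebraMap F _), map_ne_zero]
    exact h3
  have h2' : ringChar (frobFixed F (integralClosure ℤ Qbar ⧸ 𝔓) n) ≠ 2 := by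
    intro h
    have h0 := ringChar.Nat.cast_ringChar (R := frobFixed F (integralClosure ℤ Qbar ⧸ 𝔓) n)
    rw [h, ← map_natCast (algebraMap F _), _root_.map_eq_zero] at h0
    exact h2 (by exact_mod_cast h0)
  have hmain := sum_frobSum_eq_sum_jacobiAt (d := d) hTi h2' h3'
  rw [hcoeff, map_neg, eq_intCast, hmain]
  congr 1
  rw [← sum_filter]
  have hcardn := fintypeCard_frobFixed (F := F) (Ω := integralClosure ℤ Qbar ⧸ 𝔓) hn
  -- The index sets agree since `q^n m = m` exactly when the orbit length divides `n`. The summands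
  -- agree by lifting from the field with `q^l` elements, where `l` is the orbit length.
  refine sum_congr ?_ fun m hm => ?_
  · ext m
    rw [mem_erase, mem_torsionIndex, mem_filter, mem_filter, ← pow_smul_eq_iff hdq,
      nsmul_lamElt_eq_iff, hcardn]
    simp
  · rw [mem_filter, mem_filter] at hm
    obtain ⟨⟨_, hm0⟩, hdvd⟩ := hm
    set l := (orbit (Fintype.card F) (lamElt m)).ncard with hl
    have hl0 : l ≠ 0 := ncard_orbit_ne_zero hdq _
    obtain ⟨hfl⟩ := hfin l hl0
    have hlm : ((Fintype.card F ^ l : ℕ) : ZMod d) * m = m := by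
      rw [← nsmul_lamElt_eq_iff, pow_smul_eq_iff hdq]
    -- The representative chosen in `P` is some `qⁱ m`, which has the same orbit and the same Jacobi
    -- sum as `m`.
    have hmem := epsilon_mem_orbit (q := Fintype.card F) (lamElt m)
    obtain ⟨i, hi⟩ := mem_orbit_lamElt hmem
    have horb := orbit_eq_of_mem hdq hmem
    rw [hi] at horb ⊢
    rw [jacobiAt_frobFixed hTi hl0 hn hdvd (mul_lamVec hlm) (lamElt m).2 (lamVec_ne_zero hm0),
      jacobi_eq_jacobiAt 𝔓 hpp h𝔓 hf hcard rfl _ hl0 (by rw [horb])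
        (mul_lamVec (by rw [mul_left_comm, hlm]))]
    exact congrArg (· ^ (n / l)) (jacobiAt_frobFixed_mul_pow hl0 hlm i).symm

end LFunctionEqP

end HessianCurve

end

/-! ### Descent from `Qbar` to integral polynomials and special values -/

theorem corollary4p4 {F : Type*} [Field F] [Finite F] (p : ℕ) [CharP F p] (hp : 5 ≤ p)
    {Qbar : Type*} [Field Qbar] [Algebra ℚ Qbar] [IsAlgClosure ℚ Qbar]
    (𝔓 : Ideal (integralClosure ℤ Qbar)) [𝔓.IsPrime]
    (h𝔓 : (p : integralClosure ℤ Qbar) ∈ 𝔓)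
    (d : ℕ) (hd : 2 ≤ d) (hdq : d.Coprime (Nat.card F)) :
    Multipliable (HessianCurve.eulerFactor (HessianCurve.hessian F d)) ∧
    (∃ f : Polynomial ℤ,
      HessianCurve.LFunction (HessianCurve.hessian F d) = (f : PowerSeries ℤ) ∧
      f.map (Int.castRingHom Qbar) =
        HessianCurve.P 𝔓 (Nat.card F) (HessianCurve.Lam d)) ∧
    algebraMap ℚ Qbar (HessianCurve.LSpecialValue (HessianCurve.hessian F d)) =
      HessianCurve.polySpecialValue (Nat.card F)
        (HessianCurve.P 𝔓 (Nat.card F) (HessianCurve.Lam d)) := by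
  have : IsAlgClosed Qbar := IsAlgClosure.isAlgClosed ℚ
  have : CharZero Qbar := algebraRat.charZero Qbar
  have hL := HessianCurve.map_LFunction_eq_P p hp 𝔓 h𝔓 (d := d) (by omega) hdq
  set L := HessianCurve.LFunction (HessianCurve.hessian F d) with hLdef
  set g := HessianCurve.P 𝔓 (Nat.card F) (HessianCurve.Lam d) with hg
  have hcoeff : ∀ n, ((PowerSeries.coeff n L : ℤ) : Qbar) = g.coeff n := fun n => by
    rw [← Polynomial.coeff_coe, ← hL, PowerSeries.coeff_map, eq_intCast]
  -- Truncating after the degree of `g` loses nothing: the later coefficients of `L` vanish in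
  -- `Qbar`, hence in `ℤ`.
  set f : Polynomial ℤ := PowerSeries.trunc (g.natDegree + 1) L with hf
  have hLf : L = (f : PowerSeries ℤ) := by
    ext n
    rw [Polynomial.coeff_coe, hf, PowerSeries.coeff_trunc]
    split_ifs with hn
    · rfl
    · have h := hcoeff n
      rw [Polynomial.coeff_eq_zero_of_natDegree_lt (by omega)] at h
      exact_mod_cast h
  have hfg : f.map (Int.castRingHom Qbar) = g := by
    ext n
    rw [Polynomial.coeff_map, ← Polynomial.coeff_coe, ← hLf, eq_intCast, hcoeff]
  refine ⟨HessianCurve.multipliable_eulerFactor _, ⟨f, hLf, hfg⟩, ?_⟩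
  rw [HessianCurve.LSpecialValue_eq _ hLf, HessianCurve.map_polySpecialValue, Polynomial.map_map,
    ← hfg]
  congr 2
  exact RingHom.ext_int _ _
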